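/- Let $N\ge 2$, $L>0$, $T>0$, and decompose $(0,L)$ into the subdomains $\Omega_i=(x_{i-1},x_i)$, $1\le i\le N$, where $0=x_0<x_1<\dots<x_N=L$; put $h_{\min}=\min_{1\le i\le N}(x_i-x_{i-1})$. Let $w_i^0\in L^\infty(0,T)$, $1\le i\le N-1$, be an initial guess on the interfaces $x_i$, and let $w_0^k=w_N^k=0$ for all $k\ge 0$. Let $w_i^k$, $k\ge1$, be generated by the Neumann–Neumann waveform relaxation (NNWR) algorithm for the error equations of the heat equation on $(0,L)\times(0,T)$ with relaxation parameter $\theta=1/4$: for $k=1,2,\dots$ 1. (Dirichlet step) for $1\le i\le N$, $u_i^k$ solves $\partial_t u_i^k-\partial_{xx}u_i^k=0$ in $\Omega_i\times(0,T)$, $u_i^k(x,0)=0$, $u_i^k(x_{i-1},t)=w_{i-1}^{k-1}(t)$, $u_i^k(x_i,t)=w_i^{k-1}(t)$; 2. (Neumann step) for $1\le i\le N$, $\psi_i^k$ solves $\partial_t\psi_i^k-\partial_{xx}\psi_i^k=0$ in $\Omega_i\times(0,T)$, $\psi_i^k(x,0)=0$, with $-\partial_x\psi_i^k(x_{i-1},t)=(\partial_xu_{i-1}^k-\partial_xu_i^k)(x_{i-1},t)$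 if $i\ge 2$, $\partial_x\psi_i^k(x_i,t)=(\partial_xu_i^k-\partial_xu_{i+1}^k)(x_i,t)$ if $i\le N-1$, and with $\psi_1^k(0,t)=0$, $\psi_N^k(L,t)=0$ at the physical boundary; 3. (update) $w_i^k(t)=w_i^{k-1}(t)-\theta\left(\psi_i^k(x_i,t)+\psi_{i+1}^k(x_i,t)\right)$, $1\le i\le N-1$. (The heat problems are understood in the very weak sense: $u_i^k,\psi_i^k$ and their boundary values are integrable, and the boundary derivatives are distributions in time.) Then for every $k\ge 0$ $$\max_{1\le i\le N-1}\|w_i^k\|_{L^\infty(0,T)}\le\left(\frac{\sqrt6}{1-e^{-(2k+1)h_{\min}^2/T}}\right)^{2k}e^{-k^2h_{\min}^2/T}\max_{1\le i\le N-1}\|w_i^0\|_{L^\infty(0,T)},$$ and the convergence is superlinear: $\left(\max_{1\le i\le N-1}\|w_i^k\|_{L^\infty(0,T)}\right)^{1/k}\to0$ as $k\to\infty$. -/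

import Mathlib

open MeasureTheory Set Filter TopologicalSpace
open scoped Distributions Topology

namespace NNWR

/-- The time domain `(-∞, T)` on which test functions in time live. Test functions vanish near
`t = T` but not at `t = 0`, so that they see the initial condition. -/
def timeDomain (T : ℝ) : Opens ℝ := ⟨Iio T, isOpen_Iio⟩

/-- The space-time domain `ℝ × (-∞, T)`, with points written `(x, t)`. -/
def spaceTimeDomain (T : ℝ) : Opens (ℝ × ℝ) :=
  ⟨{p | p.2 < T}, isOpen_lt continuous_snd continuous_const⟩

theorem hasCompactSupport_slice {T : ℝ} (c : ℝ) (φ : 𝓓(spaceTimeDomain T, ℝ)) :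
    HasCompactSupport (fun t => φ (c, t)) ∧ tsupport (fun t => φ (c, t)) ⊆ timeDomain T := by
  have hsub : tsupport (fun t => φ (c, t)) ⊆ (fun t : ℝ => (c, t)) ⁻¹' tsupport φ := by
    refine closure_minimal ?_ ((isClosed_tsupport _).preimage (by fun_prop))
    intro t ht
    exact subset_tsupport _ ht
  refine ⟨?_, fun t ht => φ.tsupport_subset (hsub ht)⟩
  refine (φ.hasCompactSupport.isCompact.image continuous_snd).of_isClosed_subset
    (isClosed_tsupport _) ?_
  intro t ht
  exact ⟨(c, t), hsub ht, rfl⟩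

/-- The restriction `t ↦ φ(c, t)` of a space-time test function to the line `x = c`. -/
noncomputable def slice {T : ℝ} (c : ℝ) (φ : 𝓓(spaceTimeDomain T, ℝ)) : 𝓓(timeDomain T, ℝ) where
  toFun t := φ (c, t)
  contDiff' := φ.contDiff.comp (contDiff_const.prodMk contDiff_id)
  hasCompactSupport' := (hasCompactSupport_slice c φ).1
  tsupport_subset' := (hasCompactSupport_slice c φ).2

/-- `u` is a very weak (transposition) solution of `∂ₜu - ∂ₓₓu = 0` on `(a, b) × (0, T)` with
initial value `u(x, 0) = 0`, whose boundary values are the integrable functions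
`u(a, ·) = wa`, `u(b, ·) = wb`, and whose boundary derivatives, extended by zero to `t < 0`, are
the distributions `∂ₓu(a, ·) = qa`, `∂ₓu(b, ·) = qb` on `(-∞, T)`.
The identity is the heat equation multiplied by a test function `φ` and integrated by parts
over `(a, b) × (0, T)`. -/
structure IsHeatSolution (a b T : ℝ) (u : ℝ × ℝ → ℝ) (wa wb : ℝ → ℝ)
    (qa qb : 𝓓'(timeDomain T, ℝ)) : Prop where
  integrableOn : IntegrableOn u (Ioo a b ×ˢ Ioo 0 T)
  integrableOn_left : IntegrableOn wa (Ioo 0 T)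
  integrableOn_right : IntegrableOn wb (Ioo 0 T)
  weak_eq : ∀ φ : 𝓓(spaceTimeDomain T, ℝ),
    (∫ p in Ioo a b ×ˢ Ioo 0 T,
        u p * (deriv (fun t => φ (p.1, t)) p.2 + iteratedDeriv 2 (fun x => φ (x, p.2)) p.1))
      = (∫ t in Ioo 0 T, wb t * deriv (fun x => φ (x, t)) b)
        - (∫ t in Ioo 0 T, wa t * deriv (fun x => φ (x, t)) a)
        - (qb (slice b φ) - qa (slice a φ))

/-- One step `w ↦ w'` of the Neumann–Neumann waveform relaxation (error equations for the heat
equation) with relaxation parameter `θ`, for the subdomains `(x (i - 1), x i)`, `1 ≤ i ≤ N`.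
Here `w i`, `w' i` are the old and new values at the point `x i`; `duL i`, `duR i` are the
derivatives of the Dirichlet solution `u i` at the left and right end of subdomain `i`; `ψL i`,
`ψR i` and `dψL i`, `dψR i` are the boundary values and boundary derivatives of the Neumann
solution `ψ i`. -/
def IsStep (N : ℕ) (x : ℕ → ℝ) (T θ : ℝ) (w w' : ℕ → ℝ → ℝ) : Prop :=
  ∃ (u ψ : ℕ → ℝ × ℝ → ℝ) (duL duR dψL dψR : ℕ → 𝓓'(timeDomain T, ℝ)) (ψL ψR : ℕ → ℝ → ℝ),
    -- Dirichlet step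
    (∀ i ∈ Finset.Icc 1 N,
      IsHeatSolution (x (i - 1)) (x i) T (u i) (w (i - 1)) (w i) (duL i) (duR i)) ∧
    -- Neumann step
    (∀ i ∈ Finset.Icc 1 N,
      IsHeatSolution (x (i - 1)) (x i) T (ψ i) (ψL i) (ψR i) (dψL i) (dψR i)) ∧
    (∀ i ∈ Finset.Ioo 0 N,
      dψR i = duR i - duL (i + 1) ∧ -dψL (i + 1) = duR i - duL (i + 1)) ∧
    (∀ᵐ t ∂volume.restrict (Ioo 0 T), ψL 1 t = 0) ∧
    (∀ᵐ t ∂volume.restrict (Ioo 0 T), ψR N t = 0) ∧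
    -- update of the interface values
    (∀ i ∈ Finset.Ioo 0 N, ∀ᵐ t ∂volume.restrict (Ioo 0 T),
      w' i t = w i t - θ * (ψR i t + ψL (i + 1) t))

/-- `w k i`, `0 ≤ i ≤ N`, are the values at the points `x i` after `k` iterations of the
Neumann–Neumann waveform relaxation, with `w k i = 0` at the two physical boundary points. -/
structure IsIteration (N : ℕ) (x : ℕ → ℝ) (T θ : ℝ) (w : ℕ → ℕ → ℝ → ℝ) : Prop where
  left_eq_zero : ∀ k, ∀ᵐ t ∂volume.restrict (Ioo 0 T), w k 0 t = 0
  right_eq_zero : ∀ k, ∀ᵐ t ∂volume.restrict (Ioo 0 T), w k N t = 0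
  step : ∀ k, IsStep N x T θ (w k) (w (k + 1))

/-- The maximum over the interfaces `x 1, …, x (N - 1)` of the `L^∞(0, T)` norms. -/
noncomputable def maxNorm (N : ℕ) (T : ℝ) (w : ℕ → ℝ → ℝ) : ENNReal :=
  ⨆ i ∈ Finset.Ioo 0 N, eLpNorm (w i) ⊤ (volume.restrict (Ioo 0 T))

end NNWR

/-! Everything is done by transposition, on test functions in time. Let `propagate c` be the
operator $P_c=e^{-c\sqrt{-\partial_t}}$, which averages a test function over the random first
passage delay $c^2U^2/4$. On test functions vanishing near $T$, $P_c\eta(t)$ solves the backward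
heat equation in $(c,t)$, the $P_c$ form a positivity preserving semigroup (`propagate_add`), and,
since nothing survives beyond $T$, $P_c$ carries a factor $e^{-c^2/(4T)}$ (`abs_propagate_le`,
`setIntegral_propagate_le`).

Testing the weak formulation on $(a,b)$ with $P_{c+x-a}\eta$ and $P_{c+b-x}\eta$ gives two linear
relations between boundary values and boundary derivatives (`IsHeatSolution.heatRel`). Their only
coefficient is $e$, the translation of $c$ by the length $b-a$. One step of the algorithm is thus
linear algebra over the commutative ring of delays, and eliminating all boundary derivatives and
Neumann values leaves a recurrence for the interface values (`update_interior` and its boundary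
variants). The choice $\theta=1/4$ removes exactly the undelayed part: every coefficient of an old
value contains a delay of at least $2h_{\min}$.

The elimination concerns functions of $c>0$ which, for the values $w$, are derivatives in $c$ of
$c\mapsto\int w\,P_c\eta$. As these pairings tend to zero when $c\to\infty$, a relation between
derivatives integrates to one between pairings (`eval_eq_zero_of_derivPairs`), and the same decay
permits cancelling factors $1-e^n$.

For the estimate, each functional is compared with a positive one that decreases under delays. After
division the update is a sum of at most six terms, each dominated by $D(1-D)^{-2}$ applied to the
dominating functional, where $D$ is the delay by $2h_{\min}$ (`IsStep.dominated`). Six rather than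
eight, because a difference $e_a^2-e_b^2$ counts once: its quotient contains
$\sinh((b-a)z)/\sinh(bz)$, the transform of a diffusion's exit law, hence positive
(`Dominated.exit`).

After $k$ steps the dominating functional is $6^kD^k(1-D)^{-2k}$ applied to a constant $M$. The
Gaussian factor at distance $2(k+m)h$ is at most $e^{-k^2h^2/T}r^m$ with $r=e^{-(2k+1)h^2/T}$, so
the series sum to $6^k(1-r)^{-2k}e^{-k^2h^2/T}M$. Testing with bumps returns to $L^\infty$
(`ae_abs_le_of_eval_le`), and the $k$-th root of the bound tends to zero. -/

open scoped ContDiff NNReal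

/-! ### The law of the normalised first passage time -/

namespace NNWR

/-- The density of `1 / V`, where `V` has the half-normal density `2 / √π * exp (-v ^ 2)`. -/
noncomputable def levyDensity (u : ℝ) : ℝ :=
  2 / √Real.pi * ((u ^ 2)⁻¹ * Real.exp (-(u ^ 2)⁻¹))

theorem levyDensity_nonneg (u : ℝ) : 0 ≤ levyDensity u := by
  unfold levyDensity; positivity

theorem measurable_levyDensity : Measurable levyDensity := by
  unfold levyDensity; fun_prop

/-- The law of `1 / V`, where `V` has the half-normal density `2 / √π * exp (-v ^ 2)`. If `U` has
this law, then `c ^ 2 * U ^ 2 / 4` is the first time at which the diffusion with generator `∂ₓₓ`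
travels the distance `c`. -/
noncomputable def levyMeasure : Measure ℝ :=
  (volume.restrict (Ioi 0)).withDensity fun u => ENNReal.ofReal (levyDensity u)

theorem integral_levyMeasure (g : ℝ → ℝ) :
    ∫ u, g u ∂levyMeasure = ∫ u in Ioi 0, levyDensity u * g u := by
  rw [levyMeasure, integral_withDensity_eq_integral_toReal_smul
    measurable_levyDensity.ennreal_ofReal (by simp)]
  simp [ENNReal.toReal_ofReal (levyDensity_nonneg _)]

theorem integrable_levyMeasure_iff (g : ℝ → ℝ) :
    Integrable g levyMeasure ↔ IntegrableOn (fun u => levyDensity u * g u) (Ioi 0) := by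
  rw [levyMeasure, integrable_withDensity_iff_integrable_smul'
    measurable_levyDensity.ennreal_ofReal (by simp)]
  simp [ENNReal.toReal_ofReal (levyDensity_nonneg _), IntegrableOn]

theorem levyDensity_mul_eq (g : ℝ → ℝ) {u : ℝ} (hu : u ∈ Ioi (0 : ℝ)) :
    levyDensity u * g u = (|(-1 : ℝ)| * u ^ ((-1 : ℝ) - 1)) •
      (fun v : ℝ => 2 / √Real.pi * (Real.exp (-v ^ 2) * g v⁻¹)) (u ^ (-1 : ℝ)) := by
  have hu : 0 < u := hu
  have h2 : u ^ ((-1 : ℝ) - 1) = (u ^ 2)⁻¹ := by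
    rw [show (-1 : ℝ) - 1 = -((2 : ℕ) : ℝ) by norm_num, Real.rpow_neg hu.le, Real.rpow_natCast]
  simp only [Real.rpow_neg_one, h2, levyDensity, smul_eq_mul, inv_inv, inv_pow]
  simp
  ring

/-- The substitution $v=1/u$ turns integrals against the Lévy density into Gaussian ones. -/
theorem setIntegral_levyDensity_mul (g : ℝ → ℝ) :
    ∫ u in Ioi 0, levyDensity u * g u =
      ∫ v in Ioi 0, 2 / √Real.pi * (Real.exp (-v ^ 2) * g v⁻¹) := by
  rw [← integral_comp_rpow_Ioi (fun v : ℝ => 2 / √Real.pi * (Real.exp (-v ^ 2) * g v⁻¹))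
    (show (-1 : ℝ) ≠ 0 by norm_num)]
  exact setIntegral_congr_fun measurableSet_Ioi fun u hu => levyDensity_mul_eq g hu

theorem integrableOn_levyDensity : IntegrableOn levyDensity (Ioi 0) := by
  have h := (integrableOn_Ioi_comp_rpow_iff
    (fun v : ℝ => 2 / √Real.pi * (Real.exp (-v ^ 2) * (fun _ => (1 : ℝ)) v⁻¹))
    (show (-1 : ℝ) ≠ 0 by norm_num)).2 (by
      have := (integrable_exp_neg_mul_sq (show (0 : ℝ) < 1 by norm_num)).const_mul (2 / √Real.pi)
      simpa using this.integrableOn)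
  refine h.congr_fun (fun u hu => ?_) measurableSet_Ioi
  simpa using (levyDensity_mul_eq (fun _ => 1) hu).symm

theorem integral_exp_neg_sq_Ioi : ∫ v in Ioi (0 : ℝ), Real.exp (-v ^ 2) = √Real.pi / 2 := by
  simpa using integral_gaussian_Ioi 1

theorem two_div_sqrt_pi_mul : 2 / √Real.pi * (√Real.pi / 2) = 1 := by
  have : √Real.pi ≠ 0 := (Real.sqrt_pos.2 Real.pi_pos).ne'
  field_simp

theorem setIntegral_levyDensity : ∫ u in Ioi 0, levyDensity u = 1 := by
  have h := setIntegral_levyDensity_mul (fun _ => 1)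
  simp only [mul_one] at h
  rw [h, integral_const_mul, integral_exp_neg_sq_Ioi, two_div_sqrt_pi_mul]

instance : IsProbabilityMeasure levyMeasure := by
  constructor
  rw [levyMeasure, withDensity_apply _ MeasurableSet.univ, Measure.restrict_univ,
    ← ofReal_integral_eq_lintegral_ofReal integrableOn_levyDensity
      (ae_of_all _ levyDensity_nonneg), setIntegral_levyDensity, ENNReal.ofReal_one]

theorem ae_pos_levyMeasure : ∀ᵐ u ∂levyMeasure, 0 < u :=
  (withDensity_absolutelyContinuous _ _) (ae_restrict_mem measurableSet_Ioi)

/-- The event $U<r$ is $V>1/r$, and the Gaussian tail is bounded by shifting: $(v+1/r)^2\ge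
v^2+1/r^2$ for $v\ge0$. All superlinear decay comes from here. -/
theorem levyMeasure_real_Iio_le {r : ℝ} (hr : 0 < r) :
    levyMeasure.real (Iio r) ≤ Real.exp (-(r ^ 2)⁻¹) := by
  have hg : Integrable (fun v : ℝ => Real.exp (-v ^ 2)) := by
    simpa using integrable_exp_neg_mul_sq (show (0 : ℝ) < 1 by norm_num)
  rw [← integral_indicator_one measurableSet_Iio, integral_levyMeasure,
    setIntegral_levyDensity_mul, integral_const_mul]
  have h1 : ∫ v in Ioi (0 : ℝ), Real.exp (-v ^ 2) * (Iio r).indicator (1 : ℝ → ℝ) v⁻¹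
      = ∫ v in Ioi r⁻¹, Real.exp (-v ^ 2) := by
    have : ∀ v ∈ Ioi (0 : ℝ), Real.exp (-v ^ 2) * (Iio r).indicator (1 : ℝ → ℝ) v⁻¹
        = (Ioi r⁻¹).indicator (fun v => Real.exp (-v ^ 2)) v := by
      intro v hv
      have : v⁻¹ < r ↔ r⁻¹ < v := inv_lt_comm₀ hv hr
      by_cases h : r⁻¹ < v <;> simp [indicator, this, h]
    rw [setIntegral_congr_fun measurableSet_Ioi this, setIntegral_indicator measurableSet_Ioi]
    congr 2
    ext v
    simp only [mem_inter_iff, mem_Ioi, and_iff_right_iff_imp]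
    exact (inv_pos.2 hr).trans
  have h2 : ∫ v in Ioi r⁻¹, Real.exp (-v ^ 2) = ∫ v in Ioi (0 : ℝ), Real.exp (-(v + r⁻¹) ^ 2) := by
    have := (measurePreserving_add_right volume r⁻¹).setIntegral_preimage_emb
      (measurableEmbedding_addRight r⁻¹) (fun v : ℝ => Real.exp (-v ^ 2)) (Ioi r⁻¹)
    simpa using this.symm
  have h3 : ∫ v in Ioi (0 : ℝ), Real.exp (-(v + r⁻¹) ^ 2)
      ≤ ∫ v in Ioi (0 : ℝ), Real.exp (-(r ^ 2)⁻¹) * Real.exp (-v ^ 2) := by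
    refine setIntegral_mono_on (hg.comp_add_right r⁻¹).integrableOn
      (hg.const_mul _).integrableOn measurableSet_Ioi fun v hv => ?_
    rw [← Real.exp_add, Real.exp_le_exp, ← inv_pow]
    have : 0 ≤ v * r⁻¹ := mul_nonneg (le_of_lt hv) (inv_pos.2 hr).le
    nlinarith
  rw [h1, h2]
  calc _ ≤ 2 / √Real.pi * (Real.exp (-(r ^ 2)⁻¹) * (√Real.pi / 2)) := by
        rw [integral_const_mul, integral_exp_neg_sq_Ioi] at h3
        gcongr
    _ = Real.exp (-(r ^ 2)⁻¹) := by rw [mul_left_comm, two_div_sqrt_pi_mul, mul_one]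

/-! ### Test functions in time and their backward propagation -/

/-- The smooth functions on the real line that vanish on a half-line `[T', ∞)` with `T' < T`. -/
def finalTest (T : ℝ) : Submodule ℝ (ℝ → ℝ) where
  carrier := {η | ContDiff ℝ ∞ η ∧ ∃ T' < T, ∀ t, T' ≤ t → η t = 0}
  zero_mem' := ⟨contDiff_const, T - 1, by linarith, fun _ _ => rfl⟩
  add_mem' := by
    rintro η ζ ⟨h, S, hS, hη⟩ ⟨h', S', hS', hζ⟩
    refine ⟨h.add h', max S S', max_lt hS hS', fun t ht => ?_⟩
    simp [hη t ((le_max_left _ _).trans ht), hζ t ((le_max_right _ _).trans ht)]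
  smul_mem' := by
    rintro c η ⟨h, S, hS, hη⟩
    exact ⟨contDiff_const.smul h, S, hS, fun t ht => by simp [hη t ht]⟩

/-- The backward propagation over the distance `c`: the operator `exp (-c √(-∂ₜ))`. -/
noncomputable def propagate (c : ℝ) (η : ℝ → ℝ) (t : ℝ) : ℝ :=
  ∫ u, η (t + c ^ 2 * u ^ 2 / 4) ∂levyMeasure

theorem propagate_zero (η : ℝ → ℝ) : propagate 0 η = η := by
  ext t; simp [propagate]

variable {T : ℝ} {η : ℝ → ℝ}

theorem finalTest.continuous (hη : η ∈ finalTest T) : Continuous η := hη.1.continuous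

theorem finalTest.eq_zero (hη : η ∈ finalTest T) {t : ℝ} (ht : T ≤ t) : η t = 0 := by
  obtain ⟨-, S, hS, h⟩ := hη
  exact h t (hS.le.trans ht)

/-- A bound for a test function on `[t₀, ∞)`. -/
theorem finalTest.exists_bound (hη : η ∈ finalTest T) (t₀ : ℝ) :
    ∃ B, 0 ≤ B ∧ ∀ t, t₀ ≤ t → |η t| ≤ B := by
  obtain ⟨B, hB⟩ := (isCompact_Icc (a := t₀) (b := T)).exists_bound_of_continuousOn
    hη.1.continuous.continuousOn
  refine ⟨max B 0, le_max_right _ _, fun t ht => ?_⟩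
  rcases le_total T t with h | h
  · simp [finalTest.eq_zero hη h]
  · exact (hB t ⟨ht, h⟩).trans (le_max_left _ _)

theorem finalTest.deriv_mem (hη : η ∈ finalTest T) : deriv η ∈ finalTest T := by
  obtain ⟨h, S, hS, h0⟩ := hη
  refine ⟨?_, (S + T) / 2, by linarith, fun t ht => ?_⟩
  · exact (contDiff_infty_iff_deriv.1 h).2
  · have : η =ᶠ[𝓝 t] fun _ => 0 := by
      filter_upwards [lt_mem_nhds (show S < t by linarith)] with s hs using h0 s hs.le
    rw [this.deriv_eq, deriv_const]

theorem integrable_propagate (hη : η ∈ finalTest T) (c t : ℝ) :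
    Integrable (fun u => η (t + c ^ 2 * u ^ 2 / 4)) levyMeasure := by
  obtain ⟨B, -, hB⟩ := finalTest.exists_bound hη t
  refine (integrable_const B).mono' ?_ (ae_of_all _ fun u => hB _ ?_)
  · have := hη.1.continuous
    exact (by fun_prop : Continuous fun u : ℝ => η (t + c ^ 2 * u ^ 2 / 4)).aestronglyMeasurable
  · have : 0 ≤ c ^ 2 * u ^ 2 / 4 := by positivity
    linarith

theorem continuous_propagate (hη : η ∈ finalTest T) :
    Continuous fun p : ℝ × ℝ => propagate p.1 η p.2 := by
  have hc := hη.1.continuous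
  refine continuous_iff_continuousAt.2 fun p => ?_
  obtain ⟨B, -, hB⟩ := finalTest.exists_bound hη (p.2 - 1)
  refine continuousAt_of_dominated (bound := fun _ => B) ?_ ?_ (integrable_const B) ?_
  · refine Eventually.of_forall fun q => Continuous.aestronglyMeasurable ?_
    fun_prop
  · filter_upwards [(continuous_snd.tendsto p).eventually (lt_mem_nhds (sub_one_lt p.2))] with q hq
    refine ae_of_all _ fun u => hB _ ?_
    have : 0 ≤ q.1 ^ 2 * u ^ 2 / 4 := by positivity
    linarith
  · refine ae_of_all _ fun u => Continuous.continuousAt ?_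
    fun_prop

theorem propagate_eq_zero {S : ℝ} (h : ∀ t, S ≤ t → η t = 0) (c : ℝ) {t : ℝ} (ht : S ≤ t) :
    propagate c η t = 0 := by
  have : ∀ u, η (t + c ^ 2 * u ^ 2 / 4) = 0 := fun u => h _ (by
    have : 0 ≤ c ^ 2 * u ^ 2 / 4 := by positivity
    linarith)
  simp [propagate, this]

theorem propagate_nonneg {t₀ : ℝ} (h : ∀ t, t₀ ≤ t → 0 ≤ η t) (c : ℝ) {t : ℝ} (ht : t₀ ≤ t) :
    0 ≤ propagate c η t :=
  integral_nonneg fun u => h _ (by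
    have : 0 ≤ c ^ 2 * u ^ 2 / 4 := by positivity
    linarith)

/-- Gaussian decay of the propagation in the distance. -/
theorem abs_propagate_le {B t₀ c t : ℝ} (hη : η ∈ finalTest T) (hB : ∀ t, t₀ ≤ t → |η t| ≤ B)
    (hc : 0 < c) (ht₀ : t₀ < T) (ht : t₀ ≤ t) :
    |propagate c η t| ≤ B * Real.exp (-(c ^ 2 / (4 * (T - t₀)))) := by
  have hTt : 0 < T - t₀ := sub_pos.2 ht₀
  have hB0 : 0 ≤ B := (abs_nonneg _).trans (hB t₀ le_rfl)
  -- The threshold solves $c^2r^2/4=T-t_0$: for $u\ge r$ the argument of $\eta$ lies beyond $T$, so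
  -- only the event $U<r$ contributes.
  set r := 2 * √(T - t₀) / c with hr
  have hr0 : 0 < r := by positivity
  have hr2 : (r ^ 2)⁻¹ = c ^ 2 / (4 * (T - t₀)) := by
    rw [hr, div_pow, mul_pow, Real.sq_sqrt hTt.le, inv_div]; norm_num
  rw [← hr2]
  calc |propagate c η t| ≤ ∫ u, (Iio r).indicator (fun _ => B) u ∂levyMeasure := by
        rw [← Real.norm_eq_abs]
        refine norm_integral_le_of_norm_le
          ((integrable_const B).indicator measurableSet_Iio) ?_
        filter_upwards [ae_pos_levyMeasure] with u hu
        have h0 : 0 ≤ c ^ 2 * u ^ 2 / 4 := by positivity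
        by_cases h : u < r
        · simpa [indicator, h] using hB _ (by linarith)
        · have h1 : r ^ 2 ≤ u ^ 2 := pow_le_pow_left₀ hr0.le (not_lt.1 h) 2
          have h2 : T ≤ t + c ^ 2 * u ^ 2 / 4 := by
            have : c ^ 2 * r ^ 2 / 4 = T - t₀ := by
              rw [hr, div_pow, mul_pow, Real.sq_sqrt hTt.le]; field_simp; norm_num
            have : c ^ 2 * r ^ 2 ≤ c ^ 2 * u ^ 2 := by gcongr
            linarith
          simp [indicator, h, finalTest.eq_zero hη h2]
    _ = B * levyMeasure.real (Iio r) := by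
        rw [integral_indicator_const _ measurableSet_Iio, smul_eq_mul, mul_comm]
    _ ≤ _ := by gcongr; exact levyMeasure_real_Iio_le hr0

end NNWR
-- Smoothness of the propagation and the backward heat equation
namespace NNWR

/-- If all $u$-supports lie in a common compact set for $p$ near $p_0$, continuity of $F'$ already
supplies a constant dominating function. -/
theorem hasDerivAt_integral_of_compact_support {ν : Measure ℝ} [IsFiniteMeasure ν]
    {F F' : ℝ → ℝ → ℝ} {p₀ R δ : ℝ} (hδ : 0 < δ)
    (hF : ∀ p, Continuous (F p)) (hF0 : ∀ u, R ≤ |u| → F p₀ u = 0)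
    (hF' : Continuous (Function.uncurry F'))
    (hF'0 : ∀ p, |p - p₀| ≤ δ → ∀ u, R ≤ |u| → F' p u = 0)
    (hd : ∀ p u, HasDerivAt (fun p => F p u) (F' p u) p) :
    HasDerivAt (fun p => ∫ u, F p u ∂ν) (∫ u, F' p₀ u ∂ν) p₀ := by
  have hint : ∀ f : ℝ → ℝ, Continuous f → (∀ u, R ≤ |u| → f u = 0) → Integrable f ν := by
    intro f hf h0
    obtain ⟨B, hB⟩ := (isCompact_Icc (a := -R) (b := R)).exists_bound_of_continuousOn
      hf.continuousOn
    refine (integrable_const (max B 0)).mono' hf.aestronglyMeasurable (ae_of_all _ fun u => ?_)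
    rcases le_total R |u| with h | h
    · simp [h0 u h]
    · exact (hB u (abs_le.1 h)).trans (le_max_left _ _)
  obtain ⟨B, hB⟩ := ((isCompact_closedBall p₀ δ).prod
    (isCompact_Icc (a := -R) (b := R))).exists_bound_of_continuousOn hF'.continuousOn
  refine (hasDerivAt_integral_of_dominated_loc_of_deriv_le (bound := fun _ => max B 0)
    (Metric.closedBall_mem_nhds p₀ hδ) (Eventually.of_forall fun p => (hF p).aestronglyMeasurable)
    (hint _ (hF p₀) hF0) (F' := F')
    (hF'.comp (by fun_prop : Continuous fun u : ℝ => (p₀, u))).aestronglyMeasurable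
    (ae_of_all _ fun u p hp => ?_) (integrable_const _) (ae_of_all _ fun u p _ => hd p u)).2
  rcases le_total R |u| with h | h
  · rw [hF'0 p (by simpa [Real.dist_eq] using hp) u h]; simp
  · exact (hB (p, u) ⟨hp, abs_le.1 h⟩).trans (le_max_left _ _)

variable {T : ℝ} {η : ℝ → ℝ}

/-- For distances bounded below, $t+c^2u^2/4$ passes $T$ once $|u|$ is large, uniformly in the
distance. This provides the compact supports, and is why derivatives are taken only for $c>0$. -/
theorem exists_radius (K : ℝ) {c : ℝ} (hc : 0 < c) :
    ∃ R, 0 < R ∧ ∀ c', c ≤ c' → ∀ u, R ≤ |u| → K ≤ c' ^ 2 * u ^ 2 / 4 := by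
  refine ⟨2 * √(|K| + 1) / c, by positivity, fun c' hc' u hu => ?_⟩
  have h1 : 2 * √(|K| + 1) ≤ c' * |u| := by
    rw [div_le_iff₀ hc] at hu
    nlinarith [abs_nonneg u]
  have h2 : (2 * √(|K| + 1)) ^ 2 ≤ (c' * |u|) ^ 2 := pow_le_pow_left₀ (by positivity) h1 2
  rw [mul_pow, Real.sq_sqrt (by positivity), mul_pow, sq_abs] at h2
  linarith [le_abs_self K]

/-- The derivative of `propagate c η t` in the distance `c`. -/
noncomputable def propagateDeriv (c : ℝ) (η : ℝ → ℝ) (t : ℝ) : ℝ :=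
  ∫ u, deriv η (t + c ^ 2 * u ^ 2 / 4) * (c * u ^ 2 / 2) ∂levyMeasure

theorem finalTest.hasDerivAt (hη : η ∈ finalTest T) (t : ℝ) : HasDerivAt η (deriv η t) t :=
  (hη.1.differentiable (by simp)).differentiableAt.hasDerivAt

theorem hasDerivAt_propagate_time (hη : η ∈ finalTest T) {c : ℝ} (hc : 0 < c) (t : ℝ) :
    HasDerivAt (propagate c η) (propagate c (deriv η) t) t := by
  have h1 := hη.1.continuous
  have h2 := (finalTest.deriv_mem hη).1.continuous
  obtain ⟨R, hR, h⟩ := exists_radius (T - (t - 1)) hc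
  refine hasDerivAt_integral_of_compact_support (R := R) one_pos (fun t => by fun_prop) ?_
    (F' := fun t u => deriv η (t + c ^ 2 * u ^ 2 / 4))
    (by simp only [Function.uncurry_def]; fun_prop) ?_ ?_
  · exact fun u hu => finalTest.eq_zero hη (by linarith [h c le_rfl u hu])
  · exact fun s hs u hu => finalTest.eq_zero (finalTest.deriv_mem hη)
      (by linarith [h c le_rfl u hu, (abs_le.1 hs).1])
  · intro s u
    exact (finalTest.hasDerivAt hη _).comp_add_const s _

theorem hasDerivAt_sq_arg (c t u : ℝ) :
    HasDerivAt (fun c : ℝ => t + c ^ 2 * u ^ 2 / 4) (c * u ^ 2 / 2) c := by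
  have := ((((hasDerivAt_id c).pow 2).mul_const (u ^ 2)).div_const 4).const_add t
  refine HasDerivAt.congr_deriv this ?_
  simp only [id]; push_cast; ring

theorem hasDerivAt_propagate (hη : η ∈ finalTest T) {c : ℝ} (hc : 0 < c) (t : ℝ) :
    HasDerivAt (fun c => propagate c η t) (propagateDeriv c η t) c := by
  have h1 := hη.1.continuous
  have h2 := (finalTest.deriv_mem hη).1.continuous
  obtain ⟨R, hR, h⟩ := exists_radius (T - t) (half_pos hc)
  refine hasDerivAt_integral_of_compact_support (R := R) (half_pos hc) (fun t => by fun_prop) ?_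
    (F' := fun c u => deriv η (t + c ^ 2 * u ^ 2 / 4) * (c * u ^ 2 / 2))
    (by simp only [Function.uncurry_def]; fun_prop) ?_ ?_
  · exact fun u hu => finalTest.eq_zero hη (by linarith [h c (by linarith) u hu])
  · intro s hs u hu
    rw [finalTest.eq_zero (finalTest.deriv_mem hη), zero_mul]
    linarith [h s (by linarith [(abs_le.1 hs).1]) u hu]
  · intro s u
    exact (finalTest.hasDerivAt hη _).comp s (hasDerivAt_sq_arg s t u)

theorem hasDerivAt_propagateDeriv (hη : η ∈ finalTest T) {c : ℝ} (hc : 0 < c) (t : ℝ) :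
    HasDerivAt (fun c => propagateDeriv c η t)
      (∫ u, (deriv (deriv η) (t + c ^ 2 * u ^ 2 / 4) * (c * u ^ 2 / 2) * (c * u ^ 2 / 2)
        + deriv η (t + c ^ 2 * u ^ 2 / 4) * (u ^ 2 / 2)) ∂levyMeasure) c := by
  have hη' := finalTest.deriv_mem hη
  have h1 := hη'.1.continuous
  have h2 := (finalTest.deriv_mem hη').1.continuous
  obtain ⟨R, hR, h⟩ := exists_radius (T - t) (half_pos hc)
  refine hasDerivAt_integral_of_compact_support (R := R) (half_pos hc) (fun t => by fun_prop) ?_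
    (F' := fun c u => deriv (deriv η) (t + c ^ 2 * u ^ 2 / 4) * (c * u ^ 2 / 2) * (c * u ^ 2 / 2)
        + deriv η (t + c ^ 2 * u ^ 2 / 4) * (u ^ 2 / 2))
    (by simp only [Function.uncurry_def]; fun_prop) ?_ ?_
  · intro u hu
    rw [finalTest.eq_zero hη', zero_mul]
    linarith [h c (by linarith) u hu]
  · intro s hs u hu
    have : T ≤ t + s ^ 2 * u ^ 2 / 4 := by
      linarith [h s (by linarith [(abs_le.1 hs).1]) u hu]
    rw [finalTest.eq_zero hη' this, finalTest.eq_zero (finalTest.deriv_mem hη') this]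
    simp
  · intro s u
    have := ((finalTest.hasDerivAt hη' _).comp s (hasDerivAt_sq_arg s t u)).mul
      (((hasDerivAt_id s).mul_const (u ^ 2)).div_const 2)
    refine HasDerivAt.congr_deriv this ?_
    simp

/-- The propagation solves the backward heat equation. -/
theorem hasDerivAt_propagateDeriv_eq (hη : η ∈ finalTest T) {c : ℝ} (hc : 0 < c) (t : ℝ) :
    HasDerivAt (fun c => propagateDeriv c η t) (-propagate c (deriv η) t) c := by
  have hη' := finalTest.deriv_mem hη
  have hη'' := finalTest.deriv_mem hη'
  have c1 := hη'.1.continuous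
  have c2 := hη''.1.continuous
  obtain ⟨R, hR, hRu⟩ := exists_radius (T - t) hc
  set g : ℝ → ℝ := fun u => deriv η (t + c ^ 2 * u ^ 2 / 4) with hg
  set k : ℝ → ℝ := fun u => deriv (deriv η) (t + c ^ 2 * u ^ 2 / 4) with hk
  have hg0 : ∀ u, R ≤ |u| → g u = 0 := fun u hu =>
    finalTest.eq_zero hη' (by linarith [hRu c le_rfl u hu])
  have hk0 : ∀ u, R ≤ |u| → k u = 0 := fun u hu =>
    finalTest.eq_zero hη'' (by linarith [hRu c le_rfl u hu])
  have hgc : Continuous g := by fun_prop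
  have hkc : Continuous k := by fun_prop
  have hint : ∀ f : ℝ → ℝ, Continuous f → (∀ u, R ≤ |u| → f u = 0) →
      Integrable f levyMeasure := by
    intro f hf h0
    obtain ⟨B, hB⟩ := (isCompact_Icc (a := -R) (b := R)).exists_bound_of_continuousOn
      hf.continuousOn
    refine (integrable_const (max B 0)).mono' hf.aestronglyMeasurable (ae_of_all _ fun u => ?_)
    rcases le_total R |u| with h | h
    · simp [h0 u h]
    · exact (hB u (abs_le.1 h)).trans (le_max_left _ _)
  set G : ℝ → ℝ := fun u => k u * (c * u ^ 2 / 2) * (c * u ^ 2 / 2) + g u * (u ^ 2 / 2) with hG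
  have iG : Integrable G levyMeasure :=
    hint G (by fun_prop) fun u hu => by simp [hG, hg0 u hu, hk0 u hu]
  have ig : Integrable g levyMeasure := hint g hgc hg0
  have key : ∫ u, (G u + g u) ∂levyMeasure = 0 := by
    have hsum : Integrable (fun u => G u + g u) levyMeasure := iG.add ig
    rw [integral_levyMeasure]
    rw [integrable_levyMeasure_iff] at hsum
    -- $H$ is a primitive of the density times $G+g$ that vanishes at $0$ and for large $u$. This
    -- integration by parts in $u$ is what turns $\partial_c^2$ into $-\partial_t$.
    set H : ℝ → ℝ := fun u => 2 / √Real.pi * (u / 2 * Real.exp (-(u ^ 2)⁻¹) * g u) with hH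
    have hder : ∀ u ∈ Ioi (0 : ℝ), HasDerivAt H (levyDensity u * (G u + g u)) u := by
      intro u hu
      have hu : 0 < u := hu
      have e1 : HasDerivAt (fun u : ℝ => Real.exp (-(u ^ 2)⁻¹))
          (Real.exp (-(u ^ 2)⁻¹) * (2 * (u ^ 3)⁻¹)) u := by
        have := (((hasDerivAt_pow 2 u).inv (by positivity)).neg).exp
        refine HasDerivAt.congr_deriv this ?_
        push_cast
        field_simp
        norm_num
      have e2 : HasDerivAt g (k u * (c ^ 2 * u / 2)) u := by
        have h3 : HasDerivAt (fun u : ℝ => t + c ^ 2 * u ^ 2 / 4) (c ^ 2 * u / 2) u := by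
          have := (((hasDerivAt_pow 2 u).const_mul (c ^ 2)).div_const 4).const_add t
          refine HasDerivAt.congr_deriv this ?_
          push_cast; ring
        exact (finalTest.hasDerivAt hη' _).comp u h3
      have := ((((hasDerivAt_id u).div_const 2).mul e1).mul e2).const_mul (2 / √Real.pi)
      refine HasDerivAt.congr_deriv this ?_
      simp only [hG, levyDensity, id, Pi.mul_apply]
      field_simp
      ring
    have hcont : ContinuousWithinAt H (Ici 0) 0 := by
      obtain ⟨B, hB⟩ := (isCompact_Icc (a := -R) (b := R)).exists_bound_of_continuousOn
        hgc.continuousOn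
      have hH0 : H 0 = 0 := by simp [hH]
      refine ContinuousAt.continuousWithinAt ?_
      rw [ContinuousAt, hH0]
      have hlim : Tendsto (fun u : ℝ => 2 / √Real.pi * (|u| / 2 * |B|)) (𝓝 0) (𝓝 0) := by
        have : Continuous fun u : ℝ => 2 / √Real.pi * (|u| / 2 * |B|) := by fun_prop
        simpa using this.tendsto 0
      refine squeeze_zero_norm (fun u => ?_) hlim
      have hgB : |g u| ≤ |B| := by
        rcases le_total R |u| with h | h
        · simp [hg0 u h]
        · exact (hB u (abs_le.1 h)).trans (le_abs_self B)
      have hexp : Real.exp (-(u ^ 2)⁻¹) ≤ 1 := Real.exp_le_one_iff.2 (by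
        have : 0 ≤ (u ^ 2)⁻¹ := by positivity
        linarith)
      simp only [hH, norm_mul, Real.norm_eq_abs, Real.abs_exp, abs_div, abs_two,
        abs_of_nonneg (Real.sqrt_nonneg _)]
      gcongr
      calc |u| / 2 * Real.exp (-(u ^ 2)⁻¹) ≤ |u| / 2 * 1 := by gcongr
        _ = |u| / 2 := mul_one _
    have htop : Tendsto H atTop (𝓝 0) := by
      refine tendsto_const_nhds.congr' ?_
      filter_upwards [eventually_ge_atTop R] with u hu
      simp [hH, hg0 u (hu.trans (le_abs_self u))]
    rw [integral_Ioi_of_hasDerivAt_of_tendsto hcont hder hsum htop]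
    simp [hH]
  have h2 : ∫ u, G u ∂levyMeasure = -propagate c (deriv η) t := by
    rw [integral_add iG ig] at key
    have : ∫ u, g u ∂levyMeasure = propagate c (deriv η) t := rfl
    linarith
  rw [← h2]
  exact hasDerivAt_propagateDeriv hη hc t

/-- The integral is read as a convolution with the constant $1$ evaluated at $0$ (the integrand is
even in $u$), so that smooth dependence of convolutions on parameters applies locally. -/
theorem contDiffOn_propagate (hη : η ∈ finalTest T) :
    ContDiffOn ℝ ∞ (fun p : ℝ × ℝ => propagate p.1 η p.2) {p | 0 < p.1} := by
  have hη1 := hη.1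
  have hopen : ∀ c t : ℝ, IsOpen {p : ℝ × ℝ | c < p.1 ∧ t < p.2} := fun c t =>
    (isOpen_lt continuous_const continuous_fst).inter (isOpen_lt continuous_const continuous_snd)
  intro p hp
  have hp : 0 < p.1 := hp
  obtain ⟨R, hR, h⟩ := exists_radius (T - (p.2 - 1)) (half_pos hp)
  have key : ContDiffOn ℝ ∞ (fun q : ℝ × ℝ => convolution (fun _ => (1 : ℝ))
      (fun u => η (q.2 + q.1 ^ 2 * u ^ 2 / 4)) (ContinuousLinearMap.lsmul ℝ ℝ) levyMeasure
        ((fun _ => (0 : ℝ)) q)) {q : ℝ × ℝ | p.1 / 2 < q.1 ∧ p.2 - 1 < q.2} := by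
    refine contDiffOn_convolution_right_with_param_comp (n := ⊤) (ContinuousLinearMap.lsmul ℝ ℝ)
      contDiffOn_const (hopen _ _) (isCompact_Icc (a := -R) (b := R)) ?_ ?_ ?_
      (g := fun q u => η (q.2 + q.1 ^ 2 * u ^ 2 / 4))
    · rintro q u ⟨hq1, hq2⟩ hu
      have : R ≤ |u| := by
        by_contra hcon
        exact hu (abs_le.1 (not_le.1 hcon).le)
      exact finalTest.eq_zero hη (by linarith [h q.1 hq1.le u this])
    · exact (integrable_const (1 : ℝ)).locallyIntegrable
    · refine ContDiff.contDiffOn ?_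
      exact hη1.comp (by fun_prop)
  have hat := key.contDiffAt ((hopen _ _).mem_nhds
    (show p ∈ {q : ℝ × ℝ | p.1 / 2 < q.1 ∧ p.2 - 1 < q.2} from ⟨by linarith, by linarith⟩))
  refine ContDiffAt.contDiffWithinAt ?_
  convert hat using 2 with q
  simp [convolution, propagate]

theorem propagate_mem_finalTest (hη : η ∈ finalTest T) {c : ℝ} (hc : 0 ≤ c) :
    propagate c η ∈ finalTest T := by
  rcases hc.eq_or_lt with rfl | hc
  · rwa [propagate_zero]
  · refine ⟨?_, ?_⟩
    · exact contDiffOn_univ.1 ((contDiffOn_propagate hη).comp (t := {p : ℝ × ℝ | 0 < p.1})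
        (f := fun t : ℝ => (c, t)) (s := univ) (by fun_prop) (fun t _ => hc))
    · obtain ⟨-, S, hS, h⟩ := hη
      exact ⟨S, hS, fun t ht => propagate_eq_zero h c ht⟩

theorem continuousOn_propagateDeriv (hη : η ∈ finalTest T) :
    ContinuousOn (fun p : ℝ × ℝ => propagateDeriv p.1 η p.2) {p | 0 < p.1} := by
  have hopen : IsOpen {p : ℝ × ℝ | 0 < p.1} := isOpen_lt continuous_const continuous_fst
  have h1 := (contDiffOn_propagate hη).continuousOn_fderiv_of_isOpen hopen (by simp)
  have h2 : ContinuousOn (fun p : ℝ × ℝ =>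
      fderiv ℝ (fun p : ℝ × ℝ => propagate p.1 η p.2) p (1, 0)) {p | 0 < p.1} :=
    h1.clm_apply continuousOn_const
  refine h2.congr fun p hp => ?_
  have hd := (((contDiffOn_propagate hη).differentiableOn (by simp)).differentiableAt
    (hopen.mem_nhds hp)).hasFDerivAt
  have hc : HasDerivAt (fun c : ℝ => (c, p.2)) ((1 : ℝ), (0 : ℝ)) p.1 :=
    (hasDerivAt_id p.1).prodMk (hasDerivAt_const p.1 p.2)
  exact (hasDerivAt_propagate hη hp p.2).unique (hd.comp_hasDerivAt_of_eq p.1 hc rfl)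

end NNWR
-- Minimum principle, semigroup law and positivity of the image series
namespace NNWR

/-- A negative second derivative would make the point a local maximum too, hence $f$ locally
constant and its second derivative zero. -/
theorem IsLocalMin.second_deriv_nonneg {f f' : ℝ → ℝ} {f'' x : ℝ} (hmin : IsLocalMin f x)
    (hf : ∀ᶠ y in 𝓝 x, HasDerivAt f (f' y) y) (hf' : HasDerivAt f' f'' x) : 0 ≤ f'' := by
  by_contra! hneg
  have he : deriv f =ᶠ[𝓝 x] f' := hf.mono fun y hy => hy.deriv
  have hdd : deriv (deriv f) x = f'' := by rw [he.deriv_eq, hf'.deriv]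
  have hmax : IsLocalMax f x := isLocalMax_of_deriv_deriv_neg (by rwa [hdd]) hmin.deriv_eq_zero
    hf.self_of_nhds.continuousAt
  have hconst : f =ᶠ[𝓝 x] fun _ => f x := by
    filter_upwards [hmin, hmax] with y h1 h2 using le_antisymm h2 h1
  have h1 : deriv f =ᶠ[𝓝 x] fun _ => 0 := by
    filter_upwards [hconst.eventuallyEq_nhds] with y hy
    rw [hy.deriv_eq, deriv_const]
  rw [h1.deriv_eq, deriv_const] at hdd
  exact hneg.ne hdd.symm

/-- The minimum principle for the backward heat equation on a rectangle. -/
theorem le_of_backward_heat {v vt vx : ℝ → ℝ → ℝ} {R t₀ T m : ℝ}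
    (hcont : ContinuousOn (fun p : ℝ × ℝ => v p.1 p.2) (Icc 0 R ×ˢ Icc t₀ T))
    (ht : ∀ x ∈ Ioo 0 R, ∀ t ∈ Ico t₀ T, HasDerivAt (v x) (vt x t) t)
    (hx : ∀ x ∈ Ioo 0 R, ∀ t ∈ Ico t₀ T, HasDerivAt (fun x => v x t) (vx x t) x)
    (hxx : ∀ x ∈ Ioo 0 R, ∀ t ∈ Ico t₀ T, HasDerivAt (fun x => vx x t) (-vt x t) x)
    (h0 : ∀ t ∈ Icc t₀ T, m ≤ v 0 t) (hR : ∀ t ∈ Icc t₀ T, m ≤ v R t)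
    (hT : ∀ x ∈ Icc 0 R, m ≤ v x T) {x t : ℝ} (hxR : x ∈ Icc 0 R) (htT : t ∈ Icc t₀ T) :
    m ≤ v x t := by
  by_contra! hlt
  have ht₀T : t₀ ≤ T := htT.1.trans htT.2
  -- The perturbation $\varepsilon(T-t)$ makes the inequality strict, and $\varepsilon$ is small
  -- enough that the minimum of the perturbed function still lies below $m$, hence off the sides and
  -- off $t=T$. At a minimum $v_{xx}\ge0$ and the forward time slope gives $v_t\ge\varepsilon$,
  -- contradicting $v_{xx}=-v_t$.
  set ε := (m - v x t) / (2 * (T - t₀ + 1)) with hε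
  have hε0 : 0 < ε := div_pos (by linarith) (by linarith)
  have hεlt : ε * (T - t₀) < m - v x t := by
    rw [hε, div_mul_eq_mul_div, div_lt_iff₀ (by linarith)]
    nlinarith
  set g : ℝ × ℝ → ℝ := fun p => v p.1 p.2 + ε * (T - p.2) with hg
  have hgc : ContinuousOn g (Icc 0 R ×ˢ Icc t₀ T) :=
    hcont.add (by fun_prop)
  obtain ⟨⟨y, s⟩, ⟨hy, hs⟩, hmin⟩ := (isCompact_Icc.prod isCompact_Icc).exists_isMinOn
    ⟨(x, t), hxR, htT⟩ hgc
  simp only at hy hs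
  have hys : g (y, s) ≤ g (x, t) := hmin (show (x, t) ∈ _ from ⟨hxR, htT⟩)
  have hgys : v y s < m := by
    have h1 : 0 ≤ ε * (T - s) := mul_nonneg hε0.le (by linarith [hs.2])
    have h2 : ε * (T - t) ≤ ε * (T - t₀) := mul_le_mul_of_nonneg_left (by linarith [htT.1]) hε0.le
    simp only [hg] at hys
    linarith
  have hy0 : 0 < y := hy.1.lt_of_ne fun h => by subst h; exact absurd (h0 s hs) (not_le.2 hgys)
  have hyR : y < R := hy.2.lt_of_ne fun h => by subst h; exact absurd (hR s hs) (not_le.2 hgys)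
  have hsT : s < T := hs.2.lt_of_ne fun h => by subst h; exact absurd (hT y hy) (not_le.2 hgys)
  have hyI : y ∈ Ioo 0 R := ⟨hy0, hyR⟩
  have hsI : s ∈ Ico t₀ T := ⟨hs.1, hsT⟩
  have hvxx : 0 ≤ -vt y s := by
    refine IsLocalMin.second_deriv_nonneg (f := fun x => v x s) (f' := fun x => vx x s) (x := y)
      ?_ ?_ (hxx y hyI s hsI)
    · filter_upwards [Icc_mem_nhds hy0 hyR] with z hz
      have : g (y, s) ≤ g (z, s) := hmin (show (z, s) ∈ _ from ⟨hz, hs⟩)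
      simpa [hg] using this
    · filter_upwards [Ioo_mem_nhds hy0 hyR] with z hz using hx z hz s hsI
  have hvt : 0 ≤ vt y s - ε := by
    have hd : HasDerivAt (fun s => g (y, s)) (vt y s - ε) s := by
      have := (ht y hyI s hsI).add (((hasDerivAt_id s).const_sub T).const_mul ε)
      refine HasDerivAt.congr_deriv this ?_
      ring
    have hlim := (hasDerivWithinAt_iff_tendsto_slope' (self_notMem_Ioi)).1
      (hd.hasDerivWithinAt (s := Ioi s))
    refine ge_of_tendsto hlim ?_
    filter_upwards [Ioo_mem_nhdsGT hsT] with r hr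
    have : g (y, s) ≤ g (y, r) :=
      hmin (show (y, r) ∈ _ from ⟨hy, hs.1.trans hr.1.le, hr.2.le⟩)
    rw [slope_def_field]
    exact div_nonneg (by linarith) (by linarith [hr.1])
  linarith

variable {T : ℝ} {η : ℝ → ℝ}

/-- Removes the artificial boundary $x=R$ of the minimum principle by letting $R\to\infty$. -/
theorem le_zero_of_le_gaussian {a C K x : ℝ} (hK : 0 < K)
    (h : ∀ R, 0 < R → x ≤ R → a ≤ C * Real.exp (-(R ^ 2 / K))) : a ≤ 0 := by
  have h1 : Tendsto (fun R : ℝ => C * Real.exp (-(R ^ 2 / K))) atTop (𝓝 (C * 0)) := by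
    refine Tendsto.const_mul C (Real.tendsto_exp_neg_atTop_nhds_zero.comp ?_)
    exact (tendsto_pow_atTop two_ne_zero).atTop_div_const hK
  rw [mul_zero] at h1
  refine ge_of_tendsto h1 ?_
  filter_upwards [eventually_gt_atTop 0, eventually_ge_atTop x] with R hR hxR using h R hR hxR

/-- Uniqueness for the backward heat equation on a half-strip: as functions of $a$, both sides agree
at $a=0$ and at $t=T$, and their difference is Gaussian small at $a=R$. The minimum principle is
applied to the difference with both signs. -/
theorem propagate_add (hη : η ∈ finalTest T) {a b : ℝ} (ha : 0 ≤ a) (hb : 0 ≤ b) :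
    propagate a (propagate b η) = propagate (a + b) η := by
  rcases hb.eq_or_lt with rfl | hb
  · rw [propagate_zero, add_zero]
  have hζ := propagate_mem_finalTest hη hb.le
  ext t
  rcases le_or_gt T t with hTt | htT
  · rw [propagate_eq_zero (fun s hs => finalTest.eq_zero hζ hs) a hTt,
      propagate_eq_zero (fun s hs => finalTest.eq_zero hη hs) _ hTt]
  obtain ⟨B, hB0, hB⟩ := finalTest.exists_bound hη t
  obtain ⟨B', hB'0, hB'⟩ := finalTest.exists_bound hζ t
  have hK : 0 < 4 * (T - t) := by linarith
  have hend : ∀ R, 0 < R → ∀ s ∈ Icc t T,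
      |propagate R (propagate b η) s - propagate (R + b) η s| ≤
        (B' + B) * Real.exp (-(R ^ 2 / (4 * (T - t)))) := by
    intro R hR s hs
    have h1 := abs_propagate_le hζ hB' hR htT hs.1
    have h2 := abs_propagate_le hη hB (show 0 < R + b by linarith) htT hs.1
    have h3 : Real.exp (-((R + b) ^ 2 / (4 * (T - t)))) ≤ Real.exp (-(R ^ 2 / (4 * (T - t)))) := by
      gcongr; linarith
    calc _ ≤ _ := abs_sub _ _
      _ ≤ B' * Real.exp (-(R ^ 2 / (4 * (T - t)))) + B * Real.exp (-(R ^ 2 / (4 * (T - t)))) := by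
        gcongr
        exact h2.trans (by gcongr)
      _ = _ := by ring
  have hcont : Continuous fun p : ℝ × ℝ =>
      propagate p.1 (propagate b η) p.2 - propagate (p.1 + b) η p.2 :=
    (continuous_propagate hζ).sub ((continuous_propagate hη).comp
      (f := fun p : ℝ × ℝ => (p.1 + b, p.2)) (by fun_prop))
  have hT0 : ∀ x, propagate x (propagate b η) T - propagate (x + b) η T = 0 := fun x => by
    rw [propagate_eq_zero (fun s hs => finalTest.eq_zero hζ hs) x le_rfl,
      propagate_eq_zero (fun s hs => finalTest.eq_zero hη hs) _ le_rfl, sub_zero]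
  have hlow : ∀ R, 0 < R → a ≤ R → -((B' + B) * Real.exp (-(R ^ 2 / (4 * (T - t))))) ≤
      propagate a (propagate b η) t - propagate (a + b) η t := by
    intro R hR haR
    have hpos : 0 ≤ (B' + B) * Real.exp (-(R ^ 2 / (4 * (T - t)))) := by positivity
    refine le_of_backward_heat
      (v := fun x s => propagate x (propagate b η) s - propagate (x + b) η s)
      (vt := fun x s => propagate x (deriv (propagate b η)) s - propagate (x + b) (deriv η) s)
      (vx := fun x s => propagateDeriv x (propagate b η) s - propagateDeriv (x + b) η s)
      (R := R) (t₀ := t) (T := T) hcont.continuousOn ?_ ?_ ?_ ?_ ?_ ?_ ⟨ha, haR⟩ ⟨le_rfl, htT.le⟩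
    · intro x hx s _
      exact (hasDerivAt_propagate_time hζ hx.1 s).sub
        (hasDerivAt_propagate_time hη (by linarith [hx.1]) s)
    · intro x hx s _
      exact (hasDerivAt_propagate hζ hx.1 s).sub
        ((hasDerivAt_propagate hη (by linarith [hx.1]) s).comp_add_const x b)
    · intro x hx s _
      refine HasDerivAt.congr_deriv ((hasDerivAt_propagateDeriv_eq hζ hx.1 s).sub
        ((hasDerivAt_propagateDeriv_eq hη (by linarith [hx.1]) s).comp_add_const x b)) ?_
      ring
    · intro s _
      simpa [propagate_zero] using hpos
    · exact fun s hs => (abs_le.1 (hend R hR s hs)).1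
    · intro x _
      simpa [hT0 x] using hpos
  have hup : ∀ R, 0 < R → a ≤ R → -((B' + B) * Real.exp (-(R ^ 2 / (4 * (T - t))))) ≤
      propagate (a + b) η t - propagate a (propagate b η) t := by
    intro R hR haR
    have hpos : 0 ≤ (B' + B) * Real.exp (-(R ^ 2 / (4 * (T - t)))) := by positivity
    refine le_of_backward_heat
      (v := fun x s => propagate (x + b) η s - propagate x (propagate b η) s)
      (vt := fun x s => propagate (x + b) (deriv η) s - propagate x (deriv (propagate b η)) s)
      (vx := fun x s => propagateDeriv (x + b) η s - propagateDeriv x (propagate b η) s)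
      (R := R) (t₀ := t) (T := T) ?_ ?_ ?_ ?_ ?_ ?_ ?_ ⟨ha, haR⟩ ⟨le_rfl, htT.le⟩
    · exact (hcont.neg.congr fun p => by simp).continuousOn
    · intro x hx s _
      exact (hasDerivAt_propagate_time hη (by linarith [hx.1]) s).sub
        (hasDerivAt_propagate_time hζ hx.1 s)
    · intro x hx s _
      exact ((hasDerivAt_propagate hη (by linarith [hx.1]) s).comp_add_const x b).sub
        (hasDerivAt_propagate hζ hx.1 s)
    · intro x hx s _
      refine HasDerivAt.congr_deriv
        (((hasDerivAt_propagateDeriv_eq hη (by linarith [hx.1]) s).comp_add_const x b).sub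
          (hasDerivAt_propagateDeriv_eq hζ hx.1 s)) ?_
      ring
    · intro s _
      simpa [propagate_zero] using hpos
    · intro s hs
      linarith [(abs_le.1 (hend R hR s hs)).2]
    · intro x _
      have := hT0 x
      linarith
  have h1 := le_zero_of_le_gaussian (a := propagate a (propagate b η) t - propagate (a + b) η t)
    (C := B' + B) hK fun R hR haR => by linarith [hup R hR haR]
  have h2 := le_zero_of_le_gaussian (a := propagate (a + b) η t - propagate a (propagate b η) t)
    (C := B' + B) hK fun R hR haR => by linarith [hlow R hR haR]
  linarith

/-- The image series for the exit through `b` of the interval `(0, b)` from the point `b - a` is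
nonnegative, up to its truncation error. -/
theorem neg_le_sum_propagate (hη : η ∈ finalTest T) (hT : 0 < T) (hpos : ∀ t, 0 ≤ t → 0 ≤ η t)
    {B : ℝ} (hB : ∀ t, 0 ≤ t → |η t| ≤ B) {a b : ℝ} (ha : 0 < a) (hab : a ≤ b) {M : ℕ}
    (hM : 0 < M) {t : ℝ} (ht : t ∈ Icc 0 T) :
    -(B * Real.exp (-((2 * M * b) ^ 2 / (4 * T)))) ≤
      ∑ n ∈ Finset.range M,
        (propagate (2 * n * b + a) η t - propagate (2 * (n + 1) * b - a) η t) := by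
  have hb : 0 < b := ha.trans_le hab
  have hB0 : 0 ≤ B := (abs_nonneg _).trans (hB 0 le_rfl)
  have hM' : (0 : ℝ) < M := by exact_mod_cast hM
  have hpos1 : ∀ (n : ℕ) (x : ℝ), x < b → 0 < (2 * n + 1) * b - x := fun n x hx => by
    have : 0 ≤ (n : ℝ) * b := by positivity
    linarith
  have hpos2 : ∀ (n : ℕ) (x : ℝ), 0 < x → 0 < (2 * n + 1) * b + x := fun n x hx => by
    have : 0 ≤ (n : ℝ) * b := by positivity
    linarith
  have hle : -(B * Real.exp (-((2 * M * b) ^ 2 / (4 * T)))) ≤ 0 := by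
    have : 0 ≤ B * Real.exp (-((2 * M * b) ^ 2 / (4 * T))) := by positivity
    linarith
  -- The image sum is viewed as a function of the starting point $x\in[0,b]$ and evaluated at
  -- $x=b-a$.
  have key := le_of_backward_heat
      (v := fun x s => ∑ n ∈ Finset.range M,
        (propagate ((2 * n + 1) * b - x) η s - propagate ((2 * n + 1) * b + x) η s))
      (vt := fun x s => ∑ n ∈ Finset.range M,
        (propagate ((2 * n + 1) * b - x) (deriv η) s
          - propagate ((2 * n + 1) * b + x) (deriv η) s))
      (vx := fun x s => ∑ n ∈ Finset.range M,
        (-propagateDeriv ((2 * n + 1) * b - x) η s - propagateDeriv ((2 * n + 1) * b + x) η s))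
      (R := b) (t₀ := 0) (T := T) (m := -(B * Real.exp (-((2 * M * b) ^ 2 / (4 * T)))))
      (x := b - a) (t := t) ?_ ?_ ?_ ?_ ?_ ?_ ?_ ⟨by linarith, by linarith⟩ ht
  · refine key.trans_eq (Finset.sum_congr rfl fun n _ => ?_)
    congr 2 <;> ring
  · refine Continuous.continuousOn (continuous_finsetSum _ fun n _ => ?_)
    exact ((continuous_propagate hη).comp
      (f := fun p : ℝ × ℝ => ((2 * n + 1) * b - p.1, p.2)) (by fun_prop)).sub
      ((continuous_propagate hη).comp
      (f := fun p : ℝ × ℝ => ((2 * n + 1) * b + p.1, p.2)) (by fun_prop))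
  · intro x hx s _
    refine HasDerivAt.fun_sum fun n _ => ?_
    exact (hasDerivAt_propagate_time hη (hpos1 n x hx.2) s).sub
      (hasDerivAt_propagate_time hη (hpos2 n x hx.1) s)
  · intro x hx s _
    refine HasDerivAt.fun_sum fun n _ => ?_
    exact ((hasDerivAt_propagate hη (hpos1 n x hx.2) s).comp_const_sub _ x).sub
      ((hasDerivAt_propagate hη (hpos2 n x hx.1) s).comp_const_add _ x)
  · intro x hx s _
    rw [← Finset.sum_neg_distrib]
    refine HasDerivAt.fun_sum fun n _ => ?_
    refine HasDerivAt.congr_deriv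
      (((hasDerivAt_propagateDeriv_eq hη (hpos1 n x hx.2) s).comp_const_sub _ x).neg.sub
        ((hasDerivAt_propagateDeriv_eq hη (hpos2 n x hx.1) s).comp_const_add _ x)) ?_
    ring
  -- At $x=0$ each image cancels its mirror.
  · intro s _
    simpa using hle
  -- At $x=b$ the sum telescopes to $\eta-P_{2Mb}\eta$; the first term is nonnegative and the second
  -- is the truncation error.
  · intro s hs
    have : ∀ n : ℕ, propagate ((2 * n + 1) * b - b) η s - propagate ((2 * n + 1) * b + b) η s
        = (fun n : ℕ => propagate (2 * n * b) η s) n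
          - (fun n : ℕ => propagate (2 * n * b) η s) (n + 1) := by
      intro n
      simp only
      push_cast
      congr 2 <;> ring
    rw [Finset.sum_congr rfl fun n _ => this n, Finset.sum_range_sub']
    have h1 := abs_propagate_le hη hB (c := 2 * M * b) (by positivity) hT hs.1
    have h2 := hpos s hs.1
    simp only [Nat.cast_zero, mul_zero, zero_mul, propagate_zero, sub_zero] at h1 ⊢
    linarith [(abs_le.1 h1).2]
  · intro x _
    have h0 : ∀ c, propagate c η T = 0 := fun c =>
      propagate_eq_zero (fun s hs => finalTest.eq_zero hη hs) c le_rfl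
    simpa [h0] using hle

end NNWR
-- Testing the weak formulation with propagated test functions
namespace NNWR

/-- The propagation over the distance `c` as a linear map on test functions. -/
noncomputable def propagateHom (T : ℝ) (c : ℝ≥0) : finalTest T →ₗ[ℝ] finalTest T where
  toFun η := ⟨propagate c η, propagate_mem_finalTest η.2 c.2⟩
  map_add' η ζ := by
    ext t
    exact integral_add (integrable_propagate η.2 c t) (integrable_propagate ζ.2 c t)
  map_smul' r η := by
    ext t
    exact integral_const_mul r _

@[simp]
theorem coe_propagateHom {T : ℝ} (c : ℝ≥0) (η : finalTest T) :
    (propagateHom T c η : ℝ → ℝ) = propagate c η := rfl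

theorem propagateHom_add {T : ℝ} (a b : ℝ≥0) (η : finalTest T) :
    propagateHom T a (propagateHom T b η) = propagateHom T (a + b) η :=
  Subtype.ext (propagate_add η.2 a.2 b.2)

theorem propagateHom_zero {T : ℝ} (η : finalTest T) : propagateHom T 0 η = η :=
  Subtype.ext (propagate_zero _)

/-- A smooth function equal to `1` on `[-1, ∞)` and to `0` on `(-∞, -2]`. -/
noncomputable def timeCutoff (t : ℝ) : ℝ := Real.smoothTransition (t + 2)

theorem contDiff_timeCutoff : ContDiff ℝ ∞ timeCutoff :=
  Real.smoothTransition.contDiff.comp (by fun_prop)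

theorem timeCutoff_eq_one {t : ℝ} (ht : -1 ≤ t) : timeCutoff t = 1 :=
  Real.smoothTransition.one_of_one_le (by linarith)

theorem timeCutoff_eq_zero {t : ℝ} (ht : t ≤ -2) : timeCutoff t = 0 :=
  Real.smoothTransition.zero_of_nonpos (by linarith)

/-- Restriction of a test function to a compactly supported one, without changing it for
`t ≥ -1`. -/
noncomputable def cutHom (T : ℝ) : finalTest T →ₗ[ℝ] 𝓓(timeDomain T, ℝ) where
  toFun η :=
    { toFun := fun t => timeCutoff t * η.1 t
      contDiff' := contDiff_timeCutoff.mul η.2.1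
      hasCompactSupport' := by
        obtain ⟨-, S, hS, h⟩ := η.2
        refine HasCompactSupport.intro (isCompact_Icc (a := -2) (b := S)) fun t ht => ?_
        rcases le_total t (-2) with h1 | h1
        · rw [timeCutoff_eq_zero h1, zero_mul]
        · rw [h t (not_lt.1 fun h2 => ht ⟨h1, h2.le⟩), mul_zero]
      tsupport_subset' := by
        obtain ⟨-, S, hS, h⟩ := η.2
        have : tsupport (fun t => timeCutoff t * η.1 t) ⊆ Iic S := by
          refine closure_minimal (fun t ht => ?_) isClosed_Iic
          by_contra hcon
          exact ht (by simp [h t (not_le.1 hcon).le])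
        exact fun t ht => lt_of_le_of_lt (this ht) hS }
  map_add' η ζ := by
    ext t
    change timeCutoff t * (η.1 t + ζ.1 t) = timeCutoff t * η.1 t + timeCutoff t * ζ.1 t
    ring
  map_smul' r η := by
    ext t
    change timeCutoff t * (r * η.1 t) = r * (timeCutoff t * η.1 t)
    ring

theorem cutHom_apply {T : ℝ} (η : finalTest T) (t : ℝ) :
    cutHom T η t = timeCutoff t * η.1 t := rfl

/-- A smooth function equal to `1` on `[a - δ / 2, b + δ / 2]` that vanishes outside
`[a - δ, b + δ]`. -/
noncomputable def spaceCutoff (a b δ x : ℝ) : ℝ :=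
  Real.smoothTransition ((x - a) * (2 / δ) + 2) * Real.smoothTransition ((b - x) * (2 / δ) + 2)

theorem contDiff_spaceCutoff (a b δ : ℝ) : ContDiff ℝ ∞ (spaceCutoff a b δ) :=
  (Real.smoothTransition.contDiff.comp (by fun_prop)).mul
    (Real.smoothTransition.contDiff.comp (by fun_prop))

theorem spaceCutoff_eq_one {a b δ x : ℝ} (hδ : 0 < δ) (h1 : a - δ / 2 ≤ x) (h2 : x ≤ b + δ / 2) :
    spaceCutoff a b δ x = 1 := by
  have e1 : -1 ≤ (x - a) * (2 / δ) := by rw [mul_div_assoc', le_div_iff₀ hδ]; linarith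
  have e2 : -1 ≤ (b - x) * (2 / δ) := by rw [mul_div_assoc', le_div_iff₀ hδ]; linarith
  rw [spaceCutoff, Real.smoothTransition.one_of_one_le (by linarith),
    Real.smoothTransition.one_of_one_le (by linarith), one_mul]

theorem spaceCutoff_eq_zero {a b δ x : ℝ} (hδ : 0 < δ) (h : x ∉ Ioo (a - δ) (b + δ)) :
    spaceCutoff a b δ x = 0 := by
  rw [mem_Ioo, not_and_or, not_lt, not_lt] at h
  rcases h with h | h
  · have e1 : (x - a) * (2 / δ) ≤ -2 := by rw [mul_div_assoc', div_le_iff₀ hδ]; linarith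
    rw [spaceCutoff, Real.smoothTransition.zero_of_nonpos (by linarith), zero_mul]
  · have e2 : (b - x) * (2 / δ) ≤ -2 := by rw [mul_div_assoc', div_le_iff₀ hδ]; linarith
    rw [spaceCutoff, Real.smoothTransition.zero_of_nonpos (x := (b - x) * (2 / δ) + 2)
      (by linarith), mul_zero]

/-- The compactly supported test function that agrees on `[a, b] × [0, T)` with a function `Φ`
that is smooth near this set and vanishes for times close to `T`. -/
noncomputable def cutoffTest {a b δ S T : ℝ} {Φ : ℝ → ℝ → ℝ} (hδ : 0 < δ) (hS : S < T)
    (hsmooth : ∀ x t, x ∈ Icc (a - δ) (b + δ) → ContDiffAt ℝ ∞ (Function.uncurry Φ) (x, t))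
    (hzero : ∀ x t, S ≤ t → Φ x t = 0) : 𝓓(spaceTimeDomain T, ℝ) where
  toFun p := spaceCutoff a b δ p.1 * (timeCutoff p.2 * Φ p.1 p.2)
  contDiff' := by
    have hs := contDiff_spaceCutoff a b δ
    have ht := contDiff_timeCutoff
    refine contDiff_iff_contDiffAt.2 fun p => ?_
    by_cases hp : p.1 ∈ Icc (a - δ) (b + δ)
    · have h1 : ContDiffAt ℝ ∞ (fun p : ℝ × ℝ => Φ p.1 p.2) p := hsmooth p.1 p.2 hp
      exact (hs.comp contDiff_fst).contDiffAt.mul ((ht.comp contDiff_snd).contDiffAt.mul h1)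
    · have : (fun p : ℝ × ℝ => spaceCutoff a b δ p.1 * (timeCutoff p.2 * Φ p.1 p.2))
          =ᶠ[𝓝 p] fun _ => 0 := by
        filter_upwards [(isClosed_Icc.isOpen_compl.preimage continuous_fst).mem_nhds hp] with q hq
        rw [spaceCutoff_eq_zero hδ fun h => hq (Ioo_subset_Icc_self h), zero_mul]
      exact contDiffAt_const.congr_of_eventuallyEq this
  hasCompactSupport' := by
    refine HasCompactSupport.intro ((isCompact_Icc (a := a - δ) (b := b + δ)).prod
      (isCompact_Icc (a := -2) (b := S))) fun p hp => ?_
    by_cases h1 : p.1 ∈ Ioo (a - δ) (b + δ)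
    · rcases le_total p.2 (-2) with h2 | h2
      · rw [timeCutoff_eq_zero h2]; ring
      · rw [hzero _ _ (not_lt.1 fun h3 => hp ⟨Ioo_subset_Icc_self h1, h2, h3.le⟩)]; ring
    · rw [spaceCutoff_eq_zero hδ h1, zero_mul]
  tsupport_subset' := by
    have : tsupport (fun p : ℝ × ℝ => spaceCutoff a b δ p.1 * (timeCutoff p.2 * Φ p.1 p.2)) ⊆
        {p | p.2 ≤ S} := by
      refine closure_minimal (fun p hp => ?_) (isClosed_le continuous_snd continuous_const)
      by_contra hcon
      exact hp (by simp [hzero p.1 p.2 (not_le.1 hcon).le])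
    exact fun p hp => lt_of_le_of_lt (this hp) hS

/-- The weak formulation tested with a smooth solution of the backward heat equation. -/
theorem IsHeatSolution.boundary_eq {a b T : ℝ} {u : ℝ × ℝ → ℝ} {wa wb : ℝ → ℝ}
    {qa qb : 𝓓'(timeDomain T, ℝ)} (h : IsHeatSolution a b T u wa wb qa qb) (hab : a < b)
    {δ S : ℝ} (hδ : 0 < δ) (hS : S < T) {Φ Φt Φx : ℝ → ℝ → ℝ}
    (hsmooth : ∀ x t, x ∈ Icc (a - δ) (b + δ) → ContDiffAt ℝ ∞ (Function.uncurry Φ) (x, t))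
    (hzero : ∀ x t, S ≤ t → Φ x t = 0)
    (hx : ∀ x ∈ Icc a b, ∀ t, HasDerivAt (fun x => Φ x t) (Φx x t) x)
    (hxx : ∀ x ∈ Ioo a b, ∀ t, HasDerivAt (fun x => Φx x t) (-Φt x t) x)
    (ht : ∀ x ∈ Ioo a b, ∀ t, HasDerivAt (Φ x) (Φt x t) t)
    {ηa ηb : finalTest T} (ha : Φ a = ηa) (hb : Φ b = ηb) :
    (∫ t in Ioo 0 T, wb t * Φx b t) - (∫ t in Ioo 0 T, wa t * Φx a t)
      = qb (cutHom T ηb) - qa (cutHom T ηa) := by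
  set φ := cutoffTest hδ hS hsmooth hzero with hφ
  have hval : ∀ x t, φ (x, t) = spaceCutoff a b δ x * (timeCutoff t * Φ x t) := fun _ _ => rfl
  have hnear : ∀ x ∈ Icc a b, ∀ t, 0 < t → (fun x => φ (x, t)) =ᶠ[𝓝 x] fun x => Φ x t := by
    intro x hx t ht
    filter_upwards [Ioo_mem_nhds (show a - δ / 2 < x by linarith [hx.1])
      (show x < b + δ / 2 by linarith [hx.2])] with y hy
    rw [hval, spaceCutoff_eq_one hδ hy.1.le hy.2.le, timeCutoff_eq_one (by linarith), one_mul,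
      one_mul]
  have hneart : ∀ x ∈ Icc a b, ∀ t, 0 < t → (fun t => φ (x, t)) =ᶠ[𝓝 t] Φ x := by
    intro x hx t ht
    filter_upwards [lt_mem_nhds ht] with s hs
    rw [hval, spaceCutoff_eq_one hδ (by linarith [hx.1]) (by linarith [hx.2]),
      timeCutoff_eq_one (by linarith), one_mul, one_mul]
  -- The cutoffs equal $1$ near the points that matter, so the backward heat equation for $\Phi$
  -- annihilates the interior integral and only boundary terms remain.
  have hlhs : ∫ p in Ioo a b ×ˢ Ioo 0 T,
      u p * (deriv (fun t => φ (p.1, t)) p.2 + iteratedDeriv 2 (fun x => φ (x, p.2)) p.1) = 0 := by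
    refine setIntegral_eq_zero_of_forall_eq_zero fun p hp => ?_
    obtain ⟨hp1, hp2⟩ := hp
    have e1 := (hneart p.1 (Ioo_subset_Icc_self hp1) p.2 hp2.1).deriv_eq
    have e2 : iteratedDeriv 2 (fun x => φ (x, p.2)) p.1 = -Φt p.1 p.2 := by
      rw [(hnear p.1 (Ioo_subset_Icc_self hp1) p.2 hp2.1).iteratedDeriv_eq, iteratedDeriv_succ,
        iteratedDeriv_one]
      have : deriv (fun x => Φ x p.2) =ᶠ[𝓝 p.1] fun x => Φx x p.2 := by
        filter_upwards [Ioo_mem_nhds hp1.1 hp1.2] with y hy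
          using (hx y (Ioo_subset_Icc_self hy) p.2).deriv
      rw [this.deriv_eq, (hxx p.1 hp1 p.2).deriv]
    rw [e1, e2, (ht p.1 hp1 p.2).deriv]
    ring
  have hr : ∀ w : ℝ → ℝ, ∀ y ∈ Icc a b, ∫ t in Ioo 0 T, w t * deriv (fun x => φ (x, t)) y
      = ∫ t in Ioo 0 T, w t * Φx y t := by
    intro w y hy
    refine setIntegral_congr_fun measurableSet_Ioo fun t ht => ?_
    rw [(hnear y hy t ht.1).deriv_eq, (hx y hy t).deriv]
  have hslice : ∀ y ∈ Icc a b, ∀ η : finalTest T, Φ y = η → slice y φ = cutHom T η := by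
    intro y hy η he
    ext t
    change φ (y, t) = _
    rw [hval, cutHom_apply, spaceCutoff_eq_one hδ (by linarith [hy.1]) (by linarith [hy.2]),
      he, one_mul]
  have key := h.weak_eq φ
  rw [hlhs, hr wb b (right_mem_Icc.2 hab.le), hr wa a (left_mem_Icc.2 hab.le),
    hslice b (right_mem_Icc.2 hab.le) ηb hb, hslice a (left_mem_Icc.2 hab.le) ηa ha] at key
  linarith

/-- The relation between the boundary data along the characteristic travelling to the right. -/
theorem IsHeatSolution.characteristic_right {a b T : ℝ} {u : ℝ × ℝ → ℝ} {wa wb : ℝ → ℝ}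
    {qa qb : 𝓓'(timeDomain T, ℝ)} (h : IsHeatSolution a b T u wa wb qa qb) (hab : a < b)
    {l c : ℝ≥0} (hl : (l : ℝ) = b - a) (hc : 0 < c) (η : finalTest T) :
    (∫ t in Ioo 0 T, wb t * propagateDeriv (c + l) η t)
        - (∫ t in Ioo 0 T, wa t * propagateDeriv c η t)
      = qb (cutHom T (propagateHom T (c + l) η)) - qa (cutHom T (propagateHom T c η)) := by
  have hc' : (0 : ℝ) < c := hc
  obtain ⟨-, S, hS, hz⟩ := η.2
  -- With $\delta=c/2$ the distance $c+(x-a)$ stays positive on the enlarged interval, where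
  -- smoothness of the propagation is needed.
  have := h.boundary_eq hab (δ := c / 2) (S := S) (half_pos hc') hS
    (Φ := fun x t => propagate (c + (x - a)) η t)
    (Φt := fun x t => propagate (c + (x - a)) (deriv η) t)
    (Φx := fun x t => propagateDeriv (c + (x - a)) η t)
    (ηa := propagateHom T c η) (ηb := propagateHom T (c + l) η) ?_ ?_ ?_ ?_ ?_ ?_ ?_
  · simpa [hl] using this
  · intro x t hx
    have := (contDiffOn_propagate η.2).contDiffAt (x := (c + (x - a), t))
      ((isOpen_lt continuous_const continuous_fst).mem_nhds (by
        change 0 < (c : ℝ) + (x - a); linarith [hx.1]))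
    exact this.comp (x, t) (f := fun p : ℝ × ℝ => ((c : ℝ) + (p.1 - a), p.2))
      (ContDiff.contDiffAt (by fun_prop))
  · exact fun x t ht => propagate_eq_zero hz _ ht
  · intro x hx t
    have := hasDerivAt_propagate η.2 (show 0 < c + (x - a) by linarith [hx.1]) t
    exact (this.comp_const_add (c : ℝ) (x - a)).comp_sub_const x a
  · intro x hx t
    have := hasDerivAt_propagateDeriv_eq η.2 (show 0 < c + (x - a) by linarith [hx.1]) t
    exact (this.comp_const_add (c : ℝ) (x - a)).comp_sub_const x a
  · exact fun x hx t => hasDerivAt_propagate_time η.2 (by linarith [hx.1]) t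
  · simp
  · simp [hl]

/-- The relation between the boundary data along the characteristic travelling to the left. -/
theorem IsHeatSolution.characteristic_left {a b T : ℝ} {u : ℝ × ℝ → ℝ} {wa wb : ℝ → ℝ}
    {qa qb : 𝓓'(timeDomain T, ℝ)} (h : IsHeatSolution a b T u wa wb qa qb) (hab : a < b)
    {l c : ℝ≥0} (hl : (l : ℝ) = b - a) (hc : 0 < c) (η : finalTest T) :
    (∫ t in Ioo 0 T, wa t * propagateDeriv (c + l) η t)
        - (∫ t in Ioo 0 T, wb t * propagateDeriv c η t)
      = qb (cutHom T (propagateHom T c η)) - qa (cutHom T (propagateHom T (c + l) η)) := by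
  have hc' : (0 : ℝ) < c := hc
  obtain ⟨-, S, hS, hz⟩ := η.2
  have := h.boundary_eq hab (δ := c / 2) (S := S) (half_pos hc') hS
    (Φ := fun x t => propagate (c + (b - x)) η t)
    (Φt := fun x t => propagate (c + (b - x)) (deriv η) t)
    (Φx := fun x t => -propagateDeriv (c + (b - x)) η t)
    (ηb := propagateHom T c η) (ηa := propagateHom T (c + l) η) ?_ ?_ ?_ ?_ ?_ ?_ ?_
  · simp only [mul_neg, integral_neg, sub_self, add_zero, ← hl] at this
    linarith
  · intro x t hx
    have := (contDiffOn_propagate η.2).contDiffAt (x := (c + (b - x), t))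
      ((isOpen_lt continuous_const continuous_fst).mem_nhds (by
        change 0 < (c : ℝ) + (b - x); linarith [hx.2]))
    exact this.comp (x, t) (f := fun p : ℝ × ℝ => ((c : ℝ) + (b - p.1), p.2))
      (ContDiff.contDiffAt (by fun_prop))
  · exact fun x t ht => propagate_eq_zero hz _ ht
  · intro x hx t
    have := hasDerivAt_propagate η.2 (show 0 < c + (b - x) by linarith [hx.2]) t
    exact (this.comp_const_add (c : ℝ) (b - x)).comp_const_sub b x
  · intro x hx t
    have := hasDerivAt_propagateDeriv_eq η.2 (show 0 < c + (b - x) by linarith [hx.2]) t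
    exact ((this.comp_const_add (c : ℝ) (b - x)).comp_const_sub b x).fun_neg.congr_deriv
      (neg_neg _)
  · exact fun x hx t => hasDerivAt_propagate_time η.2 (by linarith [hx.2]) t
  · simp [hl]
  · simp

end NNWR
-- Elimination of the boundary derivatives over a commutative ring
namespace NNWR

section Elimination

variable {A V : Type*} [CommRing A] [AddCommGroup V] [Module A V]

/-- The two characteristic relations between the boundary values `wa`, `wb` and the boundary
derivatives `qa`, `qb` of a solution of the heat equation on an interval, where `e` stands for the
propagation over the length of the interval. -/
def HeatRel (e : A) (wa wb qa qb : V) : Prop :=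
  e • wb - wa = e • qb - qa ∧ e • wa - wb = qb - e • qa

variable {e e₀ e₁ e₂ e₃ : A} {wa wb qa qb : V}

/-- Reflecting the interval exchanges its ends and changes the sign of the space derivative. -/
theorem HeatRel.reflect (h : HeatRel e wa wb qa qb) : HeatRel e wb wa (-qb) (-qa) :=
  ⟨by linear_combination (norm := module) h.2, by linear_combination (norm := module) h.1⟩

/-- The Dirichlet-to-Neumann map with denominators cleared, as $1-e^2$ need not act invertibly.
Since `HeatRel` is symmetric under exchanging values and derivatives, the Neumann-to-Dirichlet
formulas below have the same coefficients. -/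
theorem HeatRel.deriv_right (h : HeatRel e wa wb qa qb) :
    (1 - e ^ 2) • qb = (2 * e) • wa - (1 + e ^ 2) • wb := by
  obtain ⟨h1, h2⟩ := h
  linear_combination (norm := module) e • h1 - h2

theorem HeatRel.deriv_left (h : HeatRel e wa wb qa qb) :
    (1 - e ^ 2) • qa = (1 + e ^ 2) • wa - (2 * e) • wb := by
  obtain ⟨h1, h2⟩ := h
  linear_combination (norm := module) h1 - e • h2

theorem HeatRel.value_right (h : HeatRel e wa wb qa qb) :
    (1 - e ^ 2) • wb = (2 * e) • qa - (1 + e ^ 2) • qb := by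
  obtain ⟨h1, h2⟩ := h
  linear_combination (norm := module) - e • h1 - h2

theorem HeatRel.value_left (h : HeatRel e wa wb qa qb) :
    (1 - e ^ 2) • wa = (1 + e ^ 2) • qa - (2 * e) • qb := by
  obtain ⟨h1, h2⟩ := h
  linear_combination (norm := module) - h1 - e • h2

theorem HeatRel.value_right_of_zero (h : HeatRel e 0 wb qa qb) :
    (1 + e ^ 2) • wb = -((1 - e ^ 2) • qb) := by
  linear_combination (norm := module) h.deriv_right

theorem HeatRel.value_left_of_zero (h : HeatRel e wa 0 qa qb) :
    (1 + e ^ 2) • wa = (1 - e ^ 2) • qa := by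
  linear_combination (norm := module) - h.deriv_left

variable {w₀ w₁ w₂ w₃ w₄ w' l₀ l₁ l₂ l₃ r₀ r₁ r₂ r₃ a₁ b₁ a₂ b₂ : V}

/-- The update at an interface whose two neighbouring subdomains are interior. -/
theorem update_interior
    (h₀ : HeatRel e₀ w₀ w₁ l₀ r₀) (h₁ : HeatRel e₁ w₁ w₂ l₁ r₁)
    (h₂ : HeatRel e₂ w₂ w₃ l₂ r₂) (h₃ : HeatRel e₃ w₃ w₄ l₃ r₃)
    (n₁ : HeatRel e₁ a₁ b₁ (-(r₀ - l₁)) (r₁ - l₂))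
    (n₂ : HeatRel e₂ a₂ b₂ (-(r₁ - l₂)) (r₂ - l₃))
    (hw : (4 : A) • w' = (4 : A) • w₂ - (b₁ + a₂)) :
    (4 * (1 - e₁ ^ 2) * (1 - e₂ ^ 2)) •
      (((1 - e₀ ^ 2) * (1 - e₁ ^ 2) * (1 - e₂ ^ 2) * (1 - e₃ ^ 2)) • w'
        + ((1 - e₀ ^ 2) * (1 - e₃ ^ 2) * (e₁ ^ 2 + e₂ ^ 2)) • w₂
        + ((1 - e₃ ^ 2) * (e₁ * (e₀ ^ 2 - e₂ ^ 2))) • w₁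
        + ((1 - e₀ ^ 2) * (e₂ * (e₃ ^ 2 - e₁ ^ 2))) • w₃
        - ((1 - e₂ ^ 2) * (1 - e₃ ^ 2) * (e₀ * e₁)) • w₀
        - ((1 - e₀ ^ 2) * (1 - e₁ ^ 2) * (e₂ * e₃)) • w₄) = 0 := by
  have hb := n₁.value_right
  have ha := n₂.value_left
  have hr₀ := h₀.deriv_right
  have hl₁ := h₁.deriv_left
  have hr₁ := h₁.deriv_right
  have hl₂ := h₂.deriv_left
  have hr₂ := h₂.deriv_right
  have hl₃ := h₃.deriv_left
  -- Back substitution with cleared denominators: each relation is weighted by the coefficient with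
  -- which its unknown enters the update, times the denominators of the others.
  linear_combination (norm := module)
    ((1 - e₀ ^ 2) * (1 - e₁ ^ 2) ^ 2 * (1 - e₂ ^ 2) ^ 2 * (1 - e₃ ^ 2)) • hw
    - ((1 - e₀ ^ 2) * (1 - e₁ ^ 2) * (1 - e₂ ^ 2) ^ 2 * (1 - e₃ ^ 2)) • hb
    - ((1 - e₀ ^ 2) * (1 - e₁ ^ 2) ^ 2 * (1 - e₂ ^ 2) * (1 - e₃ ^ 2)) • ha
    + (2 * e₁ * (1 - e₁ ^ 2) * (1 - e₂ ^ 2) ^ 2 * (1 - e₃ ^ 2)) • hr₀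
    - (2 * e₁ * (1 - e₀ ^ 2) * (1 - e₂ ^ 2) ^ 2 * (1 - e₃ ^ 2)) • hl₁
    + ((1 - e₀ ^ 2) * (1 - e₂ ^ 2) * (1 - e₃ ^ 2) *
        ((1 + e₁ ^ 2) * (1 - e₂ ^ 2) + (1 + e₂ ^ 2) * (1 - e₁ ^ 2))) • hr₁
    - ((1 - e₀ ^ 2) * (1 - e₁ ^ 2) * (1 - e₃ ^ 2) *
        ((1 + e₁ ^ 2) * (1 - e₂ ^ 2) + (1 + e₂ ^ 2) * (1 - e₁ ^ 2))) • hl₂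
    + (2 * e₂ * (1 - e₀ ^ 2) * (1 - e₁ ^ 2) ^ 2 * (1 - e₃ ^ 2)) • hr₂
    - (2 * e₂ * (1 - e₀ ^ 2) * (1 - e₁ ^ 2) ^ 2 * (1 - e₂ ^ 2)) • hl₃

/-- The update at the first interface, if there are at least two of them. -/
theorem update_left
    (h₁ : HeatRel e₁ 0 w₂ l₁ r₁) (h₂ : HeatRel e₂ w₂ w₃ l₂ r₂) (h₃ : HeatRel e₃ w₃ w₄ l₃ r₃)
    (n₁ : HeatRel e₁ 0 b₁ l₀ (r₁ - l₂))
    (n₂ : HeatRel e₂ a₂ b₂ (-(r₁ - l₂)) (r₂ - l₃))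
    (hw : (4 : A) • w' = (4 : A) • w₂ - (b₁ + a₂)) :
    (4 * (1 - e₂ ^ 2)) •
      (((1 - e₁ ^ 4) * (1 - e₂ ^ 2) * (1 - e₃ ^ 2)) • w'
        + ((1 - e₃ ^ 2) * (e₁ ^ 4 + e₂ ^ 2)) • w₂
        + ((1 - e₁ ^ 4) * (e₂ * e₃ ^ 2) + (1 - e₃ ^ 2) * (e₂ * (e₁ ^ 2 - e₁ ^ 4))) • w₃
        - ((1 - e₁ ^ 4) * (e₂ * e₃)) • w₄) = 0 := by
  have hb := n₁.value_right_of_zero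
  have ha := n₂.value_left
  have hr₁ := h₁.deriv_right
  have hl₂ := h₂.deriv_left
  have hr₂ := h₂.deriv_right
  have hl₃ := h₃.deriv_left
  linear_combination (norm := module)
    ((1 - e₁ ^ 2) * (1 + e₁ ^ 2) * (1 - e₂ ^ 2) ^ 2 * (1 - e₃ ^ 2)) • hw
    - ((1 - e₁ ^ 2) * (1 - e₂ ^ 2) ^ 2 * (1 - e₃ ^ 2)) • hb
    - ((1 - e₁ ^ 2) * (1 + e₁ ^ 2) * (1 - e₂ ^ 2) * (1 - e₃ ^ 2)) • ha
    + ((1 - e₂ ^ 2) * (1 - e₃ ^ 2) *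
        ((1 - e₁ ^ 2) * (1 - e₂ ^ 2) + (1 + e₁ ^ 2) * (1 + e₂ ^ 2))) • hr₁
    - ((1 - e₁ ^ 2) * (1 - e₃ ^ 2) *
        ((1 - e₁ ^ 2) * (1 - e₂ ^ 2) + (1 + e₁ ^ 2) * (1 + e₂ ^ 2))) • hl₂
    + (2 * e₂ * (1 - e₁ ^ 2) * (1 + e₁ ^ 2) * (1 - e₃ ^ 2)) • hr₂
    - (2 * e₂ * (1 - e₁ ^ 2) * (1 + e₁ ^ 2) * (1 - e₂ ^ 2)) • hl₃

/-- The update at the last interface, if there are at least two of them. -/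
theorem update_right
    (h₁ : HeatRel e₁ w₂ 0 l₁ r₁) (h₂ : HeatRel e₂ w₃ w₂ l₂ r₂) (h₃ : HeatRel e₃ w₄ w₃ l₃ r₃)
    (n₁ : HeatRel e₁ b₁ 0 (-(r₂ - l₁)) r₀)
    (n₂ : HeatRel e₂ b₂ a₂ (-(r₃ - l₂)) (r₂ - l₁))
    (hw : (4 : A) • w' = (4 : A) • w₂ - (a₂ + b₁)) :
    (4 * (1 - e₂ ^ 2)) •
      (((1 - e₁ ^ 4) * (1 - e₂ ^ 2) * (1 - e₃ ^ 2)) • w'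
        + ((1 - e₃ ^ 2) * (e₁ ^ 4 + e₂ ^ 2)) • w₂
        + ((1 - e₁ ^ 4) * (e₂ * e₃ ^ 2) + (1 - e₃ ^ 2) * (e₂ * (e₁ ^ 2 - e₁ ^ 4))) • w₃
        - ((1 - e₁ ^ 4) * (e₂ * e₃)) • w₄) = 0 := by
  refine update_left (l₁ := -r₁) (r₁ := -l₁) (l₂ := -r₂) (r₂ := -l₂) (l₃ := -r₃) (r₃ := -l₃)
    (l₀ := -r₀) (b₁ := b₁) (a₂ := a₂) (b₂ := b₂) h₁.reflect h₂.reflect h₃.reflect ?_ ?_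
    (by rw [hw, add_comm])
  · convert n₁.reflect using 1; abel
  · convert n₂.reflect using 1 <;> abel

/-- The update at the interface in the case of two subdomains. -/
theorem update_single
    (h₁ : HeatRel e₁ 0 w₂ l₁ r₁) (h₂ : HeatRel e₂ w₂ 0 l₂ r₂)
    (n₁ : HeatRel e₁ 0 b₁ l₀ (r₁ - l₂)) (n₂ : HeatRel e₂ a₂ 0 (-(r₁ - l₂)) r₀)
    (hw : (4 : A) • w' = (4 : A) • w₂ - (b₁ + a₂)) :
    (4 : A) • (((1 - e₁ ^ 4) * (1 - e₂ ^ 4)) • w' + (e₁ ^ 2 - e₂ ^ 2) ^ 2 • w₂) = 0 := by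
  have hb := n₁.value_right_of_zero
  have ha := n₂.value_left_of_zero
  have hr₁ := h₁.deriv_right
  have hl₂ := h₂.deriv_left
  linear_combination (norm := module)
    ((1 - e₁ ^ 2) * (1 + e₁ ^ 2) * (1 - e₂ ^ 2) * (1 + e₂ ^ 2)) • hw
    - ((1 - e₁ ^ 2) * (1 - e₂ ^ 2) * (1 + e₂ ^ 2)) • hb
    - ((1 - e₁ ^ 2) * (1 + e₁ ^ 2) * (1 - e₂ ^ 2)) • ha
    + ((1 - e₂ ^ 2) * ((1 - e₁ ^ 2) * (1 + e₂ ^ 2) + (1 + e₁ ^ 2) * (1 - e₂ ^ 2))) • hr₁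
    - ((1 - e₁ ^ 2) * ((1 - e₁ ^ 2) * (1 + e₂ ^ 2) + (1 + e₁ ^ 2) * (1 - e₂ ^ 2))) • hl₂

end Elimination

end NNWR
-- The ring of delays and its modules of functionals and of functions of the distance
namespace NNWR

/-- The ring of finite linear combinations of delays. -/
abbrev DelayRing := AddMonoidAlgebra ℝ ℝ≥0

/-- The delay by `a`, as an element of the ring of delays. -/
noncomputable def delay (a : ℝ≥0) : DelayRing := AddMonoidAlgebra.single a 1

theorem delay_zero : delay 0 = 1 := rfl

theorem delay_add (a b : ℝ≥0) : delay (a + b) = delay a * delay b := by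
  simp [delay, AddMonoidAlgebra.single_mul_single]

theorem delay_pow (a : ℝ≥0) (n : ℕ) : delay a ^ n = delay (n * a) := by
  simp [delay, AddMonoidAlgebra.single_pow]

/-- The module over the ring of delays given by a one-parameter semigroup. -/
noncomputable abbrev delayModule {M : Type*} [AddCommGroup M] [Module ℝ M]
    (ρ : Multiplicative ℝ≥0 →* Module.End ℝ M) : Module DelayRing M :=
  Module.compHom M (AddMonoidAlgebra.lift ℝ (Module.End ℝ M) ℝ≥0 ρ).toRingHom

/-- The functionals `ℓ` on test functions for which `ℓ (propagate c η)` decays exponentially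
in `c`. -/
def decayDual (T : ℝ) : Submodule ℝ (finalTest T →ₗ[ℝ] ℝ) where
  carrier := {ℓ | ∀ η, ∃ C, ∀ c : ℝ≥0, |ℓ (propagateHom T c η)| ≤ C * Real.exp (-c)}
  zero_mem' η := ⟨0, by simp⟩
  add_mem' := by
    intro ℓ m hℓ hm η
    obtain ⟨C, hC⟩ := hℓ η
    obtain ⟨D, hD⟩ := hm η
    refine ⟨C + D, fun c => ?_⟩
    rw [add_mul]
    exact (abs_add_le _ _).trans (add_le_add (hC c) (hD c))
  smul_mem' := by
    intro r ℓ hℓ η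
    obtain ⟨C, hC⟩ := hℓ η
    refine ⟨|r| * C, fun c => ?_⟩
    rw [LinearMap.smul_apply, smul_eq_mul, abs_mul, mul_assoc]
    exact mul_le_mul_of_nonneg_left (hC c) (abs_nonneg r)

/-- The functionals in `decayDual T`, as a module over the ring of delays. -/
def DecayDual (T : ℝ) : Type := decayDual T

noncomputable instance (T : ℝ) : AddCommGroup (DecayDual T) :=
  inferInstanceAs (AddCommGroup (decayDual T))

noncomputable instance (T : ℝ) : Module ℝ (DecayDual T) :=
  inferInstanceAs (Module ℝ (decayDual T))

namespace DecayDual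

variable {T : ℝ}

/-- Evaluation of a functional. -/
def eval (η : finalTest T) : DecayDual T →ₗ[ℝ] ℝ where
  toFun ℓ := ℓ.1 η
  map_add' _ _ := rfl
  map_smul' _ _ := rfl

theorem ext {ℓ m : DecayDual T} (h : ∀ η, eval η ℓ = eval η m) : ℓ = m :=
  Subtype.ext (LinearMap.ext h)

theorem exists_bound (ℓ : DecayDual T) (η : finalTest T) :
    ∃ C, ∀ c : ℝ≥0, |eval (propagateHom T c η) ℓ| ≤ C * Real.exp (-c) := ℓ.2 η

theorem eval_add_test (η ζ : finalTest T) (ℓ : DecayDual T) :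
    eval (η + ζ) ℓ = eval η ℓ + eval ζ ℓ := map_add ℓ.1 η ζ

theorem eval_sub_test (η ζ : finalTest T) (ℓ : DecayDual T) :
    eval (η - ζ) ℓ = eval η ℓ - eval ζ ℓ := map_sub ℓ.1 η ζ

theorem eval_smul_test (r : ℝ) (η : finalTest T) (ℓ : DecayDual T) :
    eval (r • η) ℓ = r * eval η ℓ := map_smul ℓ.1 r η

theorem eval_sum_test {ι : Type*} (s : Finset ι) (η : ι → finalTest T) (ℓ : DecayDual T) :
    eval (∑ i ∈ s, η i) ℓ = ∑ i ∈ s, eval (η i) ℓ := map_sum ℓ.1 η s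

/-- The transpose of the propagation. -/
noncomputable def shift (T : ℝ) : Multiplicative ℝ≥0 →* Module.End ℝ (DecayDual T) where
  toFun a :=
    { toFun := fun ℓ => ⟨ℓ.1.comp (propagateHom T a.toAdd), fun η => by
        obtain ⟨C, hC⟩ := ℓ.2 (propagateHom T a.toAdd η)
        refine ⟨C, fun c => ?_⟩
        have := hC c
        rwa [propagateHom_add, add_comm, ← propagateHom_add] at this⟩
      map_add' := fun _ _ => rfl
      map_smul' := fun _ _ => rfl }
  map_one' := by
    refine LinearMap.ext fun ℓ => ext fun η => ?_
    exact congrArg ℓ.1 (propagateHom_zero η)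
  map_mul' a b := by
    refine LinearMap.ext fun ℓ => ext fun η => ?_
    change ℓ.1 (propagateHom T (a.toAdd + b.toAdd) η)
      = ℓ.1 (propagateHom T b.toAdd (propagateHom T a.toAdd η))
    rw [propagateHom_add, add_comm]

noncomputable instance : Module DelayRing (DecayDual T) := delayModule (shift T)

theorem single_smul_eq (a : ℝ≥0) (r : ℝ) (ℓ : DecayDual T) :
    (AddMonoidAlgebra.single a r : DelayRing) • ℓ = r • shift T (Multiplicative.ofAdd a) ℓ := by
  change AddMonoidAlgebra.lift ℝ _ ℝ≥0 (shift T) (AddMonoidAlgebra.single a r) ℓ = _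
  rw [AddMonoidAlgebra.lift_single]
  rfl

theorem eval_single_smul (a : ℝ≥0) (r : ℝ) (ℓ : DecayDual T) (η : finalTest T) :
    eval η ((AddMonoidAlgebra.single a r : DelayRing) • ℓ) = r * eval (propagateHom T a η) ℓ := by
  rw [single_smul_eq]
  rfl

@[simp]
theorem eval_delay_smul (a : ℝ≥0) (ℓ : DecayDual T) (η : finalTest T) :
    eval η (delay a • ℓ) = eval (propagateHom T a η) ℓ := by
  rw [delay, eval_single_smul, one_mul]

theorem tendsto_eval_propagate (ℓ : DecayDual T) (η : finalTest T) {s : ℝ≥0} (hs : 0 < s) :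
    Tendsto (fun n : ℕ => eval (propagateHom T (n * s) η) ℓ) atTop (𝓝 0) := by
  obtain ⟨C, hC⟩ := exists_bound ℓ η
  have h1 : Tendsto (fun n : ℕ => C * Real.exp (-((n : ℝ) * s))) atTop (𝓝 (C * 0)) := by
    refine Tendsto.const_mul C (Real.tendsto_exp_neg_atTop_nhds_zero.comp ?_)
    exact tendsto_natCast_atTop_atTop.atTop_mul_const (show (0 : ℝ) < s from hs)
  rw [mul_zero] at h1
  refine squeeze_zero_norm (fun n => ?_) h1
  simpa using hC (n * s)

/-- A functional fixed by a positive delay is fixed by all its multiples, and therefore vanishes by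
decay. -/
theorem eq_zero_of_one_sub_delay_smul {s : ℝ≥0} (hs : 0 < s) {ℓ : DecayDual T}
    (h : (1 - delay s) • ℓ = 0) : ℓ = 0 := by
  rw [sub_smul, one_smul, sub_eq_zero] at h
  have hn : ∀ n : ℕ, delay (n * s) • ℓ = ℓ := by
    intro n
    induction n with
    | zero => simp [delay_zero]
    | succ n ih => rw [Nat.cast_succ, add_mul, one_mul, delay_add, mul_smul, ← h, ih]
  refine ext fun η => ?_
  have h1 : (fun n : ℕ => eval (propagateHom T (n * s) η) ℓ) = fun _ => eval η ℓ := by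
    ext n
    rw [← eval_delay_smul, hn]
  have h2 := tendsto_eval_propagate ℓ η hs
  rw [h1] at h2
  simpa using tendsto_nhds_unique tendsto_const_nhds h2

theorem summable_eval_propagate (ℓ : DecayDual T) (η : finalTest T) {s : ℝ≥0} (hs : 0 < s) :
    Summable fun n : ℕ => eval (propagateHom T (n * s) η) ℓ := by
  obtain ⟨C, hC⟩ := exists_bound ℓ η
  have hgeo : Summable fun n : ℕ => C * Real.exp (-s) ^ n :=
    (summable_geometric_of_lt_one (Real.exp_pos _).le
      (Real.exp_lt_one_iff.2 (by simpa using hs))).mul_left C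
  refine Summable.of_norm_bounded hgeo fun n => ?_
  rw [← Real.exp_nat_mul]
  simpa using hC (n * s)

/-- The inverse of `1 - delay s` on decaying functionals. -/
noncomputable def resolvent (s : ℝ≥0) (hs : 0 < s) (ℓ : DecayDual T) : DecayDual T :=
  ⟨{ toFun := fun η => ∑' n : ℕ, eval (propagateHom T (n * s) η) ℓ
     map_add' := fun η ζ => by
       simp_rw [map_add, eval_add_test]
       exact (summable_eval_propagate ℓ η hs).tsum_add (summable_eval_propagate ℓ ζ hs)
     map_smul' := fun r η => by
       simp_rw [map_smul, eval_smul_test]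
       exact tsum_mul_left }, fun η => by
    obtain ⟨C, hC⟩ := exists_bound ℓ η
    refine ⟨∑' n : ℕ, C * Real.exp (-s) ^ n, fun c => ?_⟩
    have hgeo : Summable fun n : ℕ => C * Real.exp (-s) ^ n :=
      (summable_geometric_of_lt_one (Real.exp_pos _).le
        (Real.exp_lt_one_iff.2 (by simpa using hs))).mul_left C
    change |∑' n : ℕ, eval (propagateHom T (n * s) (propagateHom T c η)) ℓ| ≤ _
    rw [← tsum_mul_right, ← Real.norm_eq_abs]
    refine tsum_of_norm_bounded (hgeo.mul_right _).hasSum fun n => ?_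
    rw [propagateHom_add, ← Real.exp_nat_mul, mul_assoc, ← Real.exp_add]
    have he : -((n * s + c : ℝ≥0) : ℝ) = n * -(s : ℝ) + -(c : ℝ) := by
      push_cast
      ring
    rw [← he]
    exact hC _⟩

theorem eval_resolvent (s : ℝ≥0) (hs : 0 < s) (ℓ : DecayDual T) (η : finalTest T) :
    eval η (resolvent s hs ℓ) = ∑' n : ℕ, eval (propagateHom T (n * s) η) ℓ := rfl

theorem hasSum_resolvent (s : ℝ≥0) (hs : 0 < s) (ℓ : DecayDual T) (η : finalTest T) :
    HasSum (fun n : ℕ => eval (propagateHom T (n * s) η) ℓ) (eval η (resolvent s hs ℓ)) :=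
  (summable_eval_propagate ℓ η hs).hasSum

/-- The Neumann series telescopes; exponential decay makes it converge. -/
theorem one_sub_delay_smul_resolvent (s : ℝ≥0) (hs : 0 < s) (ℓ : DecayDual T) :
    (1 - delay s) • resolvent s hs ℓ = ℓ := by
  refine ext fun η => ?_
  rw [sub_smul, one_smul, map_sub, eval_delay_smul, eval_resolvent, eval_resolvent,
    (summable_eval_propagate ℓ η hs).tsum_eq_zero_add]
  have : ∀ n : ℕ, propagateHom T (n * s) (propagateHom T s η)
      = propagateHom T ((n + 1 : ℕ) * s) η := fun n => by
    rw [propagateHom_add, show (n : ℝ≥0) * s + s = ((n + 1 : ℕ) : ℝ≥0) * s by push_cast; ring]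
  simp_rw [this]
  simp [propagateHom_zero]

theorem resolvent_delay_smul (s : ℝ≥0) (hs : 0 < s) (a : ℝ≥0) (ℓ : DecayDual T) :
    resolvent s hs (delay a • ℓ) = delay a • resolvent s hs ℓ := by
  refine ext fun η => ?_
  rw [eval_delay_smul, eval_resolvent, eval_resolvent]
  congr 1
  ext n
  rw [eval_delay_smul, propagateHom_add, propagateHom_add, add_comm]

end DecayDual

/-- Functions of a positive distance, as a module over the ring of delays. -/
def DistanceFun : Type := {c : ℝ≥0 // 0 < c} → ℝ

noncomputable instance : AddCommGroup DistanceFun :=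
  inferInstanceAs (AddCommGroup ({c : ℝ≥0 // 0 < c} → ℝ))

noncomputable instance : Module ℝ DistanceFun :=
  inferInstanceAs (Module ℝ ({c : ℝ≥0 // 0 < c} → ℝ))

namespace DistanceFun

/-- The translation of functions of the distance. -/
def shift : Multiplicative ℝ≥0 →* Module.End ℝ DistanceFun where
  toFun a :=
    { toFun := fun f c => f ⟨c.1 + a.toAdd, add_pos_of_pos_of_nonneg c.2 zero_le⟩
      map_add' := fun _ _ => rfl
      map_smul' := fun _ _ => rfl }
  map_one' := by
    refine LinearMap.ext fun f => funext fun c => congrArg f (Subtype.ext ?_)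
    exact add_zero c.1
  map_mul' a b := by
    refine LinearMap.ext fun f => funext fun c => congrArg f (Subtype.ext ?_)
    exact (add_assoc c.1 a.toAdd b.toAdd).symm

noncomputable instance : Module DelayRing DistanceFun := delayModule shift

theorem single_smul_apply (a : ℝ≥0) (r : ℝ) (f : DistanceFun) (c : {c : ℝ≥0 // 0 < c}) :
    ((AddMonoidAlgebra.single a r : DelayRing) • f) c
      = r * f ⟨c.1 + a, add_pos_of_pos_of_nonneg c.2 zero_le⟩ := by
  have : (AddMonoidAlgebra.single a r : DelayRing) • f
      = r • shift (Multiplicative.ofAdd a) f := by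
    change AddMonoidAlgebra.lift ℝ _ ℝ≥0 shift (AddMonoidAlgebra.single a r) f = _
    rw [AddMonoidAlgebra.lift_single]
    rfl
  rw [this]
  rfl

theorem delay_smul_apply (a : ℝ≥0) (f : DistanceFun) (c : {c : ℝ≥0 // 0 < c}) :
    (delay a • f) c = f ⟨c.1 + a, add_pos_of_pos_of_nonneg c.2 zero_le⟩ := by
  rw [delay, single_smul_apply, one_mul]

end DistanceFun

/-- The pairs of a functional `ℓ` and of the derivative of `ℓ (propagate c η)` in the
distance `c`. -/
noncomputable def derivPairs {T : ℝ} (η : finalTest T) :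
    Submodule DelayRing (DecayDual T × DistanceFun) where
  carrier := {p | Continuous (fun c : ℝ≥0 => DecayDual.eval (propagateHom T c η) p.1) ∧
    ∀ c : {c : ℝ≥0 // 0 < c},
      HasDerivAt (fun r : ℝ => DecayDual.eval (propagateHom T r.toNNReal η) p.1) (p.2 c) c.1}
  zero_mem' := by
    refine ⟨?_, fun c => ?_⟩
    · simpa using continuous_const
    · simp only [Prod.fst_zero, map_zero]
      exact hasDerivAt_const _ _
  add_mem' := by
    rintro p q ⟨hp, hp'⟩ ⟨hq, hq'⟩
    refine ⟨?_, fun c => ?_⟩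
    · simpa using hp.fun_add hq
    · simp only [Prod.fst_add, map_add]
      exact (hp' c).fun_add (hq' c)
  smul_mem' := by
    intro x p hp
    induction x using AddMonoidAlgebra.induction_linear with
    | zero =>
      rw [zero_smul]
      refine ⟨?_, fun c => ?_⟩
      · simpa using continuous_const
      · simp only [Prod.fst_zero, map_zero]
        exact hasDerivAt_const _ _
    | add x y hx hy =>
      rw [add_smul]
      refine ⟨?_, fun c => ?_⟩
      · simpa using hx.1.fun_add hy.1
      · simp only [Prod.fst_add, map_add]
        exact (hx.2 c).fun_add (hy.2 c)
    | single a r =>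
      have h1 : ∀ c, DecayDual.eval (propagateHom T c η)
          ((AddMonoidAlgebra.single a r : DelayRing) • p).1
          = r * DecayDual.eval (propagateHom T (c + a) η) p.1 := by
        intro c
        rw [Prod.smul_fst, DecayDual.eval_single_smul, propagateHom_add, add_comm]
      refine ⟨?_, fun c => ?_⟩
      · simp_rw [h1]
        exact (hp.1.comp (continuous_add_const a)).const_mul r
      · simp_rw [h1]
        rw [Prod.smul_snd, DistanceFun.single_smul_apply]
        refine HasDerivAt.const_mul r ?_
        have := (hp.2 ⟨c.1 + a, add_pos_of_pos_of_nonneg c.2 zero_le⟩)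
        simp only [NNReal.coe_add] at this
        refine (this.comp_add_const (c.1 : ℝ) (a : ℝ)).congr_of_eventuallyEq ?_
        filter_upwards [lt_mem_nhds (show (0 : ℝ) < c.1 from c.2)] with y hy
        rw [Real.toNNReal_add hy.le (NNReal.coe_nonneg a), Real.toNNReal_coe]

/-- The function $c\mapsto\ell(P_c\eta)$ has zero derivative for $c>0$, is continuous at $c=0$ and
tends to $0$ along the integers, so it vanishes at $c=0$, where it equals $\ell(\eta)$. -/
theorem eval_eq_zero_of_derivPairs {T : ℝ} {η : finalTest T} {ℓ : DecayDual T}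
    (h : (ℓ, (0 : DistanceFun)) ∈ derivPairs η) : DecayDual.eval η ℓ = 0 := by
  obtain ⟨hc, hd⟩ := h
  set F : ℝ → ℝ := fun r => DecayDual.eval (propagateHom T r.toNNReal η) ℓ with hF
  have hFc : Continuous F := hc.comp continuous_real_toNNReal
  have hconst : ∀ n : ℕ, F n = F 0 := by
    intro n
    rcases n.eq_zero_or_pos with rfl | hn
    · simp
    have hn' : (0 : ℝ) < n := by exact_mod_cast hn
    obtain ⟨c, -, hc⟩ := exists_hasDerivAt_eq_slope F (fun _ => 0) hn' hFc.continuousOn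
      fun x hx => hd ⟨⟨x, hx.1.le⟩, hx.1⟩
    rw [eq_div_iff (by linarith), zero_mul] at hc
    linarith
  have hlim := DecayDual.tendsto_eval_propagate ℓ η one_pos
  have h2 : (fun n : ℕ => DecayDual.eval (propagateHom T (n * 1) η) ℓ) = fun _ => F 0 := by
    ext n
    rw [← hconst n, hF]
    simp
  rw [h2] at hlim
  have := tendsto_nhds_unique tendsto_const_nhds hlim
  simpa [hF, propagateHom_zero] using this

end NNWR
-- Interface values and boundary derivatives as elements of these modules
namespace NNWR

variable {T : ℝ}

theorem finalTest.exists_abs_propagate_le (hT : 0 < T) (η : finalTest T) :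
    ∃ B, 0 ≤ B ∧ ∀ (c : ℝ≥0) (t : ℝ), 0 ≤ t →
      |propagate c η t| ≤ B * Real.exp (-((c : ℝ) ^ 2 / (4 * T))) := by
  obtain ⟨B, hB0, hB⟩ := finalTest.exists_bound η.2 0
  refine ⟨B, hB0, fun c t ht => ?_⟩
  rcases c.2.eq_or_lt with hc | hc
  · have : (c : ℝ) = 0 := hc.symm
    simpa [this, propagate_zero] using hB t ht
  · simpa using abs_propagate_le η.2 hB hc hT ht

theorem integrableOn_mul_of_continuousOn_Icc {w f : ℝ → ℝ} (hw : IntegrableOn w (Ioo 0 T))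
    (hf : ContinuousOn f (Icc 0 T)) : IntegrableOn (fun t => w t * f t) (Ioo 0 T) :=
  hw.mul_continuousOn_of_subset hf measurableSet_Ioo isCompact_Icc Ioo_subset_Icc_self

/-- Completing the square: $(c-2T)^2\ge0$. -/
theorem gaussian_le_exp_neg (hT : 0 < T) (c : ℝ) :
    Real.exp (-(c ^ 2 / (4 * T))) ≤ Real.exp T * Real.exp (-c) := by
  rw [← Real.exp_add, Real.exp_le_exp]
  have : c - T ≤ c ^ 2 / (4 * T) := by
    rw [le_div_iff₀ (by linarith)]
    nlinarith [sq_nonneg (c - 2 * T)]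
  linarith

open Classical in
/-- The functional `η ↦ ∫₀ᵀ w η` of an integrable function `w`. -/
noncomputable def pairing (T : ℝ) (w : ℝ → ℝ) : DecayDual T :=
  if h : 0 < T ∧ IntegrableOn w (Ioo 0 T) then
    ⟨{ toFun := fun η => ∫ t in Ioo 0 T, w t * η.1 t
       map_add' := fun η ζ => by
        rw [← integral_add
          (integrableOn_mul_of_continuousOn_Icc h.2 (finalTest.continuous η.2).continuousOn)
          (integrableOn_mul_of_continuousOn_Icc h.2 (finalTest.continuous ζ.2).continuousOn)]
        exact integral_congr_ae (ae_of_all _ fun t => mul_add _ _ _)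
       map_smul' := fun r η => by
        rw [RingHom.id_apply, smul_eq_mul, ← integral_const_mul]
        exact integral_congr_ae (ae_of_all _ fun t => mul_left_comm _ _ _) }, fun η => by
      obtain ⟨B, hB0, hB⟩ := finalTest.exists_abs_propagate_le h.1 η
      refine ⟨(∫ t in Ioo 0 T, |w t|) * (B * Real.exp T), fun c => ?_⟩
      have hb : ∀ t ∈ Ioo 0 T, ‖w t * propagate c η t‖
          ≤ |w t| * (B * (Real.exp T * Real.exp (-c))) := fun t ht => by
        rw [norm_mul, Real.norm_eq_abs, Real.norm_eq_abs]
        refine mul_le_mul_of_nonneg_left ((hB c t ht.1.le).trans ?_) (abs_nonneg _)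
        exact mul_le_mul_of_nonneg_left (gaussian_le_exp_neg h.1 c) hB0
      have := norm_integral_le_of_norm_le (h.2.abs.mul_const _)
        ((ae_restrict_iff' measurableSet_Ioo).2 (ae_of_all _ hb))
      rw [integral_mul_const] at this
      refine this.trans_eq ?_
      ring⟩
  else 0

theorem eval_pairing (hT : 0 < T) {w : ℝ → ℝ} (hw : IntegrableOn w (Ioo 0 T)) (η : finalTest T) :
    DecayDual.eval η (pairing T w) = ∫ t in Ioo 0 T, w t * η.1 t := by
  exact congrArg (DecayDual.eval η) (dif_pos (⟨hT, hw⟩ : 0 < T ∧ IntegrableOn w (Ioo 0 T)))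

/-- The derivative of `pairing T w` along the propagation of `η`. -/
noncomputable def pairingDeriv (w : ℝ → ℝ) (η : finalTest T) : DistanceFun := fun c =>
  ∫ t in Ioo 0 T, w t * propagateDeriv c.1 η t

/-- The action of a distribution along the propagation of `η`. -/
noncomputable def distributionFun (q : 𝓓'(timeDomain T, ℝ)) (η : finalTest T) : DistanceFun :=
  fun c => q (cutHom T (propagateHom T c.1 η))

theorem continuousOn_propagateDeriv_time (η : finalTest T) {c : ℝ} (hc : 0 < c) (s : Set ℝ) :
    ContinuousOn (propagateDeriv c η) s :=
  (continuousOn_propagateDeriv η.2).comp (f := fun t : ℝ => (c, t)) (by fun_prop) fun _ _ => hc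

/-- Differentiation under the time integral, dominated through a bound for `propagateDeriv` on a
compact range of positive distances. Since `derivPairs` is a submodule over the delays, every
recurrence satisfied by the derivatives can then be lifted to the pairings. -/
theorem pairing_mem_derivPairs (hT : 0 < T) {w : ℝ → ℝ} (hw : IntegrableOn w (Ioo 0 T))
    (η : finalTest T) : (pairing T w, pairingDeriv w η) ∈ derivPairs η := by
  obtain ⟨B, hB0, hB⟩ := finalTest.exists_abs_propagate_le hT η
  have hmeas : ∀ c : ℝ, AEStronglyMeasurable (fun t => w t * propagate c η t)
      (volume.restrict (Ioo 0 T)) := fun c =>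
    hw.aestronglyMeasurable.mul (((continuous_propagate η.2).comp
      (f := fun t : ℝ => (c, t)) (by fun_prop)).aestronglyMeasurable)
  refine ⟨?_, fun c => ?_⟩
  · simp_rw [eval_pairing hT hw]
    refine continuous_of_dominated (bound := fun t => |w t| * B) (fun c => hmeas c) (fun c => ?_)
      (hw.abs.mul_const B) (ae_of_all _ fun t => ?_)
    · refine (ae_restrict_iff' measurableSet_Ioo).2 (ae_of_all _ fun t ht => ?_)
      rw [norm_mul, Real.norm_eq_abs, Real.norm_eq_abs]
      refine mul_le_mul_of_nonneg_left ((hB c t ht.1.le).trans ?_) (abs_nonneg _)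
      refine mul_le_of_le_one_right hB0 (Real.exp_le_one_iff.2 ?_)
      have : 0 ≤ (c : ℝ) ^ 2 / (4 * T) := by positivity
      linarith
    · exact continuous_const.mul ((continuous_propagate η.2).comp
        (f := fun c : ℝ≥0 => ((c : ℝ), t)) (by fun_prop))
  · obtain ⟨c, hc⟩ := c
    have hc' : (0 : ℝ) < c := hc
    have hcpt : IsCompact (Icc ((c : ℝ) / 2) (2 * c) ×ˢ Icc 0 T) := isCompact_Icc.prod isCompact_Icc
    obtain ⟨D, hD⟩ := hcpt.exists_bound_of_continuousOn
      ((continuousOn_propagateDeriv η.2).mono fun p hp => (half_pos hc').trans_le hp.1.1)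
    have key := (hasDerivAt_integral_of_dominated_loc_of_deriv_le
      (μ := volume.restrict (Ioo 0 T)) (bound := fun t => |w t| * D)
      (F := fun r t => w t * propagate r η t) (F' := fun r t => w t * propagateDeriv r η t)
      (Icc_mem_nhds (show (c : ℝ) / 2 < c by linarith) (show (c : ℝ) < 2 * c by linarith))
      (Eventually.of_forall hmeas)
      (integrableOn_mul_of_continuousOn_Icc hw (finalTest.continuous (propagateHom T c η).2).continuousOn)
      (integrableOn_mul_of_continuousOn_Icc hw
        (continuousOn_propagateDeriv_time η hc' _)).aestronglyMeasurable
      ((ae_restrict_iff' measurableSet_Ioo).2 (ae_of_all _ fun t ht r hr => ?_))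
      (hw.abs.mul_const D) (ae_of_all _ fun t r hr => ?_)).2
    · refine key.congr_of_eventuallyEq ?_
      filter_upwards [lt_mem_nhds hc'] with r hr
      rw [eval_pairing hT hw]
      simp [Real.coe_toNNReal _ hr.le]
    · rw [norm_mul, Real.norm_eq_abs (w t)]
      exact mul_le_mul_of_nonneg_left (hD (r, t) ⟨hr, Ioo_subset_Icc_self ht⟩) (abs_nonneg _)
    · exact (hasDerivAt_propagate η.2 ((half_pos hc').trans_le hr.1) t).const_mul _

theorem IsHeatSolution.heatRel {a b : ℝ} {u : ℝ × ℝ → ℝ} {wa wb : ℝ → ℝ}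
    {qa qb : 𝓓'(timeDomain T, ℝ)} (h : IsHeatSolution a b T u wa wb qa qb) (hab : a < b)
    (η : finalTest T) :
    HeatRel (delay (b - a).toNNReal) (pairingDeriv wa η) (pairingDeriv wb η)
      (distributionFun qa η) (distributionFun qb η) := by
  have hl : ((b - a).toNNReal : ℝ) = b - a := Real.coe_toNNReal _ (by linarith)
  constructor
  · funext c
    have := h.characteristic_right hab hl c.2 η
    change (delay _ • pairingDeriv wb η) c - pairingDeriv wa η c
      = (delay _ • distributionFun qb η) c - distributionFun qa η c
    rw [DistanceFun.delay_smul_apply, DistanceFun.delay_smul_apply]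
    simpa [pairingDeriv, distributionFun] using this
  · funext c
    have := h.characteristic_left hab hl c.2 η
    change (delay _ • pairingDeriv wa η) c - pairingDeriv wb η c
      = distributionFun qb η c - (delay _ • distributionFun qa η) c
    rw [DistanceFun.delay_smul_apply, DistanceFun.delay_smul_apply]
    simpa [pairingDeriv, distributionFun] using this

theorem pairingDeriv_eq_zero {w : ℝ → ℝ} (hw : ∀ᵐ t ∂volume.restrict (Ioo 0 T), w t = 0)
    (η : finalTest T) : pairingDeriv w η = 0 := by
  funext c
  refine integral_eq_zero_of_ae ?_
  filter_upwards [hw] with t ht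
  simp [ht]

theorem distributionFun_sub (q r : 𝓓'(timeDomain T, ℝ)) (η : finalTest T) :
    distributionFun (q - r) η = distributionFun q η - distributionFun r η := rfl

theorem distributionFun_neg (q : 𝓓'(timeDomain T, ℝ)) (η : finalTest T) :
    distributionFun (-q) η = -distributionFun q η := rfl

theorem pairingDeriv_update {w w' f g : ℝ → ℝ} (hw : IntegrableOn w (Ioo 0 T))
    (hf : IntegrableOn f (Ioo 0 T)) (hg : IntegrableOn g (Ioo 0 T))
    (h : ∀ᵐ t ∂volume.restrict (Ioo 0 T), w' t = w t - 1 / 4 * (f t + g t)) (η : finalTest T) :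
    (4 : DelayRing) • pairingDeriv w' η
      = (4 : DelayRing) • pairingDeriv w η - (pairingDeriv f η + pairingDeriv g η) := by
  have h4 : ∀ v : DistanceFun, (4 : DelayRing) • v = (4 : ℝ) • v := fun v => by
    rw [show (4 : DelayRing) = 1 + 1 + 1 + 1 by norm_num,
      show (4 : ℝ) = 1 + 1 + 1 + 1 by norm_num]
    simp only [add_smul, one_smul]
  rw [h4, h4]
  funext c
  change 4 * pairingDeriv w' η c
    = 4 * pairingDeriv w η c - (pairingDeriv f η c + pairingDeriv g η c)
  have hc := continuousOn_propagateDeriv_time η (show (0 : ℝ) < c.1 from c.2) (Icc 0 T)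
  have iw := integrableOn_mul_of_continuousOn_Icc hw hc
  have jf := integrableOn_mul_of_continuousOn_Icc hf hc
  have ig := integrableOn_mul_of_continuousOn_Icc hg hc
  have key : pairingDeriv w' η c
      = pairingDeriv w η c - 1 / 4 * (pairingDeriv f η c + pairingDeriv g η c) := by
    simp only [pairingDeriv]
    have is : IntegrableOn (fun t => 1 / 4 * (f t * propagateDeriv c.1 η t
        + g t * propagateDeriv c.1 η t)) (Ioo 0 T) := (jf.add ig).const_mul _
    rw [← integral_add jf ig, ← integral_const_mul, ← integral_sub iw is]
    refine integral_congr_ae ?_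
    filter_upwards [h] with t ht
    rw [ht]
    ring
  rw [key]
  ring

end NNWR
-- The recurrence for the interface values
namespace NNWR

variable {T : ℝ} {N : ℕ} {x : ℕ → ℝ} {w w' : ℕ → ℝ → ℝ}

/-- The length of the subdomain `i`. -/
noncomputable def len (x : ℕ → ℝ) (i : ℕ) : ℝ≥0 := (x i - x (i - 1)).toNNReal

/-- The old values are Dirichlet data of weak solutions. The new values become integrable in the
same way only through the following step, so integrability of `w'` is a separate hypothesis in the
statements below. -/
theorem IsStep.integrableOn {θ : ℝ} (h : IsStep N x T θ w w') (hN : 1 ≤ N) {i : ℕ} (hi : i ≤ N) :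
    IntegrableOn (w i) (Ioo 0 T) := by
  obtain ⟨u, ψ, duL, duR, dψL, dψR, ψL, ψR, hu, -⟩ := h
  rcases i.eq_zero_or_pos with rfl | hi0
  · exact (hu 1 (Finset.mem_Icc.2 ⟨le_rfl, hN⟩)).integrableOn_left
  · exact (hu i (Finset.mem_Icc.2 ⟨hi0, hi⟩)).integrableOn_right

/-- One step of the iteration in terms of the derivatives of the pairings with propagated test
functions. -/
theorem IsStep.heatRel (h : IsStep N x T (1 / 4) w w')
    (hx : ∀ i ∈ Finset.Icc 1 N, x (i - 1) < x i) (η : finalTest T) :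
    ∃ l r a b dl dr : ℕ → DistanceFun,
      (∀ i ∈ Finset.Icc 1 N, HeatRel (delay (len x i)) (pairingDeriv (w (i - 1)) η)
        (pairingDeriv (w i) η) (l i) (r i)) ∧
      (∀ i ∈ Finset.Icc 1 N, HeatRel (delay (len x i)) (a i) (b i) (dl i) (dr i)) ∧
      (∀ i ∈ Finset.Ioo 0 N, dr i = r i - l (i + 1) ∧ dl (i + 1) = -(r i - l (i + 1))) ∧
      a 1 = 0 ∧ b N = 0 ∧
      ∀ i ∈ Finset.Ioo 0 N, (4 : DelayRing) • pairingDeriv (w' i) η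
        = (4 : DelayRing) • pairingDeriv (w i) η - (b i + a (i + 1)) := by
  obtain ⟨u, ψ, duL, duR, dψL, dψR, ψL, ψR, hu, hψ, hd, h0, hN, hup⟩ := h
  refine ⟨fun i => distributionFun (duL i) η, fun i => distributionFun (duR i) η,
    fun i => pairingDeriv (ψL i) η, fun i => pairingDeriv (ψR i) η,
    fun i => distributionFun (dψL i) η, fun i => distributionFun (dψR i) η,
    fun i hi => (hu i hi).heatRel (hx i hi) η, fun i hi => (hψ i hi).heatRel (hx i hi) η,
    fun i hi => ?_, pairingDeriv_eq_zero h0 η, pairingDeriv_eq_zero hN η, fun i hi => ?_⟩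
  · obtain ⟨h1, h2⟩ := hd i hi
    dsimp only
    refine ⟨?_, ?_⟩
    · rw [h1, distributionFun_sub]
    · rw [← distributionFun_sub, ← h2, distributionFun_neg, neg_neg]
  · have hi1 : i ∈ Finset.Icc 1 N := by
      simp only [Finset.mem_Ioo, Finset.mem_Icc] at hi ⊢; omega
    have hi2 : i + 1 ∈ Finset.Icc 1 N := by
      simp only [Finset.mem_Ioo, Finset.mem_Icc] at hi ⊢; omega
    exact pairingDeriv_update (hu i hi1).integrableOn_right (hψ i hi1).integrableOn_right
      (hψ (i + 1) hi2).integrableOn_left (hup i hi) η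

/-- Elements of the ring of delays that act injectively on decaying functionals. -/
def Cancellable (T : ℝ) (a : DelayRing) : Prop := ∀ ℓ : DecayDual T, a • ℓ = 0 → ℓ = 0

theorem Cancellable.mul {a b : DelayRing} (ha : Cancellable T a) (hb : Cancellable T b) :
    Cancellable T (a * b) := fun ℓ h => hb ℓ (ha _ (by rwa [← mul_smul]))

theorem Cancellable.eq_of_smul_eq {a : DelayRing} (ha : Cancellable T a) {ℓ m : DecayDual T}
    (h : a • ℓ = a • m) : ℓ = m :=
  sub_eq_zero.1 (ha _ (by rw [smul_sub, h, sub_self]))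

theorem cancellable_one_sub_delay {s : ℝ≥0} (hs : 0 < s) : Cancellable T (1 - delay s) :=
  fun _ => DecayDual.eq_zero_of_one_sub_delay_smul hs

theorem cancellable_one_sub_delay_pow {s : ℝ≥0} (hs : 0 < s) {n : ℕ} (hn : 0 < n) :
    Cancellable T (1 - delay s ^ n) := by
  rw [delay_pow]
  exact cancellable_one_sub_delay (by positivity)

theorem cancellable_four : Cancellable T 4 := by
  intro ℓ h
  have h4 : (4 : DelayRing) • ℓ = (4 : ℝ) • ℓ := by
    rw [show (4 : DelayRing) = 1 + 1 + 1 + 1 by norm_num,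
      show (4 : ℝ) = 1 + 1 + 1 + 1 by norm_num]
    simp only [add_smul, one_smul]
  rw [h4] at h
  have := congrArg (fun m => (4⁻¹ : ℝ) • m) h
  simpa [smul_smul] using this

theorem len_pos (hx : ∀ i ∈ Finset.Icc 1 N, x (i - 1) < x i) {i : ℕ} (hi : i ∈ Finset.Icc 1 N) :
    0 < len x i := Real.toNNReal_pos.2 (sub_pos.2 (hx i hi))

section Step

variable (hT : 0 < T) (h : IsStep N x T (1 / 4) w w')
  (hx : ∀ i ∈ Finset.Icc 1 N, x (i - 1) < x i)
  (hw' : ∀ i ∈ Finset.Ioo 0 N, IntegrableOn (w' i) (Ioo 0 T))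
include hT h hx hw'

/-- `update_interior` is an identity between functions of the distance, to which boundary
distributions contribute without any known decay. It is lifted to pairings first, and only then is
the superfluous factor $4(1-e_1^2)(1-e_2^2)$ cancelled. -/
theorem IsStep.interior {j : ℕ} (hj : 1 ≤ j) (hjN : j + 3 ≤ N) :
    ((1 - delay (len x j) ^ 2) * (1 - delay (len x (j + 1)) ^ 2)
        * (1 - delay (len x (j + 2)) ^ 2) * (1 - delay (len x (j + 3)) ^ 2)) •
          pairing T (w' (j + 1))
      + ((1 - delay (len x j) ^ 2) * (1 - delay (len x (j + 3)) ^ 2)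
        * (delay (len x (j + 1)) ^ 2 + delay (len x (j + 2)) ^ 2)) • pairing T (w (j + 1))
      + ((1 - delay (len x (j + 3)) ^ 2) * (delay (len x (j + 1))
        * (delay (len x j) ^ 2 - delay (len x (j + 2)) ^ 2))) • pairing T (w j)
      + ((1 - delay (len x j) ^ 2) * (delay (len x (j + 2))
        * (delay (len x (j + 3)) ^ 2 - delay (len x (j + 1)) ^ 2))) • pairing T (w (j + 2))
      - ((1 - delay (len x (j + 2)) ^ 2) * (1 - delay (len x (j + 3)) ^ 2)
        * (delay (len x j) * delay (len x (j + 1)))) • pairing T (w (j - 1))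
      - ((1 - delay (len x j) ^ 2) * (1 - delay (len x (j + 1)) ^ 2)
        * (delay (len x (j + 2)) * delay (len x (j + 3)))) • pairing T (w (j + 3)) = 0 := by
  have m : ∀ k, 1 ≤ k → k ≤ N → k ∈ Finset.Icc 1 N := fun k h1 h2 => Finset.mem_Icc.2 ⟨h1, h2⟩
  have hN : 1 ≤ N := by omega
  refine ((cancellable_four.mul (cancellable_one_sub_delay_pow
    (len_pos hx (m (j + 1) (by omega) (by omega))) two_pos)).mul (cancellable_one_sub_delay_pow
    (len_pos hx (m (j + 2) (by omega) (by omega))) two_pos)) _ (DecayDual.ext fun η => ?_)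
  rw [map_zero]
  refine eval_eq_zero_of_derivPairs ?_
  obtain ⟨l, r, a, b, dl, dr, hd, hn, hq, -, -, hup⟩ := h.heatRel hx η
  have o : ∀ k, 1 ≤ k → k < N → k ∈ Finset.Ioo 0 N := fun k h1 h2 => Finset.mem_Ioo.2 ⟨h1, h2⟩
  have h₀ := hd j (m j hj (by omega))
  have h₁ := hd (j + 1) (m (j + 1) (by omega) (by omega))
  have h₂ := hd (j + 2) (m (j + 2) (by omega) (by omega))
  have h₃ := hd (j + 3) (m (j + 3) (by omega) (by omega))
  have n₁ := hn (j + 1) (m (j + 1) (by omega) (by omega))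
  have n₂ := hn (j + 2) (m (j + 2) (by omega) (by omega))
  rw [(hq j (o j hj (by omega))).2, (hq (j + 1) (o (j + 1) (by omega) (by omega))).1] at n₁
  rw [(hq (j + 1) (o (j + 1) (by omega) (by omega))).2,
    (hq (j + 2) (o (j + 2) (by omega) (by omega))).1] at n₂
  have key := update_interior h₀ h₁ h₂ h₃ n₁ n₂ (hup (j + 1) (o (j + 1) (by omega) (by omega)))
  rw [← key]
  have p : ∀ k, k ≤ N → (pairing T (w k), pairingDeriv (w k) η) ∈ derivPairs η := fun k hk =>
    pairing_mem_derivPairs hT (h.integrableOn hN hk) η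
  have p' := pairing_mem_derivPairs hT (hw' (j + 1) (o (j + 1) (by omega) (by omega))) η
  exact Submodule.smul_mem _ _ (sub_mem (sub_mem (add_mem (add_mem (add_mem
    (Submodule.smul_mem _ _ p') (Submodule.smul_mem _ _ (p (j + 1) (by omega))))
    (Submodule.smul_mem _ _ (p j (by omega)))) (Submodule.smul_mem _ _ (p (j + 2) (by omega))))
    (Submodule.smul_mem _ _ (p (j - 1) (by omega))))
    (Submodule.smul_mem _ _ (p (j + 3) (by omega))))

theorem IsStep.left (hN : 3 ≤ N) (h0 : ∀ᵐ t ∂volume.restrict (Ioo 0 T), w 0 t = 0) :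
    ((1 - delay (len x 1) ^ 4) * (1 - delay (len x 2) ^ 2) * (1 - delay (len x 3) ^ 2)) •
        pairing T (w' 1)
      + ((1 - delay (len x 3) ^ 2) * (delay (len x 1) ^ 4 + delay (len x 2) ^ 2)) •
        pairing T (w 1)
      + ((1 - delay (len x 1) ^ 4) * (delay (len x 2) * delay (len x 3) ^ 2)
        + (1 - delay (len x 3) ^ 2) * (delay (len x 2)
          * (delay (len x 1) ^ 2 - delay (len x 1) ^ 4))) • pairing T (w 2)
      - ((1 - delay (len x 1) ^ 4) * (delay (len x 2) * delay (len x 3))) • pairing T (w 3)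
      = 0 := by
  have m : ∀ k, 1 ≤ k → k ≤ N → k ∈ Finset.Icc 1 N := fun k h1 h2 => Finset.mem_Icc.2 ⟨h1, h2⟩
  have o : ∀ k, 1 ≤ k → k < N → k ∈ Finset.Ioo 0 N := fun k h1 h2 => Finset.mem_Ioo.2 ⟨h1, h2⟩
  refine (cancellable_four.mul (cancellable_one_sub_delay_pow
    (len_pos hx (m 2 (by omega) (by omega))) two_pos)) _ (DecayDual.ext fun η => ?_)
  rw [map_zero]
  refine eval_eq_zero_of_derivPairs ?_
  obtain ⟨l, r, a, b, dl, dr, hd, hn, hq, ha, -, hup⟩ := h.heatRel hx η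
  have h₁ := hd 1 (m 1 (by omega) (by omega))
  have h₂ := hd 2 (m 2 (by omega) (by omega))
  have h₃ := hd 3 (m 3 (by omega) (by omega))
  have n₁ := hn 1 (m 1 (by omega) (by omega))
  have n₂ := hn 2 (m 2 (by omega) (by omega))
  rw [ha, (hq 1 (o 1 (by omega) (by omega))).1] at n₁
  rw [(hq 1 (o 1 (by omega) (by omega))).2, (hq 2 (o 2 (by omega) (by omega))).1] at n₂
  rw [pairingDeriv_eq_zero h0] at h₁
  have key := update_left h₁ h₂ h₃ n₁ n₂ (hup 1 (o 1 (by omega) (by omega)))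
  rw [← key]
  have p : ∀ k, k ≤ N → (pairing T (w k), pairingDeriv (w k) η) ∈ derivPairs η := fun k hk =>
    pairing_mem_derivPairs hT (h.integrableOn (by omega) hk) η
  have p' := pairing_mem_derivPairs hT (hw' 1 (o 1 (by omega) (by omega))) η
  exact Submodule.smul_mem _ _ (sub_mem (add_mem (add_mem
    (Submodule.smul_mem _ _ p') (Submodule.smul_mem _ _ (p 1 (by omega))))
    (Submodule.smul_mem _ _ (p 2 (by omega)))) (Submodule.smul_mem _ _ (p 3 (by omega))))

theorem IsStep.right {j : ℕ} (hN : N = j + 3)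
    (h0 : ∀ᵐ t ∂volume.restrict (Ioo 0 T), w N t = 0) :
    ((1 - delay (len x (j + 3)) ^ 4) * (1 - delay (len x (j + 2)) ^ 2)
        * (1 - delay (len x (j + 1)) ^ 2)) • pairing T (w' (j + 2))
      + ((1 - delay (len x (j + 1)) ^ 2) * (delay (len x (j + 3)) ^ 4
        + delay (len x (j + 2)) ^ 2)) • pairing T (w (j + 2))
      + ((1 - delay (len x (j + 3)) ^ 4) * (delay (len x (j + 2)) * delay (len x (j + 1)) ^ 2)
        + (1 - delay (len x (j + 1)) ^ 2) * (delay (len x (j + 2))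
          * (delay (len x (j + 3)) ^ 2 - delay (len x (j + 3)) ^ 4))) • pairing T (w (j + 1))
      - ((1 - delay (len x (j + 3)) ^ 4) * (delay (len x (j + 2)) * delay (len x (j + 1)))) •
        pairing T (w j) = 0 := by
  have m : ∀ k, 1 ≤ k → k ≤ N → k ∈ Finset.Icc 1 N := fun k h1 h2 => Finset.mem_Icc.2 ⟨h1, h2⟩
  have o : ∀ k, 1 ≤ k → k < N → k ∈ Finset.Ioo 0 N := fun k h1 h2 => Finset.mem_Ioo.2 ⟨h1, h2⟩
  refine (cancellable_four.mul (cancellable_one_sub_delay_pow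
    (len_pos hx (m (j + 2) (by omega) (by omega))) two_pos)) _ (DecayDual.ext fun η => ?_)
  rw [map_zero]
  refine eval_eq_zero_of_derivPairs ?_
  obtain ⟨l, r, a, b, dl, dr, hd, hn, hq, -, hb, hup⟩ := h.heatRel hx η
  have h₁ := hd (j + 3) (m (j + 3) (by omega) (by omega))
  have h₂ := hd (j + 2) (m (j + 2) (by omega) (by omega))
  have h₃ := hd (j + 1) (m (j + 1) (by omega) (by omega))
  have n₁ := hn (j + 3) (m (j + 3) (by omega) (by omega))
  have n₂ := hn (j + 2) (m (j + 2) (by omega) (by omega))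
  rw [hN] at hb h0
  rw [hb, (hq (j + 2) (o (j + 2) (by omega) (by omega))).2] at n₁
  rw [(hq (j + 1) (o (j + 1) (by omega) (by omega))).2,
    (hq (j + 2) (o (j + 2) (by omega) (by omega))).1] at n₂
  rw [pairingDeriv_eq_zero h0] at h₁
  have key := update_right h₁ h₂ h₃ n₁ n₂ (hup (j + 2) (o (j + 2) (by omega) (by omega)))
  rw [← key]
  have p : ∀ k, k ≤ N → (pairing T (w k), pairingDeriv (w k) η) ∈ derivPairs η := fun k hk =>
    pairing_mem_derivPairs hT (h.integrableOn (by omega) hk) η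
  have p' := pairing_mem_derivPairs hT (hw' (j + 2) (o (j + 2) (by omega) (by omega))) η
  exact Submodule.smul_mem _ _ (sub_mem (add_mem (add_mem
    (Submodule.smul_mem _ _ p') (Submodule.smul_mem _ _ (p (j + 2) (by omega))))
    (Submodule.smul_mem _ _ (p (j + 1) (by omega)))) (Submodule.smul_mem _ _ (p j (by omega))))

theorem IsStep.single (hN : N = 2) (h0 : ∀ᵐ t ∂volume.restrict (Ioo 0 T), w 0 t = 0)
    (h0' : ∀ᵐ t ∂volume.restrict (Ioo 0 T), w N t = 0) :
    ((1 - delay (len x 1) ^ 4) * (1 - delay (len x 2) ^ 4)) • pairing T (w' 1)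
      + (delay (len x 1) ^ 2 - delay (len x 2) ^ 2) ^ 2 • pairing T (w 1) = 0 := by
  have m : ∀ k, 1 ≤ k → k ≤ N → k ∈ Finset.Icc 1 N := fun k h1 h2 => Finset.mem_Icc.2 ⟨h1, h2⟩
  have o : 1 ∈ Finset.Ioo 0 N := Finset.mem_Ioo.2 ⟨one_pos, by omega⟩
  refine cancellable_four _ (DecayDual.ext fun η => ?_)
  rw [map_zero]
  refine eval_eq_zero_of_derivPairs ?_
  obtain ⟨l, r, a, b, dl, dr, hd, hn, hq, ha, hb, hup⟩ := h.heatRel hx η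
  have h₁ := hd 1 (m 1 (by omega) (by omega))
  have h₂ := hd 2 (m 2 (by omega) (by omega))
  have n₁ := hn 1 (m 1 (by omega) (by omega))
  have n₂ := hn 2 (m 2 (by omega) (by omega))
  rw [hN] at hb h0'
  rw [ha, (hq 1 o).1] at n₁
  rw [hb, (hq 1 o).2] at n₂
  rw [pairingDeriv_eq_zero h0] at h₁
  rw [pairingDeriv_eq_zero h0'] at h₂
  have key := update_single h₁ h₂ n₁ n₂ (hup 1 o)
  rw [← key]
  have p := pairing_mem_derivPairs hT (h.integrableOn (i := 1) (by omega) (by omega)) η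
  have p' := pairing_mem_derivPairs hT (hw' 1 o) η
  exact Submodule.smul_mem _ _ (add_mem (Submodule.smul_mem _ _ p') (Submodule.smul_mem _ _ p))

end Step

end NNWR
-- Domination by positive functionals
namespace NNWR

open DecayDual

variable {T : ℝ} {ℓ m lam mu : DecayDual T}

/-- `|ℓ η| ≤ lam η` for all test functions `η` that are nonnegative on `[0, ∞)`. -/
def Dominated (ℓ lam : DecayDual T) : Prop :=
  ∀ η : finalTest T, (∀ t, 0 ≤ t → 0 ≤ η.1 t) → |eval η ℓ| ≤ eval η lam

theorem Dominated.nonneg (h : Dominated ℓ lam) {η : finalTest T} (hη : ∀ t, 0 ≤ t → 0 ≤ η.1 t) :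
    0 ≤ eval η lam := (abs_nonneg _).trans (h η hη)

theorem Dominated.trans (h : Dominated ℓ lam) (h' : Dominated lam mu) : Dominated ℓ mu :=
  fun η hη => (h η hη).trans ((le_abs_self _).trans (h' η hη))

theorem Dominated.add (h : Dominated ℓ lam) (h' : Dominated m mu) :
    Dominated (ℓ + m) (lam + mu) := fun η hη => by
  rw [map_add, map_add]
  exact (abs_add_le _ _).trans (add_le_add (h η hη) (h' η hη))

theorem Dominated.neg (h : Dominated ℓ lam) : Dominated (-ℓ) lam := fun η hη => by
  rw [map_neg, abs_neg]
  exact h η hη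

theorem Dominated.zero (h : Dominated ℓ lam) : Dominated 0 lam := fun η hη => by
  rw [map_zero, abs_zero]
  exact h.nonneg hη

theorem Dominated.smul (h : Dominated ℓ lam) {c : ℝ} (hc : 0 ≤ c) :
    Dominated (c • ℓ) (c • lam) := fun η hη => by
  rw [map_smul, map_smul, smul_eq_mul, smul_eq_mul, abs_mul, abs_of_nonneg hc]
  exact mul_le_mul_of_nonneg_left (h η hη) hc

theorem propagateHom_nonneg {η : finalTest T} (hη : ∀ t, 0 ≤ t → 0 ≤ η.1 t) (c : ℝ≥0) :
    ∀ t, 0 ≤ t → 0 ≤ (propagateHom T c η).1 t := fun _ ht => propagate_nonneg hη c ht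

theorem Dominated.delay_smul (h : Dominated ℓ lam) (a : ℝ≥0) :
    Dominated (delay a • ℓ) (delay a • lam) := fun η hη => by
  rw [eval_delay_smul, eval_delay_smul]
  exact h _ (propagateHom_nonneg hη a)

theorem Dominated.map_resolvent (h : Dominated ℓ lam) {s : ℝ≥0} (hs : 0 < s) :
    Dominated (DecayDual.resolvent s hs ℓ) (DecayDual.resolvent s hs lam) := fun η hη => by
  rw [eval_resolvent s hs ℓ, ← Real.norm_eq_abs]
  exact tsum_of_norm_bounded (hasSum_resolvent s hs lam η) fun n =>
    h _ (propagateHom_nonneg hη _)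

/-- Functionals that are nonnegative and do not increase under the propagation of nonnegative test
functions. -/
def DelayAntitone (lam : DecayDual T) : Prop :=
  ∀ a b : ℝ≥0, a ≤ b → Dominated (delay b • lam) (delay a • lam)

theorem DelayAntitone.self (h : DelayAntitone lam) : Dominated lam lam := by
  simpa [delay_zero] using h 0 0 le_rfl

theorem DelayAntitone.delay_smul (h : DelayAntitone lam) (c : ℝ≥0) :
    DelayAntitone (delay c • lam) := fun a b hab => by
  rw [← mul_smul, ← mul_smul, ← delay_add, ← delay_add]
  exact h _ _ (by gcongr)

theorem DelayAntitone.map_resolvent (h : DelayAntitone lam) {s : ℝ≥0} (hs : 0 < s) :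
    DelayAntitone (DecayDual.resolvent s hs lam) := fun a b hab => by
  rw [← resolvent_delay_smul, ← resolvent_delay_smul]
  exact (h a b hab).map_resolvent hs

theorem DelayAntitone.smul (h : DelayAntitone lam) {c : ℝ} (hc : 0 ≤ c) :
    DelayAntitone (c • lam) := fun a b hab => by
  have hcomm : ∀ d : ℝ≥0, delay d • c • lam = c • delay d • lam := fun d =>
    ext fun η => by simp
  rw [hcomm, hcomm]
  exact (h a b hab).smul hc

/-- Termwise comparison of the two series: a longer period delays every term more. -/
theorem DelayAntitone.resolvent_le (h : DelayAntitone lam) {s s' : ℝ≥0} (hs : 0 < s)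
    (hss' : s ≤ s') :
    Dominated (DecayDual.resolvent s' (hs.trans_le hss') lam) (DecayDual.resolvent s hs lam) :=
  fun η hη => by
    rw [eval_resolvent, ← Real.norm_eq_abs]
    refine tsum_of_norm_bounded (hasSum_resolvent s hs lam η) fun n => ?_
    have := h (n * s) (n * s') (by gcongr) η hη
    simpa using this

/-- The functional `delay (2 h) (1 - delay (2 h))⁻² lam`. -/
noncomputable def unitBound (h : ℝ≥0) (hh : 0 < 2 * h) (lam : DecayDual T) : DecayDual T :=
  delay (2 * h) • DecayDual.resolvent (2 * h) hh (DecayDual.resolvent (2 * h) hh lam)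

theorem DelayAntitone.map_unitBound (hlam : DelayAntitone lam) {h : ℝ≥0} (hh : 0 < 2 * h) :
    DelayAntitone (unitBound h hh lam) :=
  ((hlam.map_resolvent hh).map_resolvent hh).delay_smul _

/-- Shortening all three delays to $2h$ only increases the bound: the shortest subdomain is the
worst case. -/
theorem DelayAntitone.delay_resolvent_le (hlam : DelayAntitone lam) {h : ℝ≥0} (hh : 0 < 2 * h)
    {r s s' : ℝ≥0} (hr : 2 * h ≤ r) (hs : 2 * h ≤ s) (hs' : 2 * h ≤ s') :
    Dominated (delay r • DecayDual.resolvent s (hh.trans_le hs)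
      (DecayDual.resolvent s' (hh.trans_le hs') lam)) (unitBound h hh lam) :=
  (((hlam.map_resolvent (hh.trans_le hs')).map_resolvent (hh.trans_le hs)) _ _ hr).trans
    ((((hlam.map_resolvent (hh.trans_le hs')).resolvent_le hh hs).trans
      ((hlam.resolvent_le hh hs').map_resolvent hh)).delay_smul _)

theorem Dominated.exists_resolvent (hℓ : Dominated ℓ lam) (hlam : DelayAntitone lam) {h : ℝ≥0}
    (hh : 0 < 2 * h) {ρ p p' : DelayRing} {r s s' : ℝ≥0} (hr : 2 * h ≤ r) (hs : 2 * h ≤ s)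
    (hs' : 2 * h ≤ s') (hρ : ρ = delay r) (hp : p = delay s) (hp' : p' = delay s') :
    ∃ C, ((1 - p) * (1 - p')) • C = ρ • ℓ ∧ Dominated C (unitBound h hh lam) := by
  subst hρ hp hp'
  refine ⟨delay r • DecayDual.resolvent s (hh.trans_le hs) (DecayDual.resolvent s' (hh.trans_le hs') ℓ), ?_,
    (((hℓ.map_resolvent _).map_resolvent _).delay_smul r).trans (hlam.delay_resolvent_le hh hr hs hs')⟩
  rw [← mul_smul, show (1 - delay s) * (1 - delay s') * delay r
    = delay r * (1 - delay s') * (1 - delay s) by ring, mul_smul, one_sub_delay_smul_resolvent,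
    mul_smul, one_sub_delay_smul_resolvent]

/-- A smooth function that is nonnegative, at least `1` on `(-∞, S]`, and vanishes near `T`. -/
theorem exists_plateau {S : ℝ} (hS : S < T) :
    ∃ ζ : finalTest T, (∀ t, 0 ≤ ζ.1 t) ∧ ∀ t, t ≤ S → ζ.1 t = 1 := by
  have h0 : 0 < (T - S) / 2 := by linarith
  refine ⟨⟨fun t => Real.smoothTransition (((S + T) / 2 - t) / ((T - S) / 2)), ?_, (S + T) / 2,
    by linarith, fun t ht => ?_⟩, fun t => Real.smoothTransition.nonneg _, fun t ht => ?_⟩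
  · exact Real.smoothTransition.contDiff.comp (by fun_prop)
  · exact Real.smoothTransition.zero_of_nonpos (div_nonpos_of_nonpos_of_nonneg (by linarith) h0.le)
  · refine Real.smoothTransition.one_of_one_le ?_
    rw [le_div_iff₀ h0]
    linarith

/-- The operator with symbol `sinh ((b - a) z) / sinh (b z)`, `a ≤ b`, preserves domination. -/
theorem Dominated.exit (hT : 0 < T) (h : Dominated ℓ lam) {a b d : ℝ≥0} (ha : 0 < a)
    (hb : b = a + d) (hb0 : 0 < 2 * b) :
    Dominated ((delay a - delay (a + 2 * d)) • DecayDual.resolvent (2 * b) hb0 ℓ)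
      ((delay a - delay (a + 2 * d)) • DecayDual.resolvent (2 * b) hb0 lam) := by
  intro η hη
  obtain ⟨B, hB0, hB⟩ := finalTest.exists_bound η.2 0
  obtain ⟨S, hS, hzero⟩ := η.2.2
  obtain ⟨ζ, hζ0, hζ1⟩ := exists_plateau hS
  -- The truncation error of the image series after $M$ terms, as in `neg_le_sum_propagate`.
  set δ : ℕ → ℝ := fun M => B * Real.exp (-((2 * M * (b : ℝ)) ^ 2 / (4 * T))) with hδ
  set κ : ℕ → finalTest T := fun M => ∑ n ∈ Finset.range M,
    (propagateHom T (n * (2 * b)) (propagateHom T a η)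
      - propagateHom T (n * (2 * b)) (propagateHom T (a + 2 * d) η)) with hκ
  have hb' : (0 : ℝ) < b := by
    have : 0 < b := by rw [hb]; exact add_pos_of_pos_of_nonneg ha zero_le
    exact this
  have hδ0 : Tendsto δ atTop (𝓝 0) := by
    have h1 : Tendsto (fun M : ℕ => (2 * M * (b : ℝ)) ^ 2 / (4 * T)) atTop atTop := by
      refine Tendsto.atTop_div_const (by linarith) ((tendsto_pow_atTop two_ne_zero).comp ?_)
      exact (tendsto_natCast_atTop_atTop.const_mul_atTop two_pos).atTop_mul_const hb'
    simpa using (Real.tendsto_exp_neg_atTop_nhds_zero.comp h1).const_mul B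
  have hlim : ∀ m : DecayDual T, Tendsto (fun M => eval (κ M) m) atTop
      (𝓝 (eval η ((delay a - delay (a + 2 * d)) • DecayDual.resolvent (2 * b) hb0 m))) := by
    intro m
    rw [sub_smul, map_sub, eval_delay_smul, eval_delay_smul]
    have := ((hasSum_resolvent (2 * b) hb0 m (propagateHom T a η)).sub
      (hasSum_resolvent (2 * b) hb0 m (propagateHom T (a + 2 * d) η))).tendsto_sum_nat
    refine this.congr fun M => ?_
    rw [hκ, eval_sum_test]
    exact Finset.sum_congr rfl fun n _ => (eval_sub_test _ _ _).symm
  have hval : ∀ M t, (κ M).1 t = ∑ n ∈ Finset.range M,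
      (propagate (2 * n * b + a) η t - propagate (2 * (n + 1) * b - a) η t) := by
    intro M t
    have : (κ M).1 t = ∑ n ∈ Finset.range M,
        (propagateHom T (n * (2 * b)) (propagateHom T a η)
          - propagateHom T (n * (2 * b)) (propagateHom T (a + 2 * d) η)).1 t := by
      rw [hκ, Submodule.coe_sum, Finset.sum_apply]
    rw [this]
    refine Finset.sum_congr rfl fun n _ => ?_
    rw [propagateHom_add, propagateHom_add]
    change propagate _ _ t - propagate _ _ t = _
    congr 2
    · push_cast; ring
    · rw [hb]; push_cast; ring
  -- Up to time $S$ the plateau equals $1$ and compensates the truncation error; after $S$ the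
  -- partial sum vanishes. The corrected sums are thus admissible in the domination, and the
  -- correction disappears as $M\to\infty$.
  have hpos : ∀ M, 0 < M → ∀ t, 0 ≤ t → 0 ≤ (κ M + δ M • ζ).1 t := by
    intro M hM t ht
    have hδM : 0 ≤ δ M := by positivity
    change 0 ≤ (κ M).1 t + δ M * ζ.1 t
    rcases le_total t S with htS | htS
    · rw [hζ1 t htS, hval]
      have := neg_le_sum_propagate η.2 hT hη hB (a := a) (b := b) ha
        (by rw [hb]; push_cast; linarith [d.2]) hM (t := t) ⟨ht, by linarith⟩
      linarith
    · have : (κ M).1 t = 0 := by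
        rw [hval]
        refine Finset.sum_eq_zero fun n _ => ?_
        rw [propagate_eq_zero hzero _ htS, propagate_eq_zero hzero _ htS, sub_zero]
      rw [this, zero_add]
      exact mul_nonneg hδM (hζ0 t)
  have hlim' : ∀ m : DecayDual T, Tendsto (fun M => eval (κ M + δ M • ζ) m) atTop
      (𝓝 (eval η ((delay a - delay (a + 2 * d)) • DecayDual.resolvent (2 * b) hb0 m))) := by
    intro m
    have := (hlim m).add (hδ0.mul_const (eval ζ m))
    rw [zero_mul, add_zero] at this
    refine this.congr fun M => ?_
    rw [eval_add_test, eval_smul_test]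
  refine le_of_tendsto_of_tendsto (hlim' ℓ).abs (hlim' lam) ?_
  filter_upwards [eventually_gt_atTop 0] with M hM
  exact h _ (hpos M hM)

theorem two_mul_le_of_le {h a : ℝ≥0} (ha : h ≤ a) : 2 * h ≤ 2 * a := by gcongr

/-- Factor $e_a^2-e_b^2=e_a(e_a-e^{a+2d})$, where $e^{a+2d}$ is the delay by $a+2d$ and $d=b-a$. The
second factor over $1-e_b^2$ is the positive exit operator, so domination passes through the whole
quotient instead of through two separate monomials. -/
theorem Dominated.exists_cross_of_le (hT : 0 < T) (hℓ : Dominated ℓ lam)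
    (hlam : DelayAntitone lam) {h a b i : ℝ≥0} (hh : 0 < 2 * h) (ha : h ≤ a) (hi : h ≤ i)
    (hab : a ≤ b) :
    ∃ C, ((1 - delay a ^ 2) * (1 - delay i ^ 2) * (1 - delay b ^ 2)) • C
      = (delay i * (delay a ^ 2 - delay b ^ 2)) • ℓ ∧ Dominated C (unitBound h hh lam) := by
  obtain ⟨d, hd⟩ := exists_add_of_le hab
  have ha2 := hh.trans_le (two_mul_le_of_le ha)
  have hi2 := hh.trans_le (two_mul_le_of_le hi)
  have hb2 := hh.trans_le (two_mul_le_of_le (ha.trans hab))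
  have ha0 : 0 < a := pos_of_mul_pos_right ha2 zero_le
  have hfac : delay a * (delay a - delay (a + 2 * d)) = delay (2 * a) - delay (2 * b) := by
    rw [mul_sub, ← delay_add, ← delay_add, hd]
    congr 2 <;> ring
  set S : DecayDual T → DecayDual T := fun m =>
    (delay a - delay (a + 2 * d)) • DecayDual.resolvent (2 * b) hb2 m with hS
  have hSdom : ∀ m, Dominated m lam → Dominated (S m) (S lam) := fun m hm =>
    hm.exit hT ha0 hd hb2
  -- Partial fractions:
  -- $\frac{e_a^2-e_b^2}{(1-e_a^2)(1-e_b^2)}=\frac{e_a^2}{1-e_a^2}-\frac{e_b^2}{1-e_b^2}$. The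
  -- subtracted term is nonnegative on `lam` and can be dropped, which leaves only one resolvent.
  have hV : delay a • DecayDual.resolvent (2 * a) ha2 (S lam)
      = delay (2 * a) • DecayDual.resolvent (2 * a) ha2 lam - delay (2 * b) • DecayDual.resolvent (2 * b) hb2 lam := by
    refine ((cancellable_one_sub_delay ha2).mul (cancellable_one_sub_delay hb2)).eq_of_smul_eq ?_
    have e1 := one_sub_delay_smul_resolvent (2 * a) ha2 (S lam)
    have e2 := one_sub_delay_smul_resolvent (2 * b) hb2 lam
    have e3 := one_sub_delay_smul_resolvent (2 * a) ha2 lam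
    have e4 : (1 - delay (2 * b)) • S lam = (delay a - delay (a + 2 * d)) • lam := by
      rw [hS, ← mul_smul, mul_comm, mul_smul, e2]
    calc ((1 - delay (2 * a)) * (1 - delay (2 * b))) • delay a • DecayDual.resolvent (2 * a) ha2 (S lam)
        = delay a • (1 - delay (2 * b)) • (1 - delay (2 * a)) • DecayDual.resolvent (2 * a) ha2 (S lam) := by
          module
      _ = (delay a * (delay a - delay (a + 2 * d))) • lam := by rw [e1, e4, mul_smul]
      _ = (delay (2 * a) - delay (2 * b)) • lam := by rw [hfac]
      _ = (delay (2 * a) * (1 - delay (2 * b))) • lam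
          - (delay (2 * b) * (1 - delay (2 * a))) • lam := by module
      _ = (delay (2 * a) * (1 - delay (2 * b))) • (1 - delay (2 * a)) • DecayDual.resolvent (2 * a) ha2 lam
          - (delay (2 * b) * (1 - delay (2 * a))) • (1 - delay (2 * b)) •
            DecayDual.resolvent (2 * b) hb2 lam := by rw [e2, e3]
      _ = _ := by module
  have hVdom : Dominated (delay a • DecayDual.resolvent (2 * a) ha2 (S lam))
      (delay (2 * a) • DecayDual.resolvent (2 * a) ha2 lam) := by
    intro η hη
    have h1 := (((hSdom lam hlam.self).map_resolvent ha2).delay_smul a).nonneg hη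
    have h2 := ((hlam.self.map_resolvent hb2).delay_smul (2 * b)).nonneg hη
    rw [abs_of_nonneg h1, hV, map_sub]
    linarith
  refine ⟨delay i • DecayDual.resolvent (2 * i) hi2 (delay a • DecayDual.resolvent (2 * a) ha2 (S ℓ)), ?_, ?_⟩
  · have e0 := one_sub_delay_smul_resolvent (2 * i) hi2 (delay a • DecayDual.resolvent (2 * a) ha2 (S ℓ))
    have e1 := one_sub_delay_smul_resolvent (2 * a) ha2 (S ℓ)
    have e2 := one_sub_delay_smul_resolvent (2 * b) hb2 ℓ
    have e4 : (1 - delay (2 * b)) • S ℓ = (delay a - delay (a + 2 * d)) • ℓ := by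
      rw [hS, ← mul_smul, mul_comm, mul_smul, e2]
    rw [delay_pow, delay_pow, delay_pow]
    push_cast
    calc _ = delay i • (1 - delay (2 * b)) • (1 - delay (2 * a)) • (1 - delay (2 * i)) •
          DecayDual.resolvent (2 * i) hi2 (delay a • DecayDual.resolvent (2 * a) ha2 (S ℓ)) := by module
      _ = delay i • delay a • (1 - delay (2 * b)) • (1 - delay (2 * a)) •
          DecayDual.resolvent (2 * a) ha2 (S ℓ) := by rw [e0]; module
      _ = (delay i * (delay a * (delay a - delay (a + 2 * d)))) • ℓ := by
          rw [e1, e4]; module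
      _ = _ := by rw [hfac]
  · have h1 := (((((hSdom ℓ hℓ).map_resolvent ha2).delay_smul a).trans hVdom).map_resolvent hi2).delay_smul i
    refine h1.trans ?_
    rw [resolvent_delay_smul, ← mul_smul, ← delay_add]
    exact hlam.delay_resolvent_le hh ((two_mul_le_of_le ha).trans le_add_self)
      (two_mul_le_of_le hi) (two_mul_le_of_le ha)

theorem Dominated.exists_cross (hT : 0 < T) (hℓ : Dominated ℓ lam)
    (hlam : DelayAntitone lam) {h a b i : ℝ≥0} (hh : 0 < 2 * h) (ha : h ≤ a) (hb : h ≤ b)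
    (hi : h ≤ i) :
    ∃ C, ((1 - delay a ^ 2) * (1 - delay i ^ 2) * (1 - delay b ^ 2)) • C
      = (delay i * (delay a ^ 2 - delay b ^ 2)) • ℓ ∧ Dominated C (unitBound h hh lam) := by
  rcases le_total a b with hab | hab
  · exact hℓ.exists_cross_of_le hT hlam hh ha hi hab
  · obtain ⟨C, hC, hdom⟩ := hℓ.exists_cross_of_le hT hlam hh hb hi hab
    refine ⟨-C, ?_, hdom.neg⟩
    linear_combination (norm := module) - hC

theorem Dominated.of_eq_sum_six {C₁ C₂ C₃ C₄ C₅ C₆ : DecayDual T} (h₁ : Dominated C₁ lam)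
    (h₂ : Dominated C₂ lam) (h₃ : Dominated C₃ lam) (h₄ : Dominated C₄ lam)
    (h₅ : Dominated C₅ lam) (h₆ : Dominated C₆ lam)
    (h : ℓ = C₁ + C₂ + C₃ + C₄ + C₅ + C₆) : Dominated ℓ ((6 : ℝ) • lam) := by
  rw [h, show (6 : ℝ) • lam = lam + lam + lam + lam + lam + lam by module]
  exact ((((h₁.add h₂).add h₃).add h₄).add h₅).add h₆

end NNWR
-- Six dominated terms in one step
namespace NNWR

variable {T : ℝ} {lam : DecayDual T}

theorem two_mul_le_linear {h a b : ℝ≥0} (ha : h ≤ a) (hb : h ≤ b) (m n : ℕ) (hmn : 2 ≤ m + n) :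
    2 * h ≤ m * a + n * b := by
  calc 2 * h ≤ ((m + n : ℕ) : ℝ≥0) * h := by gcongr; exact_mod_cast hmn
    _ = m * h + n * h := by push_cast; ring
    _ ≤ m * a + n * b := by gcongr

theorem delay_pow_mul_pow (a b : ℝ≥0) (m n : ℕ) :
    delay a ^ m * delay b ^ n = delay (m * a + n * b) := by
  rw [delay_pow, delay_pow, delay_add]

theorem two_mul_le_nat_mul {h a : ℝ≥0} (ha : h ≤ a) {m : ℕ} (hm : 2 ≤ m) : 2 * h ≤ m * a := by
  gcongr
  exact_mod_cast hm

theorem Dominated.exists_monomial {ℓ : DecayDual T} (hℓ : Dominated ℓ lam)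
    (hlam : DelayAntitone lam) {h a b c d : ℝ≥0} (hh : 0 < 2 * h) (ha : h ≤ a) (hb : h ≤ b)
    (hc : h ≤ c) (hd : h ≤ d) (m n p q : ℕ) (hmn : 2 ≤ m + n) (hp : 2 ≤ p) (hq : 2 ≤ q) :
    ∃ C, ((1 - delay c ^ p) * (1 - delay d ^ q)) • C = (delay a ^ m * delay b ^ n) • ℓ ∧
      Dominated C (unitBound h hh lam) :=
  hℓ.exists_resolvent hlam hh (two_mul_le_linear ha hb m n hmn) (two_mul_le_nat_mul hc hp)
    (two_mul_le_nat_mul hd hq) (delay_pow_mul_pow a b m n) (delay_pow c p) (delay_pow d q)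

variable {h : ℝ≥0} (hh : 0 < 2 * h) (hlam : DelayAntitone lam)
include hlam

/-- Two monomials for the interface itself, one cross term for each neighbour and one monomial for
each second neighbour. -/
theorem dominated_interior (hT : 0 < T) {a b c d : ℝ≥0} (ha : h ≤ a) (hb : h ≤ b) (hc : h ≤ c)
    (hd : h ≤ d) {ℓ m₀ m₁ m₂ m₃ m₄ : DecayDual T} (h₀ : Dominated m₀ lam)
    (h₁ : Dominated m₁ lam) (h₂ : Dominated m₂ lam) (h₃ : Dominated m₃ lam)
    (h₄ : Dominated m₄ lam)
    (key : ((1 - delay a ^ 2) * (1 - delay b ^ 2) * (1 - delay c ^ 2) * (1 - delay d ^ 2)) • ℓ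
      + ((1 - delay a ^ 2) * (1 - delay d ^ 2) * (delay b ^ 2 + delay c ^ 2)) • m₂
      + ((1 - delay d ^ 2) * (delay b * (delay a ^ 2 - delay c ^ 2))) • m₁
      + ((1 - delay a ^ 2) * (delay c * (delay d ^ 2 - delay b ^ 2))) • m₃
      - ((1 - delay c ^ 2) * (1 - delay d ^ 2) * (delay a * delay b)) • m₀
      - ((1 - delay a ^ 2) * (1 - delay b ^ 2) * (delay c * delay d)) • m₄ = 0) :
    Dominated ℓ ((6 : ℝ) • unitBound h hh lam) := by
  have hpos : ∀ {e : ℝ≥0}, h ≤ e → Cancellable T (1 - delay e ^ 2) := fun {e} he =>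
    cancellable_one_sub_delay_pow ((pos_of_mul_pos_right hh zero_le).trans_le he) two_pos
  obtain ⟨C₁, e₁, d₁⟩ := h₂.exists_monomial hlam hh hb hb hb hc 2 0 2 2 le_rfl le_rfl le_rfl
  obtain ⟨C₂, e₂, d₂⟩ := h₂.exists_monomial hlam hh hc hc hb hc 2 0 2 2 le_rfl le_rfl le_rfl
  obtain ⟨C₃, e₃, d₃⟩ := h₁.exists_cross hT hlam hh ha hc hb
  obtain ⟨C₄, e₄, d₄⟩ := h₃.exists_cross hT hlam hh hd hb hc
  obtain ⟨C₅, e₅, d₅⟩ := h₀.exists_monomial hlam hh ha hb ha hb 1 1 2 2 le_rfl le_rfl le_rfl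
  obtain ⟨C₆, e₆, d₆⟩ := h₄.exists_monomial hlam hh hc hd hc hd 1 1 2 2 le_rfl le_rfl le_rfl
  refine Dominated.of_eq_sum_six d₁.neg d₂.neg d₃.neg d₄.neg d₅ d₆
    ((((hpos ha).mul (hpos hb)).mul (hpos hc)).mul (hpos hd) |>.eq_of_smul_eq ?_)
  linear_combination (norm := module) key
    + ((1 - delay a ^ 2) * (1 - delay d ^ 2)) • e₁ + ((1 - delay a ^ 2) * (1 - delay d ^ 2)) • e₂
    + (1 - delay d ^ 2) • e₃ + (1 - delay a ^ 2) • e₄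
    - ((1 - delay c ^ 2) * (1 - delay d ^ 2)) • e₅ - ((1 - delay a ^ 2) * (1 - delay b ^ 2)) • e₆

/-- Expanding the coefficients gives exactly six monomials of degree at least two, so positivity of
the exit law is not needed. -/
theorem dominated_end {a b c : ℝ≥0} (ha : h ≤ a) (hb : h ≤ b) (hc : h ≤ c)
    {ℓ m₁ m₂ m₃ : DecayDual T} (h₁ : Dominated m₁ lam) (h₂ : Dominated m₂ lam)
    (h₃ : Dominated m₃ lam)
    (key : ((1 - delay a ^ 4) * (1 - delay b ^ 2) * (1 - delay c ^ 2)) • ℓ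
      + ((1 - delay c ^ 2) * (delay a ^ 4 + delay b ^ 2)) • m₁
      + ((1 - delay a ^ 4) * (delay b * delay c ^ 2)
        + (1 - delay c ^ 2) * (delay b * (delay a ^ 2 - delay a ^ 4))) • m₂
      - ((1 - delay a ^ 4) * (delay b * delay c)) • m₃ = 0) :
    Dominated ℓ ((6 : ℝ) • unitBound h hh lam) := by
  have hpos : ∀ {e : ℝ≥0}, h ≤ e → ∀ {n : ℕ}, 0 < n → Cancellable T (1 - delay e ^ n) :=
    fun {e} he {n} hn =>
      cancellable_one_sub_delay_pow ((pos_of_mul_pos_right hh zero_le).trans_le he) hn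
  obtain ⟨C₁, e₁, d₁⟩ := h₁.exists_monomial hlam hh ha ha ha hb 4 0 4 2 (by simp) (by simp) le_rfl
  obtain ⟨C₂, e₂, d₂⟩ := h₁.exists_monomial hlam hh hb hb ha hb 2 0 4 2 le_rfl (by simp) le_rfl
  obtain ⟨C₃, e₃, d₃⟩ := h₂.exists_monomial hlam hh hb hc hb hc 1 2 2 2 (by simp) le_rfl le_rfl
  obtain ⟨C₄, e₄, d₄⟩ := h₂.exists_monomial hlam hh hb ha ha hb 1 2 4 2 (by simp) (by simp) le_rfl
  obtain ⟨C₅, e₅, d₅⟩ := h₂.exists_monomial hlam hh hb ha ha hb 1 4 4 2 (by simp) (by simp) le_rfl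
  obtain ⟨C₆, e₆, d₆⟩ := h₃.exists_monomial hlam hh hb hc hb hc 1 1 2 2 le_rfl le_rfl le_rfl
  refine Dominated.of_eq_sum_six d₁.neg d₂.neg d₃.neg d₄.neg d₅ d₆
    (((hpos ha four_pos).mul (hpos hb two_pos)).mul (hpos hc two_pos) |>.eq_of_smul_eq ?_)
  linear_combination (norm := module) key
    + (1 - delay c ^ 2) • e₁ + (1 - delay c ^ 2) • e₂ + (1 - delay a ^ 4) • e₃
    + (1 - delay c ^ 2) • e₄ - (1 - delay c ^ 2) • e₅ - (1 - delay a ^ 4) • e₆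

theorem dominated_single {a b : ℝ≥0} (ha : h ≤ a) (hb : h ≤ b) {ℓ m : DecayDual T}
    (hm : Dominated m lam)
    (key : ((1 - delay a ^ 4) * (1 - delay b ^ 4)) • ℓ
      + (delay a ^ 2 - delay b ^ 2) ^ 2 • m = 0) :
    Dominated ℓ ((6 : ℝ) • unitBound h hh lam) := by
  have hpos : ∀ {e : ℝ≥0}, h ≤ e → Cancellable T (1 - delay e ^ 4) := fun {e} he =>
    cancellable_one_sub_delay_pow ((pos_of_mul_pos_right hh zero_le).trans_le he) four_pos
  obtain ⟨C₁, e₁, d₁⟩ := hm.exists_monomial hlam hh ha ha ha hb 4 0 4 4 (by simp) (by simp) (by simp)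
  obtain ⟨C₂, e₂, d₂⟩ := hm.exists_monomial hlam hh ha hb ha hb 2 2 4 4 (by simp) (by simp) (by simp)
  obtain ⟨C₃, e₃, d₃⟩ := hm.exists_monomial hlam hh hb hb ha hb 4 0 4 4 (by simp) (by simp) (by simp)
  -- The square expands into four terms, the mixed one counted twice; zeros fill up to six.
  refine Dominated.of_eq_sum_six d₁.neg d₂ d₂ d₃.neg d₁.zero d₁.zero
    (((hpos ha).mul (hpos hb)).eq_of_smul_eq ?_)
  linear_combination (norm := module) key + e₁ - (2 : DelayRing) • e₂ + e₃

omit hlam in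
theorem IsStep.dominated {N : ℕ} {x : ℕ → ℝ} {w w' : ℕ → ℝ → ℝ} (hT : 0 < T)
    (hstep : IsStep N x T (1 / 4) w w') (hx : ∀ i ∈ Finset.Icc 1 N, x (i - 1) < x i)
    (hlen : ∀ i ∈ Finset.Icc 1 N, h ≤ len x i)
    (hw' : ∀ i ∈ Finset.Ioo 0 N, IntegrableOn (w' i) (Ioo 0 T))
    (h0 : ∀ᵐ t ∂volume.restrict (Ioo 0 T), w 0 t = 0)
    (h0' : ∀ᵐ t ∂volume.restrict (Ioo 0 T), w N t = 0)
    (hlam : DelayAntitone lam) (hdom : ∀ i ≤ N, Dominated (pairing T (w i)) lam)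
    {i : ℕ} (hi : i ∈ Finset.Ioo 0 N) :
    Dominated (pairing T (w' i)) ((6 : ℝ) • unitBound h hh lam) := by
  have l : ∀ k, 1 ≤ k → k ≤ N → h ≤ len x k := fun k h1 h2 => hlen k (Finset.mem_Icc.2 ⟨h1, h2⟩)
  obtain ⟨hi0, hiN⟩ := Finset.mem_Ioo.1 hi
  by_cases hN2 : N = 2
  · obtain rfl : i = 1 := by omega
    exact dominated_single hh hlam (l 1 le_rfl (by omega)) (l 2 (by omega) (by omega))
      (hdom 1 (by omega)) (hstep.single hT hx hw' hN2 h0 h0')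
  by_cases hi1 : i = 1
  · subst hi1
    exact dominated_end hh hlam (l 1 (by omega) (by omega)) (l 2 (by omega) (by omega))
      (l 3 (by omega) (by omega)) (hdom 1 (by omega)) (hdom 2 (by omega)) (hdom 3 (by omega))
      (hstep.left hT hx hw' (by omega) h0)
  by_cases hiN1 : i + 1 = N
  · obtain ⟨j, rfl⟩ := Nat.exists_eq_add_of_le' (show 2 ≤ i by omega)
    exact dominated_end hh hlam (l (j + 3) (by omega) (by omega))
      (l (j + 2) (by omega) (by omega)) (l (j + 1) (by omega) (by omega))
      (hdom (j + 2) (by omega)) (hdom (j + 1) (by omega)) (hdom j (by omega))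
      (hstep.right hT hx hw' hiN1.symm h0')
  · obtain ⟨j, rfl⟩ := Nat.exists_eq_add_of_le' (show 1 ≤ i by omega)
    exact dominated_interior hh hlam hT (l j (by omega) (by omega))
      (l (j + 1) (by omega) (by omega)) (l (j + 2) (by omega) (by omega))
      (l (j + 3) (by omega) (by omega)) (hdom (j - 1) (by omega)) (hdom j (by omega))
      (hdom (j + 1) (by omega)) (hdom (j + 2) (by omega)) (hdom (j + 3) (by omega))
      (hstep.interior hT hx hw' (by omega) (by omega))

end NNWR
-- Loss of mass under propagation, and duality with the supremum norm
namespace NNWR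

variable {T : ℝ} {η : ℝ → ℝ}

theorem integrable_prod_levyMeasure (hη : η ∈ finalTest T) (c : ℝ) :
    Integrable (Function.uncurry fun t u : ℝ => η (t + c ^ 2 * u ^ 2 / 4))
      ((volume.restrict (Ioo 0 T)).prod levyMeasure) := by
  obtain ⟨B, -, hB⟩ := finalTest.exists_bound hη 0
  have := finalTest.continuous hη
  refine (integrable_const B).mono' (Continuous.aestronglyMeasurable
    (by unfold Function.uncurry; fun_prop)) ?_
  filter_upwards [Measure.quasiMeasurePreserving_fst.ae (ae_restrict_mem measurableSet_Ioo)]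
    with p hp
  refine hB _ (add_nonneg hp.1.le ?_)
  positivity

theorem setIntegral_comp_add (hT : 0 < T) (hη : η ∈ finalTest T) {s : ℝ} (hs : 0 ≤ s) :
    ∫ t in Ioo 0 T, η (t + s) = ∫ t in s..T, η t := by
  have hi : ∀ a b, IntervalIntegrable η volume a b := fun a b =>
    (finalTest.continuous hη).intervalIntegrable a b
  have h0 : ∫ t in T..T + s, η t = 0 := intervalIntegral.integral_zero_ae <| ae_of_all _ fun t ht =>
    finalTest.eq_zero hη (by rw [uIoc_of_le (by linarith)] at ht; exact ht.1.le)
  rw [← integral_Ioc_eq_integral_Ioo, ← intervalIntegral.integral_of_le hT.le,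
    intervalIntegral.integral_comp_add_right, zero_add,
    ← intervalIntegral.integral_add_adjacent_intervals (hi s T) (hi T _), h0, add_zero]

theorem integrable_intervalIntegral (hT : 0 < T) (hη : η ∈ finalTest T) (c : ℝ) :
    Integrable (fun u => ∫ t in (c ^ 2 * u ^ 2 / 4)..T, η t) levyMeasure := by
  refine (integrable_prod_levyMeasure hη c).integral_prod_right.congr (ae_of_all _ fun u => ?_)
  exact setIntegral_comp_add hT hη (s := c ^ 2 * u ^ 2 / 4) (by positivity)

/-- Fubini: a delay $s$ replaces the integral over $(0,T)$ by the one over $(s,T)$. Monotonicity in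
$c$ and Gaussian decay are then read off from $s=c^2u^2/4$. -/
theorem setIntegral_propagate (hT : 0 < T) (hη : η ∈ finalTest T) (c : ℝ) :
    ∫ t in Ioo 0 T, propagate c η t
      = ∫ u, (∫ t in (c ^ 2 * u ^ 2 / 4)..T, η t) ∂levyMeasure := by
  simp only [propagate]
  rw [integral_integral_swap (integrable_prod_levyMeasure hη c)]
  exact integral_congr_ae (ae_of_all _ fun u => setIntegral_comp_add hT hη (by positivity))

theorem intervalIntegral_antitone (hη : η ∈ finalTest T) (h : ∀ t, 0 ≤ t → 0 ≤ η t) {s s' : ℝ}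
    (hs : 0 ≤ s) (hss' : s ≤ s') : ∫ t in s'..T, η t ≤ ∫ t in s..T, η t := by
  have hi : ∀ a b, IntervalIntegrable η volume a b := fun a b =>
    (finalTest.continuous hη).intervalIntegrable a b
  rw [← intervalIntegral.integral_add_adjacent_intervals (hi s s') (hi s' T)]
  have := intervalIntegral.integral_nonneg (μ := volume) hss' fun t ht => h t (hs.trans ht.1)
  linarith

theorem intervalIntegral_eq_zero (hη : η ∈ finalTest T) {s : ℝ} (hs : T ≤ s) :
    ∫ t in s..T, η t = 0 :=
  intervalIntegral.integral_zero_ae <| ae_of_all _ fun t ht =>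
    finalTest.eq_zero hη (by rw [uIoc_of_ge hs] at ht; exact ht.1.le)

theorem setIntegral_propagate_antitone (hT : 0 < T) (hη : η ∈ finalTest T)
    (h : ∀ t, 0 ≤ t → 0 ≤ η t) {a b : ℝ} (ha : 0 ≤ a) (hab : a ≤ b) :
    ∫ t in Ioo 0 T, propagate b η t ≤ ∫ t in Ioo 0 T, propagate a η t := by
  rw [setIntegral_propagate hT hη, setIntegral_propagate hT hη]
  refine integral_mono (integrable_intervalIntegral hT hη b) (integrable_intervalIntegral hT hη a)
    fun u => intervalIntegral_antitone hη h (by positivity) (by gcongr)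

/-- Only delays shorter than $T$ leave any mass, and their probability is bounded by the Gaussian
tail. -/
theorem setIntegral_propagate_le (hT : 0 < T) (hη : η ∈ finalTest T)
    (h : ∀ t, 0 ≤ t → 0 ≤ η t) {c : ℝ} (hc : 0 ≤ c) :
    ∫ t in Ioo 0 T, propagate c η t
      ≤ Real.exp (-(c ^ 2 / (4 * T))) * ∫ t in Ioo 0 T, η t := by
  rcases hc.eq_or_lt with rfl | hc
  · simp [propagate_zero]
  have hI : ∫ t in Ioo 0 T, η t = ∫ t in (0)..T, η t := by
    simpa using setIntegral_comp_add hT hη le_rfl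
  have hI0 : 0 ≤ ∫ t in (0)..T, η t :=
    intervalIntegral.integral_nonneg hT.le fun t ht => h t ht.1
  have hr : 0 < 2 * √T / c := by positivity
  have hrsq : ((2 * √T / c) ^ 2)⁻¹ = c ^ 2 / (4 * T) := by
    rw [div_pow, mul_pow, Real.sq_sqrt hT.le, inv_div]
    norm_num
  rw [setIntegral_propagate hT hη, hI]
  calc ∫ u, (∫ t in (c ^ 2 * u ^ 2 / 4)..T, η t) ∂levyMeasure
      ≤ ∫ u, (Iio (2 * √T / c)).indicator (fun _ => ∫ t in (0)..T, η t) u ∂levyMeasure := by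
        refine integral_mono_ae (integrable_intervalIntegral hT hη c)
          ((integrable_const _).indicator measurableSet_Iio) ?_
        filter_upwards [ae_pos_levyMeasure] with u hu
        by_cases hur : u < 2 * √T / c
        · rw [indicator_of_mem (mem_Iio.2 hur)]
          exact intervalIntegral_antitone hη h le_rfl (by positivity)
        · rw [indicator_of_notMem (by simpa using hur), intervalIntegral_eq_zero hη]
          rw [not_lt, div_le_iff₀ hc] at hur
          have := Real.sq_sqrt hT.le
          nlinarith [mul_self_le_mul_self (by positivity) hur]
    _ = levyMeasure.real (Iio (2 * √T / c)) * ∫ t in (0)..T, η t := by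
        rw [integral_indicator measurableSet_Iio, setIntegral_const, smul_eq_mul]
    _ ≤ _ := by
        refine mul_le_mul_of_nonneg_right ?_ hI0
        rw [← hrsq]
        exact levyMeasure_real_Iio_le hr

theorem integrableOn_one (T : ℝ) : IntegrableOn (1 : ℝ → ℝ) (Ioo 0 T) :=
  integrableOn_const (C := (1 : ℝ)) (by simp)

theorem eval_propagateHom_pairing_one (hT : 0 < T) (c : ℝ≥0) (η : finalTest T) :
    DecayDual.eval (propagateHom T c η) (pairing T 1) = ∫ t in Ioo 0 T, propagate c η t := by
  rw [eval_pairing hT (integrableOn_one T)]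
  simp

theorem delayAntitone_pairing_one (hT : 0 < T) : DelayAntitone (pairing T 1) :=
  fun a b hab η hη => by
    rw [DecayDual.eval_delay_smul, DecayDual.eval_delay_smul, eval_propagateHom_pairing_one hT,
      eval_propagateHom_pairing_one hT, abs_of_nonneg
        (setIntegral_nonneg measurableSet_Ioo fun t ht => propagate_nonneg hη b ht.1.le)]
    exact setIntegral_propagate_antitone hT η.2 hη a.2 hab

theorem dominated_pairing_of_ae_le (hT : 0 < T) {w : ℝ → ℝ} (hw : IntegrableOn w (Ioo 0 T))
    {M : ℝ} (hM : ∀ᵐ t ∂volume.restrict (Ioo 0 T), |w t| ≤ M) :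
    Dominated (pairing T w) (M • pairing T 1) := fun η hη => by
  have h1 := integrableOn_one T
  have hi := integrableOn_mul_of_continuousOn_Icc h1 (finalTest.continuous η.2).continuousOn
  rw [eval_pairing hT hw, map_smul, eval_pairing hT h1, smul_eq_mul, ← integral_const_mul]
  rw [← Real.norm_eq_abs]
  refine norm_integral_le_of_norm_le (hi.const_mul M) ?_
  filter_upwards [hM, ae_restrict_mem measurableSet_Ioo] with t ht ht'
  rw [norm_mul, Pi.one_apply, one_mul, Real.norm_eq_abs, Real.norm_of_nonneg (hη t ht'.1.le)]
  exact mul_le_mul_of_nonneg_right ht (hη t ht'.1.le)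

/-- Test with normalised bumps shrinking to $t$: Lebesgue differentiation recovers $w(t)$ for almost
every $t$, while their integrals over $(0,T)$ are at most $1$. -/
theorem ae_abs_le_of_eval_le (hT : 0 < T) {w : ℝ → ℝ} (hw : IntegrableOn w (Ioo 0 T)) {C : ℝ}
    (hC : 0 ≤ C) (h : ∀ η : finalTest T, (∀ t, 0 ≤ t → 0 ≤ η.1 t) →
      |DecayDual.eval η (pairing T w)| ≤ C * ∫ t in Ioo 0 T, η.1 t) :
    ∀ᵐ t ∂volume.restrict (Ioo 0 T), |w t| ≤ C := by
  let φ : ℕ → ContDiffBump (0 : ℝ) := fun n => ⟨1 / (n + 1), 2 * (1 / (n + 1)), by positivity, by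
    have : (0 : ℝ) < 1 / (n + 1) := by positivity
    linarith⟩
  have hφ : Tendsto (fun n => (φ n).rOut) atTop (𝓝 0) := by
    simpa only [mul_zero] using (tendsto_one_div_add_atTop_nhds_zero_nat (𝕜 := ℝ)).const_mul 2
  have hconv := ContDiffBump.ae_convolution_tendsto_right_of_locallyIntegrable (K := 2) hφ
    (Eventually.of_forall fun n => le_rfl)
    (hw.integrable_indicator measurableSet_Ioo).locallyIntegrable
  rw [ae_restrict_iff' measurableSet_Ioo]
  filter_upwards [hconv] with t ht htT
  rw [indicator_of_mem htT] at ht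
  refine le_of_tendsto ht.abs ?_
  filter_upwards [hφ.eventually (gt_mem_nhds (sub_pos.2 htT.2))] with n hn
  have hzero : ∀ s, t + (φ n).rOut ≤ s → (φ n).normed volume (t - s) = 0 := fun s hs => by
    have : t - s ∉ Function.support ((φ n).normed volume) := by
      rw [ContDiffBump.support_normed_eq, mem_ball_zero_iff, Real.norm_eq_abs, not_lt]
      exact (le_abs_self _).trans' (by linarith) |>.trans_eq (abs_neg _)
    simpa using this
  -- For large $n$ the bump ends before $T$, which is all that membership in `finalTest` asks; it
  -- may extend below $0$.
  let η : finalTest T := ⟨fun s => (φ n).normed volume (t - s),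
    (φ n).contDiff_normed.comp (contDiff_const.sub contDiff_id), t + (φ n).rOut, by linarith, hzero⟩
  have hη : ∀ s, 0 ≤ η.1 s := fun s => (φ n).nonneg_normed _
  have hint : ∫ s, η.1 s = 1 := by
    change ∫ s, (φ n).normed volume (t - s) = 1
    rw [integral_sub_left_eq_self, (φ n).integral_normed]
  have hηi : Integrable η.1 := by
    by_contra hcon
    rw [integral_undef hcon] at hint
    exact zero_ne_one hint
  have hle : ∫ s in Ioo 0 T, η.1 s ≤ 1 :=
    hint ▸ setIntegral_le_integral hηi (ae_of_all _ hη)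
  have key := h η fun s _ => hη s
  rw [eval_pairing hT hw] at key
  refine (le_of_eq ?_).trans (key.trans (mul_le_of_le_one_right hC hle))
  rw [convolution_eq_swap, ← integral_indicator measurableSet_Ioo]
  congr 2
  ext s
  by_cases hs : s ∈ Ioo 0 T
  · simp [hs, η, mul_comm]
  · simp [hs]

end NNWR
-- Iteration of the bound and superlinear convergence
namespace NNWR

open DecayDual

variable {T : ℝ}

/-- A resolvent sums over delays by $s$, so geometric decay along the progression $q+ms$ is
reproduced with the constant divided by $1-r$. -/
theorem eval_resolvent_le_geometric {s : ℝ≥0} (hs : 0 < s) {lam : DecayDual T} {η : finalTest T}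
    {q : ℝ≥0} {D r : ℝ} (hr0 : 0 ≤ r) (hr1 : r < 1)
    (H : ∀ m : ℕ, eval (propagateHom T (q + m * s) η) lam ≤ D * r ^ m) (m : ℕ) :
    eval (propagateHom T (q + m * s) η) (DecayDual.resolvent s hs lam) ≤ D / (1 - r) * r ^ m := by
  have hgeo := (hasSum_geometric_of_lt_one hr0 hr1).mul_left (D * r ^ m)
  refine (hasSum_le (fun n => ?_) (hasSum_resolvent s hs lam _) hgeo).trans_eq
    (by rw [div_eq_mul_inv]; ring)
  rw [propagateHom_add, show (n : ℝ≥0) * s + (q + m * s) = q + ((m + n : ℕ) : ℝ≥0) * s by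
    push_cast; ring]
  refine (H (m + n)).trans_eq ?_
  rw [pow_add, mul_assoc]

theorem eval_unitBound_le_geometric {h : ℝ≥0} (hh : 0 < 2 * h) {lam : DecayDual T}
    {η : finalTest T} {q : ℝ≥0} {D r : ℝ} (hr0 : 0 ≤ r) (hr1 : r < 1)
    (H : ∀ m : ℕ, eval (propagateHom T (q + 2 * h + m * (2 * h)) η) lam ≤ D * r ^ m) (m : ℕ) :
    eval (propagateHom T (q + m * (2 * h)) η) (unitBound h hh lam)
      ≤ D / (1 - r) / (1 - r) * r ^ m := by
  rw [unitBound, eval_delay_smul, propagateHom_add,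
    show 2 * h + (q + m * (2 * h)) = q + 2 * h + m * (2 * h) by ring]
  exact eval_resolvent_le_geometric hh hr0 hr1 (eval_resolvent_le_geometric hh hr0 hr1 H) m

/-- The functional `(6 * delay (2 h) (1 - delay (2 h))⁻²) ^ k lam`. -/
noncomputable def iterBound (h : ℝ≥0) (hh : 0 < 2 * h) (lam : DecayDual T) : ℕ → DecayDual T
  | 0 => lam
  | k + 1 => (6 : ℝ) • unitBound h hh (iterBound h hh lam k)

theorem DelayAntitone.map_iterBound {lam : DecayDual T} (hlam : DelayAntitone lam) {h : ℝ≥0}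
    (hh : 0 < 2 * h) : ∀ k, DelayAntitone (iterBound h hh lam k)
  | 0 => hlam
  | k + 1 => ((hlam.map_iterBound hh k).map_unitBound hh).smul (by norm_num)

/-- Each iteration uses up one delay $2h$ of the initial offset $K\cdot2h$; the index $j=K-k$ counts
what is left. Its price is the factor $6$ and two geometric sums. -/
theorem eval_iterBound_le_geometric {h : ℝ≥0} (hh : 0 < 2 * h) {lam : DecayDual T}
    {η : finalTest T} {D r : ℝ} {K : ℕ} (hr0 : 0 ≤ r) (hr1 : r < 1)
    (H : ∀ m : ℕ, eval (propagateHom T (K * (2 * h) + m * (2 * h)) η) lam ≤ D * r ^ m) (k : ℕ) :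
    ∀ j, j + k = K → ∀ m : ℕ, eval (propagateHom T (j * (2 * h) + m * (2 * h)) η)
      (iterBound h hh lam k) ≤ (6 / (1 - r) ^ 2) ^ k * D * r ^ m := by
  induction k with
  | zero =>
    rintro j rfl m
    simpa [iterBound] using H m
  | succ k ih =>
    intro j hj m
    have h1 := eval_unitBound_le_geometric hh hr0 hr1 (fun m => (by
      simpa [add_mul] using ih (j + 1) (by omega) m)) (q := j * (2 * h)) m
    rw [iterBound, map_smul, smul_eq_mul]
    refine (mul_le_mul_of_nonneg_left h1 (by norm_num)).trans_eq ?_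
    rw [pow_succ, div_div, ← pow_two]
    ring

theorem eval_iterBound_pairing_one_le (hT : 0 < T) {h : ℝ≥0} (hh : 0 < 2 * h) {M : ℝ}
    (hM : 0 ≤ M) (k : ℕ) {η : finalTest T} (hη : ∀ t, 0 ≤ t → 0 ≤ η.1 t) :
    eval η (iterBound h hh (M • pairing T 1) k)
      ≤ (√6 / (1 - Real.exp (-((2 * k + 1) * (h : ℝ) ^ 2 / T)))) ^ (2 * k)
        * Real.exp (-(k ^ 2 * (h : ℝ) ^ 2 / T)) * M * ∫ t in Ioo 0 T, η.1 t := by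
  have hh' : 0 < (h : ℝ) := pos_of_mul_pos_right (show (0 : ℝ) < 2 * h from hh) two_pos.le
  have hI : 0 ≤ ∫ t in Ioo 0 T, η.1 t :=
    setIntegral_nonneg measurableSet_Ioo fun t ht => hη t ht.1.le
  -- From $(k+m)^2=k^2+2km+m^2\ge k^2+(2k+1)m$ for integers $m\ge0$: the largest ratio needed for
  -- geometric decay beyond offset $k$, attained at $m=1$.
  set r := Real.exp (-((2 * k + 1) * (h : ℝ) ^ 2 / T)) with hr
  have hr1 : r < 1 := Real.exp_lt_one_iff.2 (neg_lt_zero.2 (by positivity))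
  have H : ∀ m : ℕ, eval (propagateHom T (k * (2 * h) + m * (2 * h)) η) (M • pairing T 1)
      ≤ (Real.exp (-(k ^ 2 * (h : ℝ) ^ 2 / T)) * M * ∫ t in Ioo 0 T, η.1 t) * r ^ m := by
    intro m
    rw [map_smul, eval_propagateHom_pairing_one hT, smul_eq_mul]
    have h1 := setIntegral_propagate_le hT η.2 hη (NNReal.coe_nonneg (k * (2 * h) + m * (2 * h)))
    have h2 : Real.exp (-(((k * (2 * h) + m * (2 * h) : ℝ≥0) : ℝ) ^ 2 / (4 * T)))
        ≤ Real.exp (-(k ^ 2 * (h : ℝ) ^ 2 / T)) * r ^ m := by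
      rw [hr, ← Real.exp_nat_mul, ← Real.exp_add, Real.exp_le_exp]
      have hm : (m : ℝ) ≤ (m : ℝ) ^ 2 := by exact_mod_cast Nat.le_self_pow two_ne_zero m
      have h3 : (((k * (2 * h) + m * (2 * h) : ℝ≥0) : ℝ) ^ 2 / (4 * T))
          = k ^ 2 * (h : ℝ) ^ 2 / T + (2 * k * m + m ^ 2) * ((h : ℝ) ^ 2 / T) := by
        push_cast
        field_simp
        ring
      have h4 : (m : ℝ) * ((h : ℝ) ^ 2 / T) ≤ (m : ℝ) ^ 2 * ((h : ℝ) ^ 2 / T) := by gcongr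
      rw [h3]
      linarith [show (m : ℝ) * (-((2 * k + 1) * (h : ℝ) ^ 2 / T))
        = -(2 * k * m * ((h : ℝ) ^ 2 / T)) - m * ((h : ℝ) ^ 2 / T) by ring]
    calc M * _ ≤ M * ((Real.exp (-(k ^ 2 * (h : ℝ) ^ 2 / T)) * r ^ m)
          * ∫ t in Ioo 0 T, η.1 t) := by
          gcongr
          exact h1.trans (mul_le_mul_of_nonneg_right h2 hI)
      _ = _ := by ring
  have h0 := eval_iterBound_le_geometric hh (Real.exp_pos _).le hr1 H k 0 (zero_add k) 0
  simp only [Nat.cast_zero, zero_mul, add_zero, propagateHom_zero, pow_zero, mul_one] at h0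
  refine h0.trans_eq ?_
  rw [pow_mul, div_pow √6, Real.sq_sqrt (by norm_num)]
  ring

section Iteration

variable {N : ℕ} {x : ℕ → ℝ} {w : ℕ → ℕ → ℝ → ℝ}

theorem IsIteration.dominated (hT : 0 < T) (hw : IsIteration N x T (1 / 4) w) (hN : 1 ≤ N)
    (hx : ∀ i ∈ Finset.Icc 1 N, x (i - 1) < x i) {h : ℝ≥0} (hh : 0 < 2 * h)
    (hlen : ∀ i ∈ Finset.Icc 1 N, h ≤ len x i) {M : ℝ} (hM0 : 0 ≤ M)
    (hM : ∀ i ∈ Finset.Ioo 0 N, ∀ᵐ t ∂volume.restrict (Ioo 0 T), |w 0 i t| ≤ M) (k : ℕ) :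
    ∀ i ≤ N, Dominated (pairing T (w k i)) (iterBound h hh (M • pairing T 1) k) := by
  have hlam : ∀ k, DelayAntitone (iterBound h hh (M • pairing T 1) k) :=
    ((delayAntitone_pairing_one hT).smul hM0).map_iterBound hh
  have hint : ∀ k i, i ≤ N → IntegrableOn (w k i) (Ioo 0 T) := fun k i hi =>
    (hw.step k).integrableOn hN hi
  have hzero : ∀ k i, i ≤ N → (∀ᵐ t ∂volume.restrict (Ioo 0 T), w k i t = 0) →
      Dominated (pairing T (w k i)) (iterBound h hh (M • pairing T 1) k) := fun k i hi h0 => by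
    have : pairing T (w k i) = 0 := DecayDual.ext fun η => by
      rw [eval_pairing hT (hint k i hi), map_zero]
      refine integral_eq_zero_of_ae ?_
      filter_upwards [h0] with t ht
      simp [ht]
    rw [this]
    exact (hlam k).self.zero
  have hcases : ∀ i ≤ N, i = 0 ∨ i = N ∨ i ∈ Finset.Ioo 0 N := fun i hi => by
    rw [Finset.mem_Ioo]
    omega
  induction k with
  | zero =>
    intro i hi
    rcases hcases i hi with rfl | rfl | hi'
    · exact hzero 0 0 hi (hw.left_eq_zero 0)
    · exact hzero 0 i hi (hw.right_eq_zero 0)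
    · exact dominated_pairing_of_ae_le hT (hint 0 i hi) (hM i hi')
  | succ k ih =>
    intro i hi
    rcases hcases i hi with rfl | rfl | hi'
    · exact hzero _ 0 hi (hw.left_eq_zero _)
    · exact hzero _ i hi (hw.right_eq_zero _)
    · exact (hw.step k).dominated hh hT hx hlen
        (fun j hj => hint (k + 1) j (Finset.mem_Ioo.1 hj).2.le) (hw.left_eq_zero k)
        (hw.right_eq_zero k) (hlam k) ih hi'

theorem IsIteration.ae_abs_le (hT : 0 < T) (hw : IsIteration N x T (1 / 4) w) (hN : 1 ≤ N)
    (hx : ∀ i ∈ Finset.Icc 1 N, x (i - 1) < x i) {h : ℝ} (hh : 0 < h)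
    (hlen : ∀ i ∈ Finset.Icc 1 N, h ≤ x i - x (i - 1)) {M : ℝ} (hM0 : 0 ≤ M)
    (hM : ∀ i ∈ Finset.Ioo 0 N, ∀ᵐ t ∂volume.restrict (Ioo 0 T), |w 0 i t| ≤ M) (k : ℕ) {i : ℕ}
    (hi : i ≤ N) : ∀ᵐ t ∂volume.restrict (Ioo 0 T), |w k i t|
      ≤ (√6 / (1 - Real.exp (-((2 * k + 1) * h ^ 2 / T)))) ^ (2 * k)
        * Real.exp (-(k ^ 2 * h ^ 2 / T)) * M := by
  lift h to ℝ≥0 using hh.le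
  have hh2 : 0 < 2 * h := mul_pos two_pos hh
  refine ae_abs_le_of_eval_le hT ((hw.step k).integrableOn hN hi)
    (mul_nonneg (mul_nonneg (Even.pow_nonneg (even_two_mul k) _) (Real.exp_pos _).le) hM0)
    fun η hη => ?_
  refine (hw.dominated hT hN hx hh2 (fun i hi => ?_) hM0 hM k i hi η hη).trans
    (eval_iterBound_pairing_one_le hT hh2 hM0 k hη)
  exact NNReal.le_toNNReal_of_coe_le (hlen i hi)

theorem ae_abs_le_maxNorm {v : ℕ → ℝ → ℝ} (hv : maxNorm N T v ≠ ⊤) {i : ℕ}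
    (hi : i ∈ Finset.Ioo 0 N) :
    ∀ᵐ t ∂volume.restrict (Ioo 0 T), |v i t| ≤ (maxNorm N T v).toReal := by
  have hle : eLpNorm (v i) ⊤ (volume.restrict (Ioo 0 T)) ≤ maxNorm N T v :=
    le_iSup₂ (f := fun i (_ : i ∈ Finset.Ioo 0 N) =>
      eLpNorm (v i) ⊤ (volume.restrict (Ioo 0 T))) i hi
  rw [eLpNorm_exponent_top] at hle
  filter_upwards [enorm_ae_le_eLpNormEssSup (v i) (volume.restrict (Ioo 0 T))] with t ht
  rw [← Real.norm_eq_abs, ← toReal_enorm]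
  exact ENNReal.toReal_mono hv (ht.trans hle)

theorem maxNorm_le_of_ae_abs_le {v : ℕ → ℝ → ℝ} {C : ℝ}
    (h : ∀ i ∈ Finset.Ioo 0 N, ∀ᵐ t ∂volume.restrict (Ioo 0 T), |v i t| ≤ C) :
    maxNorm N T v ≤ ENNReal.ofReal C := iSup₂_le fun i hi => by
  rw [eLpNorm_exponent_top]
  exact eLpNormEssSup_le_of_ae_bound (h i hi)

theorem maxNorm_lt_top {v : ℕ → ℝ → ℝ}
    (h : ∀ i ∈ Finset.Ioo 0 N, MemLp (v i) ⊤ (volume.restrict (Ioo 0 T))) :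
    maxNorm N T v < ⊤ := by
  rw [maxNorm, ← Finset.sup_eq_iSup, Finset.sup_lt_iff (by simp)]
  exact fun i hi => (h i hi).2

/-- For $k\ge1$ the denominator is at least $1-e^{-y}$, so the bound is at most $(q^2e^{-ky})^kM$
with fixed $q$. Its $k$-th root is at most $q^2e^{-ky}\max(1,M)$, since $M^{1/k}\le\max(1,M)$. -/
theorem tendsto_rpow_of_le {f : ℕ → ENNReal} {M : ENNReal} (hM : M ≠ ⊤) {y : ℝ} (hy : 0 < y)
    (hf : ∀ k : ℕ, f k ≤ ENNReal.ofReal ((√6 / (1 - Real.exp (-((2 * k + 1) * y)))) ^ (2 * k)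
      * Real.exp (-(k ^ 2 * y))) * M) :
    Tendsto (fun k : ℕ => f k ^ (1 / (k : ℝ))) atTop (𝓝 0) := by
  set q := √6 / (1 - Real.exp (-y)) with hq
  have hr : Real.exp (-y) < 1 := Real.exp_lt_one_iff.2 (neg_lt_zero.2 hy)
  have hlim : Tendsto (fun k : ℕ => ENNReal.ofReal (q ^ 2 * Real.exp (-(k * y))) * max 1 M)
      atTop (𝓝 0) := by
    have h1 : Tendsto (fun k : ℕ => q ^ 2 * Real.exp (-(k * y))) atTop (𝓝 0) := by
      simpa using (Real.tendsto_exp_neg_atTop_nhds_zero.comp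
        (tendsto_natCast_atTop_atTop.atTop_mul_const hy)).const_mul (q ^ 2)
    simpa using ENNReal.Tendsto.mul_const (b := max 1 M) (ENNReal.tendsto_ofReal h1)
      (Or.inr (by simp [hM]))
  refine tendsto_of_tendsto_of_tendsto_of_le_of_le' tendsto_const_nhds hlim
    (Eventually.of_forall fun _ => zero_le) ?_
  filter_upwards [eventually_ge_atTop 1] with k hk
  have hk0 : (0 : ℝ) < k := by exact_mod_cast hk
  have hexp : Real.exp (-((2 * k + 1) * y)) ≤ Real.exp (-y) :=
    Real.exp_le_exp.2 (by nlinarith)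
  have h1 : (√6 / (1 - Real.exp (-((2 * k + 1) * y)))) ^ (2 * k) * Real.exp (-(k ^ 2 * y))
      ≤ (q ^ 2 * Real.exp (-(k * y))) ^ k := by
    rw [mul_pow, ← pow_mul, ← Real.exp_nat_mul,
      show (k : ℝ) * -(k * y) = -(k ^ 2 * y) by ring, hq]
    have : 0 < 1 - Real.exp (-y) := by linarith
    have h2 : 0 ≤ √6 / (1 - Real.exp (-((2 * k + 1) * y))) :=
      div_nonneg (by positivity) (by linarith)
    gcongr
  calc f k ^ (1 / (k : ℝ))
      ≤ (ENNReal.ofReal (q ^ 2 * Real.exp (-(k * y))) ^ k * max 1 M) ^ (1 / (k : ℝ)) := by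
        refine ENNReal.rpow_le_rpow ((hf k).trans ?_) (by positivity)
        rw [← ENNReal.ofReal_pow (by positivity)]
        gcongr
        exact le_max_right _ _
    _ = ENNReal.ofReal (q ^ 2 * Real.exp (-(k * y))) * max 1 M ^ (1 / (k : ℝ)) := by
        rw [ENNReal.mul_rpow_of_nonneg _ _ (by positivity), ← ENNReal.rpow_natCast,
          ← ENNReal.rpow_mul, mul_one_div_cancel hk0.ne', ENNReal.rpow_one]
    _ ≤ _ := by
        gcongr
        refine (ENNReal.rpow_le_rpow_of_exponent_le (le_max_left _ _) ?_).trans_eq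
          (ENNReal.rpow_one _)
        rw [div_le_one hk0]
        exact_mod_cast hk

end Iteration

end NNWR

/-! ### The convergence theorem -/

theorem theorem4 (N : ℕ) (hN : 2 ≤ N) (L T : ℝ) (hT : 0 < T) (x : ℕ → ℝ)
    (hx0 : x 0 = 0) (hxN : x N = L) (hx : ∀ i ∈ Finset.Icc 1 N, x (i - 1) < x i)
    (hmin : ℝ) (hhmin : IsLeast ((fun i => x i - x (i - 1)) '' (Set.Icc 1 N)) hmin)
    (w : ℕ → ℕ → ℝ → ℝ) (hw : NNWR.IsIteration N x T (1 / 4) w)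
    (hw0 : ∀ i ∈ Finset.Ioo 0 N, MemLp (w 0 i) ⊤ (volume.restrict (Set.Ioo 0 T))) :
    (∀ k : ℕ, NNWR.maxNorm N T (w k) ≤
      ENNReal.ofReal
        ((Real.sqrt 6 / (1 - Real.exp (-((2 * k + 1) * hmin ^ 2 / T)))) ^ (2 * k) *
          Real.exp (-(k ^ 2 * hmin ^ 2 / T))) * NNWR.maxNorm N T (w 0)) ∧
    Tendsto (fun k : ℕ => NNWR.maxNorm N T (w k) ^ (1 / (k : ℝ))) atTop (𝓝 0) := by
  have hpos : 0 < hmin := by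
    obtain ⟨i, hi, rfl⟩ := hhmin.1
    exact sub_pos.2 (hx i (Finset.mem_Icc.2 hi))
  have hlen : ∀ i ∈ Finset.Icc 1 N, hmin ≤ x i - x (i - 1) := fun i hi =>
    hhmin.2 ⟨i, Finset.mem_Icc.1 hi, rfl⟩
  have hM := (NNWR.maxNorm_lt_top hw0).ne
  have main : ∀ k : ℕ, NNWR.maxNorm N T (w k) ≤
      ENNReal.ofReal
        ((Real.sqrt 6 / (1 - Real.exp (-((2 * k + 1) * hmin ^ 2 / T)))) ^ (2 * k) *
          Real.exp (-(k ^ 2 * hmin ^ 2 / T))) * NNWR.maxNorm N T (w 0) := by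
    intro k
    refine (NNWR.maxNorm_le_of_ae_abs_le fun i hi => hw.ae_abs_le hT (by omega) hx hpos hlen
      ENNReal.toReal_nonneg (fun i hi => NNWR.ae_abs_le_maxNorm hM hi) k
      (Finset.mem_Ioo.1 hi).2.le).trans_eq ?_
    rw [ENNReal.ofReal_mul (mul_nonneg (Even.pow_nonneg (even_two_mul k) _) (Real.exp_pos _).le),
      ENNReal.ofReal_toReal hM]
  refine ⟨main, NNWR.tendsto_rpow_of_le hM (y := hmin ^ 2 / T) (by positivity) fun k => ?_⟩
  simpa only [mul_div_assoc] using main k
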